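/- **Setting.** Let $N\ge 1$, $M\ge 0$, and let $A(1,\cdot),\dots,A(M,\cdot)$ be complex-valued wide-sense stationary signals on $\mathbb R$ (finite second moments, constant mean, $\mathbb E[A(m,t)\overline{A(m,t-\tau)}]=R_m(\tau)$), mutually uncorrelated: $\mathbb E[A(i,t)\overline{A(j,t-\tau)}]=0$ for all $i\ne j$ and all $t,\tau$. Each $A(m,\cdot)$ has a power spectral density $S_m\ge 0$, $S_m\in L^1(\mathbb R)$, $R_m(\tau)=\int S_m(f)e^{2\pi i f\tau}\,df$, which vanishes outside a Lebesgue measurable set $\mathcal B_m$, and $B:=\sum_{m}\mu(\mathcal B_m)<\infty$. Let $U\in\mathbb R^{N\times M}$ have rank $M$ and let $X=UA$, that is $X(n,t)=\sum_m U_{nm}A(m,t)$. The total average density of a set $\mathcal S$ of pairs (label, instant) is $D(\mathcal S)=\liminf_{t\to\infty}\frac{|\{(\kappa,s)\in\mathcal S:\ |s|\le t\}|}{2tN}$; the label is the channel $n\in\{1,\dots,N\}$, or, for samples of filtered signals, the filtered signal that is sampled (so samples of different filtered signals are counted separately). A *linear reconstruction* from a family of sample values is a square-integrable random variable that is measurable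 with respect to these values and is a mean-square limit of finite linear combinations of them. A *filter output* of $X$ is a signal $Y$ such that, for some sequence of finite weights $c_k(n,s)$ not depending on $t$, $\sum_{n,s}c_k(n,s)X(n,t-s)\to Y(t)$ in mean square for every $t$. **Theorem.** 1. There are a set $\mathcal S\subset\{1,\dots,N\}\times\mathbb R$ with $D(\mathcal S)=B/N$ and linear reconstructions $\hat X(n,t)$ from the samples $X(n_s,t_s)$, $(n_s,t_s)\in\mathcal S$, such that $\mathbb E|X(n,t)-\hat X(n,t)|^2=0$ for all $n,t$. 2. (Multi-band scheme.) Suppose that $f^0<\dots<f^L$ and $\Gamma^l\subset\{1,\dots,M\}$, $0\le l<L$, are such that, up to null sets, $\mathcal B_m=\bigcup_{l:\,m\in\Gamma^l}[f^l,f^{l+1}]$ for every $m$. Then there are sets $\Xi^l\subset\{1,\dots,N\}$ with $|\Xi^l|=|\Gamma^l|$ for which the rows of $U^l_s:=U(\Xi^l,\Gamma^l)$ are linearly independent, and for every such choice and all offsets $\tau^l_n\in\mathbb R$ the following holds. Put $B^l=f^{l+1}-f^l$ and let $h^l$ be the impulse response of the ideal band-pass filter for $[f^l,f^{l+1}]$.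 The convolutions $Y^l(n,\cdot)=X(n,\cdot)*h^l$ exist in mean square and are filter outputs of $X$; the sampling set consisting of the instants $t^l_{n,k}=\tau^l_n+k/B^l$ ($k\in\mathbb Z$), for each subband $l$ and each channel $n\in\Xi^l$, has total density $D=B/N$; and, with $\Phi^l=U(\cdot,\Gamma^l)\,({U^l_s}^{H}U^l_s)^{-1}{U^l_s}^{H}$, $\operatorname{sinc}(x)=\frac{\sin \pi x}{\pi x}$ and $f^{l,c}=\frac{f^l+f^{l+1}}2$, the interpolations $$\sum_{l}\sum_{j\in\Xi^l}\Phi^l_{nj}\sum_{|k|\le K}Y^l(j,t^l_{j,k})\,\operatorname{sinc}\!\big(B^l(t-t^l_{j,k})\big)\,e^{2\pi i f^{l,c}(t-t^l_{j,k})}$$ converge in mean square, as $K\to\infty$, to linear reconstructions $\hat X(n,t)$ from these samples with $\mathbb E|X(n,t)-\hat X(n,t)|^2=0$, for all $n,t$. 3. (Minimality.) Suppose that $S_m>0$ almost everywhere on $\mathcal B_m$ for every $m$. If finitely many filter outputs $Y_1,\dots,Y_K$ of $X$ are sampled on uniform grids $\tau_i+T_i\mathbb Z$, $T_i>0$, and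 for all $n,t$ there are linear reconstructions $\hat X(n,t)$ from all these samples with $\mathbb E|X(n,t)-\hat X(n,t)|^2=0$, then the total density of the sampling set is at least $B/N$. -/

import Mathlib

open MeasureTheory Filter Topology
open scoped ENNReal

noncomputable section

namespace CorrelatedSampling

variable {Ω : Type*} [MeasurableSpace Ω]

/-! ### Second-order stochastic signals -/

/-- The correlation `E[x(t) conj(y(t - τ))]` of two complex signals. -/
def corr (P : Measure Ω) (x y : ℝ → Ω → ℂ) (t τ : ℝ) : ℂ :=
  ∫ ω, x t ω * (starRingEnd ℂ) (y (t - τ) ω) ∂P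

/-- Wide-sense stationarity: finite second moments, constant mean, and an autocorrelation
that depends on the lag only. -/
structure IsWSS (P : Measure Ω) (x : ℝ → Ω → ℂ) : Prop where
  memLp : ∀ t, MemLp (x t) 2 P
  mean : ∃ c : ℂ, ∀ t, ∫ ω, x t ω ∂P = c
  autocorr : ∀ τ t t', corr P x x t τ = corr P x x t' τ

/-- `S` is the power spectral density of the WSS signal `x`: it is nonnegative, integrable, and
its inverse Fourier transform is the autocorrelation function of `x`. -/
structure HasPSD (P : Measure Ω) (x : ℝ → Ω → ℂ) (S : ℝ → ℝ) : Prop where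
  nonneg : ∀ f, 0 ≤ S f
  integrable : Integrable S
  autocorr : ∀ t τ, corr P x x t τ =
    ∫ f : ℝ, (S f : ℂ) * Complex.exp (2 * Real.pi * Complex.I * f * τ)

/-- The channels are mutually uncorrelated: all cross-correlations vanish identically. -/
def MutuallyUncorrelated {M : ℕ} (P : Measure Ω) (A : Fin M → ℝ → Ω → ℂ) : Prop :=
  ∀ i j, i ≠ j → ∀ t τ, corr P (A i) (A j) t τ = 0

/-- The mixed signals `X = U A`. -/
def mix {N M : ℕ} (U : Matrix (Fin N) (Fin M) ℝ) (A : Fin M → ℝ → Ω → ℂ) :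
    Fin N → ℝ → Ω → ℂ :=
  fun n t ω => ∑ m, (U n m : ℂ) * A m t ω

/-- The total spectral bandwidth: the sum of the Lebesgue measures of the spectral supports. -/
def totalBandwidth {M : ℕ} (B : Fin M → Set ℝ) : ℝ≥0∞ :=
  ∑ m, volume (B m)

/-- The mean-square error `E|x - y|²` (as an extended nonnegative number). -/
def mse (P : Measure Ω) (x y : Ω → ℂ) : ℝ≥0∞ :=
  ∫⁻ ω, ‖x ω - y ω‖ₑ ^ 2 ∂P

/-! ### Sampling sets, density, reconstruction -/

/-- Total average sampling density per channel, for `N` channels, of a set of (label, instant)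
pairs: `liminf_{t → ∞} |S ∩ (labels × [-t, t])| / (2 t N)`.  For samples of the signals
themselves the label is the channel; for samples taken behind filters the label also records the
filter, so that samples of different filtered signals are counted separately. -/
def samplingDensity {κ : Type*} (N : ℕ) (S : Set (κ × ℝ)) : ℝ≥0∞ :=
  liminf (fun t : ℝ =>
    (((S ∩ {p | p.2 ∈ Set.Icc (-t) t}).encard : ℕ∞) : ℝ≥0∞) / ENNReal.ofReal (2 * t * N)) atTop

/-- `Z` is a linear reconstruction from the sample values `Y i`: it is a function of the sample
values (measurable for the σ-algebra which they generate) and a mean-square limit of finite linear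
combinations of them. -/
def IsLinearReconstruction (P : Measure Ω) {ι : Type*} (Y : ι → Ω → ℂ) (Z : Ω → ℂ) : Prop :=
  Measurable[⨆ i, MeasurableSpace.comap (Y i) inferInstance] Z ∧ MemLp Z 2 P ∧
    ∀ ε : ℝ≥0∞, 0 < ε → ∃ c : ι →₀ ℂ,
      eLpNorm (fun ω => Z ω - c.sum fun i a => a * Y i ω) 2 P ≤ ε

/-! ### Filters -/

/-- `y = x ∗ h` in the mean-square sense: `y(t)` is the limit in `L²(P)`, as `R → ∞`, of the
`L²(P)`-valued integrals of `h(s) x(t - s)` over `[-R, R]`. -/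
def IsConvolution (P : Measure Ω) (h : ℝ → ℂ) (x y : ℝ → Ω → ℂ) : Prop :=
  ∃ (hx : ∀ t, MemLp (x t) 2 P) (hy : ∀ t, MemLp (y t) 2 P), ∀ t,
    (∀ R : ℝ, IntervalIntegrable (fun s => h s • (hx (t - s)).toLp (x (t - s))) volume (-R) R) ∧
    Tendsto (fun R : ℝ => ∫ s in (-R)..R, h s • (hx (t - s)).toLp (x (t - s))) atTop
      (𝓝 ((hy t).toLp (y t)))

/-- `y` is the output of a time-invariant linear (mean-square) filter with the `N` inputs `X`:
a mean-square limit, with the same weights at every instant, of finite linear combinations of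
translates of the inputs. -/
def IsFilterOutput {N : ℕ} (P : Measure Ω) (X : Fin N → ℝ → Ω → ℂ) (y : ℝ → Ω → ℂ) : Prop :=
  (∀ t, MemLp (y t) 2 P) ∧
    ∃ c : ℕ → (Fin N × ℝ →₀ ℂ), ∀ t, Tendsto (fun k => eLpNorm (fun ω =>
      y t ω - (c k).sum fun p a => a * X p.1 (t - p.2) ω) 2 P) atTop (𝓝 0)

/-- Impulse response of the ideal band-pass filter for `[a, b]`, i.e. the inverse Fourier transform
of the indicator function of `[a, b]`. -/
def bandPass (a b : ℝ) (s : ℝ) : ℂ :=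
  ∫ f in a..b, Complex.exp (2 * Real.pi * Complex.I * f * s)

/-! ### The multi-band scheme -/

section MultiBand

variable {N M L : ℕ}

/-- The `l`-th subband `[f^l, f^{l+1}]` for the sequence of edges `e`. -/
def subband (e : Fin (L + 1) → ℝ) (l : Fin L) : Set ℝ :=
  Set.Icc (e l.castSucc) (e l.succ)

/-- The bandwidth of the `l`-th subband, which is also its temporal sampling rate. -/
def width (e : Fin (L + 1) → ℝ) (l : Fin L) : ℝ :=
  e l.succ - e l.castSucc

/-- The edges `e` and the active sets `Γ l` of latent sources describe the spectral supports:
up to null sets, each support is the union of the subbands in which the source is active. -/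
def IsSubbandDivision (B : Fin M → Set ℝ) (e : Fin (L + 1) → ℝ)
    (Γ : Fin L → Finset (Fin M)) : Prop :=
  StrictMono e ∧ ∀ m, B m =ᵐ[volume] ⋃ l ∈ {l | m ∈ Γ l}, subband e l

/-- For each subband, `Ξ l` selects as many channels as there are active sources, such that the
corresponding rows of `U(·, Γ l)` are linearly independent. -/
def IsChannelSelection (U : Matrix (Fin N) (Fin M) ℝ) (Γ : Fin L → Finset (Fin M))
    (Ξ : Fin L → Finset (Fin N)) : Prop :=
  ∀ l, (Ξ l).card = (Γ l).card ∧
    LinearIndependent ℝ (fun i : Ξ l => fun j : Γ l => U i j)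

/-- The `k`-th sampling instant in subband `l` on channel `n`, with an arbitrary offset. -/
def instant (e : Fin (L + 1) → ℝ) (τ : Fin L → Fin N → ℝ) (l : Fin L) (n : Fin N) (k : ℤ) : ℝ :=
  τ l n + k / width e l

/-- The sampling set of the multi-band scheme, labelled by (subband, channel). -/
def multiBandSet (e : Fin (L + 1) → ℝ) (Ξ : Fin L → Finset (Fin N)) (τ : Fin L → Fin N → ℝ) :
    Set ((Fin L × Fin N) × ℝ) :=
  {p | p.1.2 ∈ Ξ p.1.1 ∧ ∃ k : ℤ, p.2 = instant e τ p.1.1 p.1.2 k}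

/-- The temporal interpolation kernel `sinc(B^l u) exp(2 π i f^{l,c} u)` with the normalized sinc
function and the centre frequency `f^{l,c}` of the subband. -/
def kernel (e : Fin (L + 1) → ℝ) (l : Fin L) (u : ℝ) : ℂ :=
  (Real.sinc (Real.pi * (width e l * u)) : ℂ) *
    Complex.exp (2 * Real.pi * Complex.I * ((e l.castSucc + e l.succ) / 2 : ℝ) * u)

/-- The spatial interpolation operator `U(·,Γ) (U_sᴴ U_s)⁻¹ U_sᴴ` where `U_s = U(Ξ, Γ)`. -/
def spatialInterp (U : Matrix (Fin N) (Fin M) ℝ) (Γ : Finset (Fin M)) (Ξ : Finset (Fin N)) :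
    Matrix (Fin N) Ξ ℝ :=
  let Ul : Matrix (Fin N) Γ ℝ := U.submatrix id (fun j => (j : Fin M))
  let Us : Matrix Ξ Γ ℝ := U.submatrix (fun i => (i : Fin N)) (fun j => (j : Fin M))
  Ul * (Us.conjTranspose * Us)⁻¹ * Us.conjTranspose

/-- The interpolation, in time and then in space and summed over all subbands, of the samples of
the subband signals `Y l n` with indices `|k| ≤ K`. -/
def multiBandInterp (U : Matrix (Fin N) (Fin M) ℝ) (e : Fin (L + 1) → ℝ)
    (Γ : Fin L → Finset (Fin M)) (Ξ : Fin L → Finset (Fin N)) (τ : Fin L → Fin N → ℝ)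
    (Y : Fin L → Fin N → ℝ → Ω → ℂ) (K : ℕ) (n : Fin N) (t : ℝ) (ω : Ω) : ℂ :=
  ∑ l, ∑ j : Ξ l, (spatialInterp U (Γ l) (Ξ l) n j : ℂ) *
    ∑ k ∈ Finset.Icc (-(K : ℤ)) K,
      Y l j (instant e τ l j k) ω * kernel e l (t - instant e τ l j k)

end MultiBand

/-- The sampling set that consists of the uniform grids `τ i + T i ℤ`, labelled by `i`. -/
def uniformSet {K : ℕ} (T τ : Fin K → ℝ) : Set (Fin K × ℝ) :=
  {p | ∃ k : ℤ, p.2 = τ p.1 + k * T p.1}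

end CorrelatedSampling

end

namespace CorrelatedSampling

/-! ### Uniqueness from the values of the Fourier transform at large arguments -/

/-! The theorem is a statement about one Hilbert space. Let `specMeasure S` be the measure on M
copies of the frequency axis with density S_m on the m-th copy. The spectral densities and the
vanishing cross-correlations say exactly that A(m,t) and the exponential exp(2πift) on the m-th copy
have the same Gram matrix. Hence there is an isometry J from L²(`specMeasure S`) into L²(P) that
matches them (`exists_spectral_isometry`). It carries the row U(n,·) times exp(2πift) to X(n,t),
translation in time becomes modulation, and each filter output is J applied to the modulations of
one transfer function.

Part 1. The rows times exponentials with |t| > R are total for every R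
(`span_expLp_topologicalClosure_eq_top`). If g is orthogonal to them, a left inverse of U shows that
each S_m g(m,·) has a Fourier transform of bounded support. It then agrees almost everywhere with an
entire function that vanishes off a set of finite measure, so it is zero. As arbitrarily late
instants suffice, a total family can be chosen so sparsely that it is negligible along a sequence of
windows (`exists_sparse_total_subset`). The density is a liminf, so this family adds nothing to a
grid of rate B, and the union has density exactly B/N.

Part 2. The band-pass filter acts as multiplication by the indicator of the band, and the
interpolation becomes the cardinal series of an exponential on that band. Both approximations are
bounded uniformly and converge off the band edges, so they converge in L². The bounds rest on the
sine integral and on the uniformly bounded primitives of the Dirichlet kernels. Almost every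
spectral point lies in exactly one subband in which its source is active, and there the selected
rows of U determine all rows.

Part 3. Sampling with period T_i cannot distinguish frequencies that differ by a multiple of 1/T_i.
If the rates add up to less than B, consider large boxes in the group generated by the 1/T_i. Their
size grows polynomially, so some box hardly changes when it is enlarged by a fixed amount.
Integrating over a base frequency then yields finitely many shifted copies of a set of positive
measure inside the supports, with more copies than alias classes (`exists_pattern`). The vanishing
of all samples is an underdetermined linear system over the measurable functions; a nonzero solution
is a spectrum orthogonal to every sample (`exists_orthogonal_function`), which contradicts totality.
-/

open scoped FourierTransform in
/-- The Fourier transform is self-adjoint. -/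
theorem integral_fourier_mul_eq {f h : ℝ → ℂ} (hf : Integrable f) (hh : Integrable h) :
    ∫ x, 𝓕 f x * h x = ∫ x, f x * 𝓕 h x := by
  simpa using! VectorFourier.integral_fourierIntegral_smul_eq_flip (L := innerₗ ℝ)
    Real.continuous_fourierChar continuous_inner hf hh

open scoped FourierTransform SchwartzMap in
/-- Fourier inversion almost everywhere, for an integrable function with integrable Fourier
transform. -/
theorem ae_eq_fourierInv_fourier {G : ℝ → ℂ} (hG : Integrable G) (hF : Integrable (𝓕 G)) :
    ∀ᵐ x, G x = 𝓕⁻ (𝓕 G) x := by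
  have hcont : Continuous (𝓕⁻ (𝓕 G)) := by
    rw [Real.fourierInv_eq_fourier_comp_neg]
    exact VectorFourier.fourierIntegral_continuous Real.continuous_fourierChar
      (by fun_prop) hF.comp_neg
  -- Both sides are tested against smooth compactly supported g. With g = 𝓕 ψ, ψ Schwartz,
  -- self-adjointness turns either pairing into ∫ ψ · 𝓕 G.
  refine ae_eq_of_integral_contDiff_smul_eq hG.locallyIntegrable hcont.locallyIntegrable ?_
  intro g hg hgs
  have hg1 : HasCompactSupport (fun x => (g x : ℂ)) :=
    hgs.comp_left (g := fun x : ℝ => (x : ℂ)) (by simp)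
  have hg2 : ContDiff ℝ (⊤ : ℕ∞) (fun x => (g x : ℂ)) := Complex.ofRealCLM.contDiff.comp hg
  obtain ⟨φ, hφ⟩ : ∃ φ : 𝓢(ℝ, ℂ), ∀ x, φ x = g x := ⟨hg1.toSchwartzMap hg2, fun _ => rfl⟩
  obtain ⟨ψ, hψ⟩ : ∃ ψ : 𝓢(ℝ, ℂ), ψ = 𝓕⁻ φ := ⟨_, rfl⟩
  have hφψ : 𝓕 (ψ : ℝ → ℂ) = φ := by
    rw [← SchwartzMap.fourier_coe, hψ, FourierTransform.fourier_fourierInv_eq]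
  have e1 : ∫ x, g x • G x = ∫ x, ψ x * 𝓕 G x := by
    rw [← integral_fourier_mul_eq ψ.integrable hG, hφψ]
    simp only [hφ, Complex.real_smul]
  have e2 : ∫ x, g x • 𝓕⁻ (𝓕 G) x = ∫ x, ψ x * 𝓕 G x := by
    have : ∫ x, g x • 𝓕⁻ (𝓕 G) x = ∫ x, φ x * 𝓕 (fun x => 𝓕 G (-x)) x := by
      rw [Real.fourierInv_eq_fourier_comp_neg]
      simp only [hφ, Complex.real_smul]
    rw [this, ← integral_fourier_mul_eq φ.integrable hF.comp_neg, ← integral_neg_eq_self]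
    refine integral_congr_ae (Eventually.of_forall fun x => ?_)
    simp only [neg_neg, hψ, SchwartzMap.fourierInv_coe, Real.fourierInv_eq_fourier_neg]
  rw [e1, e2]

/-- The Laplace-type integral of a compactly supported continuous function is entire. -/
theorem differentiable_integral_exp_mul {F : ℝ → ℂ} (hF : Continuous F) (a b : ℝ) :
    Differentiable ℂ (fun z : ℂ =>
      ∫ l in a..b, Complex.exp (2 * Real.pi * Complex.I * l * z) * F l) := by
  intro z₀
  have := (intervalIntegral.hasDerivAt_integral_of_dominated_loc_of_deriv_le (μ := volume)
    (a := a) (b := b) (x₀ := z₀)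
    (F := fun z l => Complex.exp (2 * Real.pi * Complex.I * l * z) * F l)
    (F' := fun z l => (Complex.exp (2 * Real.pi * Complex.I * l * z) *
      (2 * Real.pi * Complex.I * l)) * F l)
    (bound := fun l => Real.exp (2 * Real.pi * |l| * (‖z₀‖ + 1)) * (2 * Real.pi * |l|) * ‖F l‖)
    (Metric.ball_mem_nhds z₀ one_pos) (Eventually.of_forall fun z => by fun_prop)
    (Continuous.intervalIntegrable (by fun_prop) _ _) (by fun_prop) ?_
    (Continuous.intervalIntegrable (by fun_prop) _ _) ?_).2
  · exact this.differentiableAt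
  · refine Eventually.of_forall fun l _ z hz => ?_
    rw [norm_mul, norm_mul, Complex.norm_exp]
    have hz' : ‖z‖ ≤ ‖z₀‖ + 1 := by
      have := norm_sub_norm_le z z₀
      rw [Metric.mem_ball, dist_eq_norm] at hz
      linarith
    have h1 : ‖(2 * Real.pi * Complex.I * l : ℂ)‖ = 2 * Real.pi * |l| := by
      simp [abs_of_pos Real.pi_pos]
    have h2 : (2 * Real.pi * Complex.I * l * z : ℂ).re ≤ 2 * Real.pi * |l| * (‖z₀‖ + 1) := by
      refine (Complex.re_le_norm _).trans ?_
      rw [norm_mul, h1]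
      have := Real.pi_pos
      gcongr
    rw [h1]
    have := Real.pi_pos
    gcongr
  · refine Eventually.of_forall fun l _ z hz => ?_
    have h := ((hasDerivAt_id z).const_mul (2 * Real.pi * Complex.I * l : ℂ)).cexp
    simpa using h.mul_const (F l)

open scoped FourierTransform in
/-- An integrable function that vanishes outside a set of finite measure, and whose Fourier
transform has bounded support, is zero. -/
theorem ae_eq_zero_of_integral_exp_eq_zero {G : ℝ → ℂ} (hG : Integrable G) {E : Set ℝ}
    (hE : volume E < ∞) (hsupp : ∀ᵐ f, f ∉ E → G f = 0) {R : ℝ}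
    (h : ∀ l : ℝ, R < |l| → ∫ f : ℝ, Complex.exp (2 * Real.pi * Complex.I * f * l) * G f = 0) :
    ∀ᵐ f, G f = 0 := by
  wlog hR : 0 ≤ R generalizing R
  · exact this (R := 0) (fun l hl => h l (by linarith)) le_rfl
  have hFc : Continuous (𝓕 G) :=
    VectorFourier.fourierIntegral_continuous Real.continuous_fourierChar (by fun_prop) hG
  have hF0 : ∀ l, R < |l| → 𝓕 G l = 0 := fun l hl => by
    rw [Real.fourier_real_eq_integral_exp_smul, ← h (-l) (by simpa using hl)]
    congr 1; ext f
    rw [smul_eq_mul]; congr 2; push_cast; ring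
  have hFs : HasCompactSupport (𝓕 G) := by
    refine HasCompactSupport.intro (isCompact_Icc (a := -R) (b := R)) fun l hl => hF0 l ?_
    rw [Set.mem_Icc, ← abs_le] at hl
    exact not_le.1 hl
  have hFi : Integrable (𝓕 G) := hFc.integrable_of_hasCompactSupport hFs
  -- As the transform lives on [-R, R], the inversion integral makes sense at complex arguments and
  -- gives an entire extension.
  let Φ : ℂ → ℂ := fun z => ∫ l in (-R)..R, Complex.exp (2 * Real.pi * Complex.I * l * z) * 𝓕 G l
  have hΦd : Differentiable ℂ Φ := differentiable_integral_exp_mul hFc _ _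
  have hΦ : ∀ x : ℝ, 𝓕⁻ (𝓕 G) x = Φ x := by
    intro x
    simp only [Φ]
    rw [intervalIntegral.integral_of_le (by linarith), ← integral_Icc_eq_integral_Ioc,
      Real.fourierInv_eq', setIntegral_eq_integral_of_forall_compl_eq_zero]
    · congr 1; ext l
      rw [smul_eq_mul]; congr 2
      simp; ring
    · intro l hl
      rw [Set.mem_Icc, ← abs_le] at hl
      rw [hF0 l (not_le.1 hl), mul_zero]
  have hGΦ : ∀ᵐ x : ℝ, G x = Φ x := by
    filter_upwards [ae_eq_fourierInv_fourier hG hFi] with x hx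
    rw [hx, hΦ]
  have hZ : volume {x : ℝ | Φ x = 0} ≠ 0 := by
    intro h0
    have : volume (Set.univ : Set ℝ) ≤ volume E + volume {x : ℝ | Φ x = 0} := by
      refine le_trans ?_ (measure_union_le _ _)
      refine measure_mono_ae ?_
      filter_upwards [hsupp, hGΦ] with x h1 h2 _
      change x ∈ E ∪ {x : ℝ | Φ x = 0}
      by_cases hx : x ∈ E
      · exact Or.inl hx
      · exact Or.inr (by simp [← h2, h1 hx])
    rw [h0, add_zero, Real.volume_univ] at this
    exact absurd hE (not_lt.2 this)
  -- A real set without accumulation points of this kind is locally null, hence null; so the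
  -- non-null zero set of Φ accumulates somewhere, and the identity theorem applies.
  obtain ⟨x₀, hx₀⟩ : ∃ x₀ : ℝ, ∃ᶠ x in 𝓝[≠] x₀, Φ (x : ℝ) = 0 := by
    by_contra! hcon
    refine hZ (measure_null_of_locally_null _ fun x _ => ⟨{x}, ?_, by simp⟩)
    have := hcon x
    rw [eventually_nhdsWithin_iff] at this
    rw [mem_nhdsWithin_iff_eventually]
    filter_upwards [this] with y hy hy0
    by_contra hne
    exact hy hne hy0
  have hfreq : ∃ᶠ z in 𝓝[≠] (x₀ : ℂ), Φ z = 0 := by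
    have ht : Tendsto (fun x : ℝ => (x : ℂ)) (𝓝[≠] x₀) (𝓝[≠] (x₀ : ℂ)) := by
      refine tendsto_nhdsWithin_iff.2 ⟨?_, ?_⟩
      · exact (Complex.continuous_ofReal.tendsto x₀).mono_left nhdsWithin_le_nhds
      · filter_upwards [self_mem_nhdsWithin] with y hy
        simpa using hy
    exact ht.frequently hx₀
  have hzero : Set.EqOn Φ 0 Set.univ :=
    AnalyticOnNhd.eqOn_zero_of_preconnected_of_frequently_eq_zero
      (fun z _ => hΦd.analyticAt z) isPreconnected_univ (Set.mem_univ _) hfreq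
  filter_upwards [hGΦ] with x hx
  rw [hx, hzero (Set.mem_univ _)]; rfl

/-! ### The impulse response of the ideal band-pass filter -/

/-- The sine integral. -/
noncomputable def sineIntegral (x : ℝ) : ℝ := ∫ y in (0 : ℝ)..x, Real.sinc y

theorem sineIntegral_neg (x : ℝ) : sineIntegral (-x) = -sineIntegral x := by
  unfold sineIntegral
  have := intervalIntegral.integral_comp_neg (a := 0) (b := x) Real.sinc
  simp only [Real.sinc_neg, neg_zero] at this
  rw [this, intervalIntegral.integral_symm]

theorem integral_sin_mul_exp (A y : ℝ) :
    ∫ x in (0 : ℝ)..A, Real.sin x * Real.exp (-(y * x)) =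
      (1 + y ^ 2)⁻¹ - Real.exp (-(A * y)) * (Real.cos A + y * Real.sin A) / (1 + y ^ 2) := by
  have hpos : (0 : ℝ) < 1 + y ^ 2 := by positivity
  rw [intervalIntegral.integral_eq_sub_of_hasDerivAt
    (f := fun x => -(Real.exp (-(y * x)) * (Real.cos x + y * Real.sin x) / (1 + y ^ 2)))]
  · simp only [mul_zero, neg_zero, Real.exp_zero, Real.cos_zero, Real.sin_zero]
    rw [mul_comm y A]; field_simp; ring
  · intro x _
    have h1 : HasDerivAt (fun x => Real.exp (-(y * x))) (Real.exp (-(y * x)) * (-y)) x := by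
      simpa using ((hasDerivAt_id x).const_mul y).neg.exp
    have h2 := (Real.hasDerivAt_cos x).add ((Real.hasDerivAt_sin x).const_mul y)
    convert! ((h1.mul h2).div_const (1 + y ^ 2)).neg using 1
    simp
    field_simp
    ring
  · exact Continuous.intervalIntegrable (by fun_prop) _ _

theorem integral_exp_neg_mul_Ioi {x : ℝ} (hx : 0 < x) :
    ∫ y in Set.Ioi (0 : ℝ), Real.exp (-(y * x)) = x⁻¹ := by
  have := integral_exp_mul_Ioi (a := -x) (by linarith) 0
  simp only [mul_zero, Real.exp_zero] at this
  rw [show x⁻¹ = -1 / -x by field_simp, ← this]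
  congr 1; ext y; ring_nf

theorem integrableOn_exp_neg_mul_Ioi {x : ℝ} (hx : 0 < x) :
    IntegrableOn (fun y => Real.exp (-(y * x))) (Set.Ioi (0 : ℝ)) := by
  refine (integrableOn_exp_mul_Ioi (a := -x) (by linarith) 0).congr_fun (fun y _ => ?_)
    measurableSet_Ioi
  ring_nf

theorem abs_exp_mul_div_le {A y : ℝ} :
    ‖Real.exp (-(A * y)) * (Real.cos A + y * Real.sin A) / (1 + y ^ 2)‖ ≤
      2 * Real.exp (-(y * A)) := by
  have hpos : (0 : ℝ) < 1 + y ^ 2 := by positivity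
  rw [Real.norm_eq_abs, abs_div, abs_mul, abs_of_pos (Real.exp_pos _), abs_of_pos hpos,
    div_le_iff₀ hpos, mul_comm A y, mul_comm 2, mul_assoc]
  refine mul_le_mul_of_nonneg_left ?_ (Real.exp_pos _).le
  calc |Real.cos A + y * Real.sin A| ≤ |Real.cos A| + |y * Real.sin A| := abs_add_le _ _
    _ ≤ 1 + |y| * 1 := by
      rw [abs_mul]
      gcongr
      · exact Real.abs_cos_le_one A
      · exact Real.abs_sin_le_one A
    _ ≤ 2 * (1 + y ^ 2) := by nlinarith [sq_abs y, sq_nonneg (|y| - 1)]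

/-- Insert 1/x = ∫₀^∞ exp(-yx) dy and exchange the integrals. The main term is ∫₀^∞ dy/(1+y²) = π/2,
and the other term carries the factor exp(-Ay), which makes the rate of convergence explicit. -/
theorem sineIntegral_eq {A : ℝ} (hA : 0 < A) :
    sineIntegral A = Real.pi / 2 - ∫ y in Set.Ioi (0 : ℝ),
      Real.exp (-(A * y)) * (Real.cos A + y * Real.sin A) / (1 + y ^ 2) := by
  have hint2 : IntegrableOn (fun y => Real.exp (-(A * y)) * (Real.cos A + y * Real.sin A) /
      (1 + y ^ 2)) (Set.Ioi (0 : ℝ)) := by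
    refine ((integrableOn_exp_neg_mul_Ioi hA).const_mul 2).mono' ?_
      (Eventually.of_forall fun y => abs_exp_mul_div_le)
    refine Continuous.aestronglyMeasurable ?_
    refine Continuous.div (by fun_prop) (by fun_prop) fun y => ?_
    positivity
  have hint : Integrable (Function.uncurry fun x y => Real.sin x * Real.exp (-(y * x)))
      ((volume.restrict (Set.uIoc 0 A)).prod (volume.restrict (Set.Ioi (0 : ℝ)))) := by
    have hcont : Continuous (Function.uncurry fun x y => Real.sin x * Real.exp (-(y * x))) := by
      unfold Function.uncurry; fun_prop
    rw [integrable_prod_iff hcont.aestronglyMeasurable, Set.uIoc_of_le hA.le]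
    constructor
    · filter_upwards [ae_restrict_mem measurableSet_Ioc] with x hx
      have := (integrableOn_exp_neg_mul_Ioi hx.1).const_mul (Real.sin x)
      exact this
    · have : IntegrableOn (fun x => |Real.sinc x|) (Set.Ioc 0 A) :=
        ((Real.continuous_sinc.abs.intervalIntegrable 0 A).1)
      refine this.congr_fun (fun x hx => ?_) measurableSet_Ioc
      simp only [Function.uncurry, norm_mul, Real.norm_eq_abs, Real.abs_exp]
      rw [integral_const_mul, integral_exp_neg_mul_Ioi hx.1, Real.sinc_of_ne_zero hx.1.ne', abs_div,
        abs_of_pos hx.1]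
      rfl
  calc sineIntegral A = ∫ x in (0 : ℝ)..A, ∫ y in Set.Ioi (0 : ℝ),
        Real.sin x * Real.exp (-(y * x)) := by
        unfold sineIntegral
        rw [intervalIntegral.integral_of_le hA.le, intervalIntegral.integral_of_le hA.le]
        refine setIntegral_congr_fun measurableSet_Ioc fun x hx => ?_
        rw [integral_const_mul, integral_exp_neg_mul_Ioi hx.1, Real.sinc_of_ne_zero hx.1.ne']
        rfl
    _ = ∫ y in Set.Ioi (0 : ℝ), ((1 + y ^ 2)⁻¹ -
          Real.exp (-(A * y)) * (Real.cos A + y * Real.sin A) / (1 + y ^ 2)) := by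
        rw [intervalIntegral_integral_swap hint]
        simp_rw [integral_sin_mul_exp]
    _ = _ := by
        rw [integral_sub integrable_inv_one_add_sq.integrableOn hint2, integral_Ioi_inv_one_add_sq]
        simp

theorem abs_sineIntegral_sub_le {A : ℝ} (hA : 0 < A) :
    |sineIntegral A - Real.pi / 2| ≤ 2 / A := by
  rw [sineIntegral_eq hA, sub_sub_cancel_left, abs_neg, ← Real.norm_eq_abs]
  refine (norm_integral_le_of_norm_le ((integrableOn_exp_neg_mul_Ioi hA).const_mul 2)
    (Eventually.of_forall fun y => abs_exp_mul_div_le)).trans_eq ?_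
  rw [integral_const_mul, integral_exp_neg_mul_Ioi hA]; rfl

theorem tendsto_sineIntegral_atTop : Tendsto sineIntegral atTop (𝓝 (Real.pi / 2)) := by
  rw [tendsto_iff_dist_tendsto_zero]
  refine squeeze_zero' (Eventually.of_forall fun _ => dist_nonneg) ?_
    (tendsto_const_nhds.div_atTop tendsto_id (a := 2))
  filter_upwards [eventually_gt_atTop 0] with A hA
  exact abs_sineIntegral_sub_le hA

/-- Up to 1 the bound |sinc| ≤ 1 suffices; beyond 1 the distance from π/2 is at most 2, and π/2 + 2
< 4. -/
theorem abs_sineIntegral_le (x : ℝ) : |sineIntegral x| ≤ 4 := by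
  wlog hx : 0 ≤ x generalizing x
  · have := this (-x) (by linarith)
    rwa [sineIntegral_neg, abs_neg] at this
  rcases le_total x 1 with h1 | h1
  · have := intervalIntegral.norm_integral_le_of_norm_le_const (a := 0) (b := x) (C := 1)
      (f := Real.sinc) fun y _ => Real.abs_sinc_le_one y
    rw [sub_zero, one_mul, abs_of_nonneg hx] at this
    exact this.trans (by linarith)
  · have := abs_sineIntegral_sub_le (A := x) (by linarith)
    have h2 : 2 / x ≤ 2 := div_le_self (by norm_num) h1
    have h3 := Real.pi_lt_four
    have h4 := Real.pi_pos
    rw [abs_le] at this ⊢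
    constructor <;> linarith

theorem hasDerivAt_sineIntegral (x : ℝ) : HasDerivAt sineIntegral (Real.sinc x) x :=
  intervalIntegral.integral_hasDerivAt_right (Real.continuous_sinc.intervalIntegrable _ _)
    (Real.continuous_sinc.stronglyMeasurableAtFilter _ _) Real.continuous_sinc.continuousAt

theorem integral_exp_symm (c R : ℝ) :
    ∫ s in (-R)..R, Complex.exp (2 * Real.pi * Complex.I * c * s) =
      ((2 * R * Real.sinc (2 * Real.pi * R * c) : ℝ) : ℂ) := by
  rcases eq_or_ne c 0 with rfl | hc
  · simp; ring
  · have hc' : (2 * Real.pi * c : ℝ) ≠ 0 := by have := Real.pi_ne_zero; positivity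
    have h := intervalIntegral.integral_comp_mul_left (a := -R) (b := R)
      (fun t : ℝ => Complex.exp (t * Complex.I)) hc'
    rw [mul_neg, integral_exp_mul_I_eq_sinc] at h
    have e : ∀ s : ℝ, Complex.exp (2 * Real.pi * Complex.I * c * s) =
        Complex.exp (((2 * Real.pi * c * s : ℝ) : ℂ) * Complex.I) := fun s => by
      congr 1; push_cast; ring
    simp_rw [e, h]
    rw [show 2 * Real.pi * R * c = 2 * Real.pi * c * R by ring, Complex.real_smul]
    have hc'' : (c : ℂ) ≠ 0 := by exact_mod_cast hc
    have hpi : (Real.pi : ℂ) ≠ 0 := by exact_mod_cast Real.pi_ne_zero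
    push_cast
    field_simp

/-- After exchanging the integrals, a frequency u of the band contributes a sinc of u - f, whose
primitive is the sine integral. The truncated response is thus a difference of two sine integrals,
which yields both its boundedness and its limit. -/
theorem integral_bandPass_mul_exp (a b R f : ℝ) :
    ∫ s in (-R)..R, bandPass a b s * Complex.exp (2 * Real.pi * Complex.I * f * (-s : ℝ)) =
      (((sineIntegral (2 * Real.pi * R * (b - f)) - sineIntegral (2 * Real.pi * R * (a - f))) /
        Real.pi : ℝ) : ℂ) := by
  have e1 : ∀ s : ℝ, bandPass a b s * Complex.exp (2 * Real.pi * Complex.I * f * (-s : ℝ)) =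
      ∫ u in a..b, Complex.exp (2 * Real.pi * Complex.I * (u - f : ℝ) * s) := fun s => by
    unfold bandPass
    rw [← intervalIntegral.integral_mul_const]
    congr 1; ext u
    rw [← Complex.exp_add]; congr 1; push_cast; ring
  simp_rw [e1]
  rw [intervalIntegral_intervalIntegral_swap]
  · simp_rw [integral_exp_symm]
    rw [intervalIntegral.integral_ofReal]
    congr 1
    rw [intervalIntegral.integral_eq_sub_of_hasDerivAt
      (f := fun u => sineIntegral (2 * Real.pi * R * (u - f)) / Real.pi)]
    · ring
    · intro u _
      have h1 : HasDerivAt (fun u => 2 * Real.pi * R * (u - f)) (2 * Real.pi * R) u := by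
        simpa using ((hasDerivAt_id u).sub_const f).const_mul (2 * Real.pi * R)
      have h2 := ((hasDerivAt_sineIntegral (2 * Real.pi * R * (u - f))).comp u h1).div_const Real.pi
      convert! h2 using 1
      have := Real.pi_ne_zero
      field_simp
    · have := Real.continuous_sinc
      exact Continuous.intervalIntegrable (by fun_prop) _ _
  · have hc : Continuous (Function.uncurry fun s u : ℝ =>
        Complex.exp (2 * Real.pi * Complex.I * (u - f : ℝ) * s)) := by
      unfold Function.uncurry; fun_prop
    exact (hc.continuousOn.integrableOn_compact (isCompact_uIcc.prod isCompact_uIcc)).mono_set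
      (Set.prod_mono Set.uIoc_subset_uIcc Set.uIoc_subset_uIcc)

/-- Uniform in R and f: this is the dominating constant for the mean-square convergence of the
convolution. -/
theorem norm_integral_bandPass_mul_exp_le (a b R f : ℝ) :
    ‖∫ s in (-R)..R, bandPass a b s *
      Complex.exp (2 * Real.pi * Complex.I * f * (-s : ℝ))‖ ≤ 8 := by
  rw [integral_bandPass_mul_exp, Complex.norm_real, Real.norm_eq_abs, abs_div,
    abs_of_pos Real.pi_pos, div_le_iff₀ Real.pi_pos]
  have h := abs_sub (sineIntegral (2 * Real.pi * R * (b - f)))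
    (sineIntegral (2 * Real.pi * R * (a - f)))
  have h1 := abs_sineIntegral_le (2 * Real.pi * R * (b - f))
  have h2 := abs_sineIntegral_le (2 * Real.pi * R * (a - f))
  have h3 := Real.pi_gt_three
  linarith

/-- The partial frequency responses of the ideal band-pass filter converge to the indicator function
of the band, except at the two edges. -/
theorem tendsto_integral_bandPass_mul_exp {a b f : ℝ} (hab : a < b) (ha : f ≠ a) (hb : f ≠ b) :
    Tendsto (fun R : ℝ => ∫ s in (-R)..R, bandPass a b s *
      Complex.exp (2 * Real.pi * Complex.I * f * (-s : ℝ))) atTop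
      (𝓝 ((Set.Icc a b).indicator (fun _ => 1) f)) := by
  simp_rw [integral_bandPass_mul_exp]
  have hp : ∀ c : ℝ, 0 < c → Tendsto (fun R : ℝ => sineIntegral (2 * Real.pi * R * c)) atTop
      (𝓝 (Real.pi / 2)) := fun c hc => by
    refine tendsto_sineIntegral_atTop.comp ?_
    refine (tendsto_id.const_mul_atTop (r := 2 * Real.pi * c)
      (by have := Real.pi_pos; positivity)).congr fun R => ?_
    simp; ring
  have hn : ∀ c : ℝ, c < 0 → Tendsto (fun R : ℝ => sineIntegral (2 * Real.pi * R * c)) atTop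
      (𝓝 (-(Real.pi / 2))) := fun c hc => by
    refine ((hp (-c) (by linarith)).neg).congr fun R => ?_
    rw [← sineIntegral_neg]; congr 1; ring
  have hpi := Real.pi_ne_zero
  rcases lt_or_gt_of_ne ha with h1 | h1
  · rw [Set.indicator_of_notMem (by simp [h1])]
    have := ((hp (b - f) (by linarith)).sub (hp (a - f) (by linarith))).div_const Real.pi
    rw [sub_self, zero_div] at this
    exact_mod_cast (Complex.continuous_ofReal.tendsto 0).comp this
  rcases lt_or_gt_of_ne hb with h2 | h2
  · rw [Set.indicator_of_mem (Set.mem_Icc.2 ⟨h1.le, h2.le⟩)]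
    have := ((hp (b - f) (by linarith)).sub (hn (a - f) (by linarith))).div_const Real.pi
    rw [show (Real.pi / 2 - -(Real.pi / 2)) / Real.pi = 1 by field_simp; ring] at this
    exact_mod_cast (Complex.continuous_ofReal.tendsto 1).comp this
  · rw [Set.indicator_of_notMem (by simp [h2])]
    have := ((hn (b - f) (by linarith)).sub (hn (a - f) (by linarith))).div_const Real.pi
    rw [sub_self, zero_div] at this
    exact_mod_cast (Complex.continuous_ofReal.tendsto 0).comp this

/-! ### The cardinal series of an exponential -/

/-- A primitive of the Dirichlet kernel. -/
noncomputable def dirichletPrimitive (K : ℕ) (z : ℝ) : ℝ :=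
  z + ∑ k ∈ Finset.range K, Real.sin (2 * Real.pi * (k + 1) * z) / (Real.pi * (k + 1))

/-- The Dirichlet kernel of period one. -/
noncomputable def dirichletKernel (K : ℕ) (z : ℝ) : ℝ :=
  1 + ∑ k ∈ Finset.range K, 2 * Real.cos (2 * Real.pi * (k + 1) * z)

theorem continuous_dirichletKernel (K : ℕ) : Continuous (dirichletKernel K) := by
  unfold dirichletKernel; fun_prop

theorem continuous_dirichletPrimitive (K : ℕ) : Continuous (dirichletPrimitive K) := by
  unfold dirichletPrimitive; fun_prop

theorem hasDerivAt_dirichletPrimitive (K : ℕ) (z : ℝ) :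
    HasDerivAt (dirichletPrimitive K) (dirichletKernel K z) z := by
  unfold dirichletPrimitive dirichletKernel
  refine (hasDerivAt_id z).add (HasDerivAt.fun_sum fun k _ => ?_)
  have h1 : HasDerivAt (fun z => 2 * Real.pi * (k + 1) * z) (2 * Real.pi * (k + 1)) z := by
    simpa using (hasDerivAt_id z).const_mul (2 * Real.pi * (k + 1))
  convert! h1.sin.div_const (Real.pi * (k + 1)) using 1
  have := Real.pi_ne_zero
  field_simp

theorem sin_mul_dirichletKernel (K : ℕ) (z : ℝ) :
    Real.sin (Real.pi * z) * dirichletKernel K z = Real.sin ((2 * K + 1) * Real.pi * z) := by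
  induction K with
  | zero => simp [dirichletKernel]
  | succ K ih =>
    have : dirichletKernel (K + 1) z =
        dirichletKernel K z + 2 * Real.cos (2 * Real.pi * (K + 1) * z) := by
      simp [dirichletKernel, Finset.sum_range_succ, add_assoc]
    rw [this, mul_add, ih]
    have h1 : (2 * ((K + 1 : ℕ) : ℝ) + 1) * Real.pi * z =
      2 * Real.pi * (K + 1) * z + Real.pi * z := by push_cast; ring
    have h2 : (2 * (K : ℝ) + 1) * Real.pi * z =
      2 * Real.pi * (K + 1) * z - Real.pi * z := by ring
    rw [h1, h2, Real.sin_add, Real.sin_sub]; ring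

theorem sum_exp_eq_dirichletKernel (K : ℕ) (z : ℝ) :
    ∑ k ∈ Finset.Icc (-(K : ℤ)) K, Complex.exp (2 * Real.pi * Complex.I * k * z) =
      (dirichletKernel K z : ℂ) := by
  induction K with
  | zero => simp [dirichletKernel]
  | succ K ih =>
    have h1 : Finset.Icc (-((K + 1 : ℕ) : ℤ)) ((K + 1 : ℕ) : ℤ) =
        insert (-((K : ℤ) + 1)) (insert ((K : ℤ) + 1) (Finset.Icc (-(K : ℤ)) K)) := by
      ext k; simp only [Finset.mem_Icc, Finset.mem_insert]; push_cast; omega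
    have : dirichletKernel (K + 1) z =
        dirichletKernel K z + 2 * Real.cos (2 * Real.pi * (K + 1) * z) := by
      simp [dirichletKernel, Finset.sum_range_succ, add_assoc]
    rw [h1, Finset.sum_insert, Finset.sum_insert, ih, this]
    · push_cast
      rw [Complex.cos]
      rw [show 2 * (Real.pi : ℂ) * Complex.I * (-((K : ℂ) + 1)) * z =
        -(2 * Real.pi * ((K : ℂ) + 1) * z) * Complex.I by ring,
        show 2 * (Real.pi : ℂ) * Complex.I * ((K : ℂ) + 1) * z =
        (2 * Real.pi * ((K : ℂ) + 1) * z) * Complex.I by ring]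
      ring
    · simp
    · simp; omega

theorem dirichletPrimitive_neg (K : ℕ) (z : ℝ) :
    dirichletPrimitive K (-z) = -dirichletPrimitive K z := by
  simp [dirichletPrimitive, neg_div, add_comm]

/-- This reflection reduces [0, 1] to [0, 1/2], where 1 / sin(πt) is singular only at 0. -/
theorem dirichletPrimitive_one_sub (K : ℕ) (z : ℝ) :
    dirichletPrimitive K (1 - z) = 1 - dirichletPrimitive K z := by
  unfold dirichletPrimitive
  have : ∀ k : ℕ, Real.sin (2 * Real.pi * (k + 1) * (1 - z)) =
      -Real.sin (2 * Real.pi * (k + 1) * z) := fun k => by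
    rw [← Real.sin_neg, ← Real.sin_add_nat_mul_two_pi (-(2 * Real.pi * (k + 1) * z)) (k + 1)]
    congr 1; push_cast; ring
  simp_rw [this, neg_div, Finset.sum_neg_distrib]; ring

/-- The difference between `1 / sin (π t)` and its principal part at `0`. -/
noncomputable def cosecRemainder (t : ℝ) : ℝ := 1 / Real.sin (Real.pi * t) - 1 / (Real.pi * t)

/-- With y = πt the remainder is (y - sin y) / (y sin y). Jordan's inequality gives sin y ≥ y/2, and
for y ≤ 1 the numerator is of third order. -/
theorem abs_cosecRemainder_le {t : ℝ} (h0 : 0 < t) (h1 : t ≤ 1 / 2) : |cosecRemainder t| ≤ 2 := by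
  unfold cosecRemainder
  have hpi := Real.pi_pos
  set y := Real.pi * t with hy
  have hy0 : 0 < y := by positivity
  have hy1 : y ≤ Real.pi / 2 := by rw [hy]; nlinarith
  have hsin : 2 / Real.pi * y ≤ Real.sin y := Real.mul_le_sin hy0.le hy1
  have hsin1 : y / 2 ≤ Real.sin y := by
    refine le_trans ?_ hsin
    have : 1 / 2 ≤ 2 / Real.pi := by
      rw [div_le_div_iff₀ (by norm_num) hpi]; linarith [Real.pi_lt_four]
    nlinarith
  have hs0 : 0 < Real.sin y := by linarith
  have hle := Real.sin_le hy0.le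
  rw [div_sub_div _ _ hs0.ne' hy0.ne', abs_of_nonneg
    (div_nonneg (by linarith) (by positivity)), div_le_iff₀ (by positivity)]
  rcases le_total y 1 with h | h
  · have := Real.sin_gt_sub_cube hy0
    nlinarith [mul_pos hy0 hy0]
  · nlinarith

theorem measurable_cosecRemainder : Measurable cosecRemainder := by
  unfold cosecRemainder; fun_prop

theorem intervalIntegrable_sin_mul_cosecRemainder (c : ℝ) {z : ℝ} (h0 : 0 ≤ z) (h1 : z ≤ 1 / 2) :
    IntervalIntegrable (fun t => Real.sin (c * t) * cosecRemainder t) volume 0 z := by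
  rw [intervalIntegrable_iff, Set.uIoc_of_le h0]
  refine Measure.integrableOn_of_bounded (M := 2) (by simp) ?_ ?_
  · have := measurable_cosecRemainder
    exact (by fun_prop :
      Measurable fun t => Real.sin (c * t) * cosecRemainder t).aestronglyMeasurable
  · filter_upwards [ae_restrict_mem measurableSet_Ioc] with t ht
    have h2 := abs_cosecRemainder_le ht.1 (ht.2.trans h1)
    have h3 := Real.abs_sin_le_one (c * t)
    rw [norm_mul, Real.norm_eq_abs, Real.norm_eq_abs]
    nlinarith [abs_nonneg (cosecRemainder t), abs_nonneg (Real.sin (c * t))]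

/-- The kernel is sin((2K+1)πt) / sin(πt). The principal part 1/(πt) of the cosecant integrates to
the sine integral and leaves a bounded oscillating integrand. -/
theorem dirichletPrimitive_eq (K : ℕ) {z : ℝ} (h0 : 0 ≤ z) (h1 : z ≤ 1 / 2) :
    dirichletPrimitive K z = sineIntegral ((2 * K + 1) * Real.pi * z) / Real.pi +
      ∫ t in (0 : ℝ)..z, Real.sin ((2 * K + 1) * Real.pi * t) * cosecRemainder t := by
  have hpi := Real.pi_pos
  have e1 : dirichletPrimitive K z = ∫ t in (0 : ℝ)..z, dirichletKernel K t := by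
    rw [intervalIntegral.integral_eq_sub_of_hasDerivAt
      (fun t _ => hasDerivAt_dirichletPrimitive K t)
      ((continuous_dirichletKernel K).intervalIntegrable _ _)]
    simp [dirichletPrimitive]
  have e2 : sineIntegral ((2 * K + 1) * Real.pi * z) / Real.pi =
      ∫ t in (0 : ℝ)..z, (2 * K + 1) * Real.sinc ((2 * K + 1) * Real.pi * t) := by
    rw [intervalIntegral.integral_eq_sub_of_hasDerivAt
      (f := fun t => sineIntegral ((2 * K + 1) * Real.pi * t) / Real.pi)]
    · simp [sineIntegral]
    · intro t _
      have h1 : HasDerivAt (fun t => (2 * K + 1) * Real.pi * t) ((2 * K + 1) * Real.pi) t := by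
        simpa using (hasDerivAt_id t).const_mul ((2 * K + 1) * Real.pi)
      convert! ((hasDerivAt_sineIntegral _).comp t h1).div_const Real.pi using 1
      field_simp
    · have := Real.continuous_sinc
      exact Continuous.intervalIntegrable (by fun_prop) _ _
  rw [e1, e2, ← intervalIntegral.integral_add]
  · rw [intervalIntegral.integral_of_le h0, intervalIntegral.integral_of_le h0]
    refine setIntegral_congr_fun measurableSet_Ioc fun t ht => ?_
    have ht0 := ht.1
    have hs : 0 < Real.sin (Real.pi * t) := by
      refine Real.sin_pos_of_pos_of_lt_pi (by positivity) ?_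
      nlinarith [ht.2]
    rw [Real.sinc_of_ne_zero (by positivity), cosecRemainder, ← sin_mul_dirichletKernel]
    field_simp
    ring
  · have := Real.continuous_sinc
    exact Continuous.intervalIntegrable (by fun_prop) _ _
  · exact intervalIntegrable_sin_mul_cosecRemainder _ h0 h1

/-- The partial sums stay bounded in K although they show the Gibbs phenomenon. On [0, 1/2] the two
terms of `dirichletPrimitive_eq` are at most 2 and 1; the reflection about 1/2 costs one more, and
oddness covers negative z. -/
theorem abs_dirichletPrimitive_le (K : ℕ) {z : ℝ} (hz : |z| ≤ 1) :
    |dirichletPrimitive K z| ≤ 4 := by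
  have key : ∀ z : ℝ, 0 ≤ z → z ≤ 1 / 2 → |dirichletPrimitive K z| ≤ 3 := by
    intro z h0 h1
    rw [dirichletPrimitive_eq K h0 h1]
    have hb := intervalIntegral.norm_integral_le_of_norm_le_const (a := 0) (b := z) (C := 2)
      (f := fun t => Real.sin ((2 * K + 1) * Real.pi * t) * cosecRemainder t) fun t ht => by
        rw [Set.uIoc_of_le h0] at ht
        have h2 := abs_cosecRemainder_le ht.1 (ht.2.trans h1)
        have h3 := Real.abs_sin_le_one ((2 * K + 1) * Real.pi * t)
        rw [norm_mul, Real.norm_eq_abs, Real.norm_eq_abs]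
        nlinarith [abs_nonneg (cosecRemainder t),
          abs_nonneg (Real.sin ((2 * K + 1) * Real.pi * t))]
    rw [sub_zero, abs_of_nonneg h0, Real.norm_eq_abs] at hb
    refine (abs_add_le _ _).trans ?_
    have h4 : |sineIntegral ((2 * K + 1) * Real.pi * z) / Real.pi| ≤ 2 := by
      rw [abs_div, abs_of_pos Real.pi_pos, div_le_iff₀ Real.pi_pos]
      linarith [abs_sineIntegral_le ((2 * K + 1) * Real.pi * z), Real.pi_gt_three]
    linarith
  have key2 : ∀ z : ℝ, 0 ≤ z → z ≤ 1 → |dirichletPrimitive K z| ≤ 4 := by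
    intro z h0 h1
    rcases le_total z (1 / 2) with h | h
    · exact (key z h0 h).trans (by norm_num)
    · have h2 := key (1 - z) (by linarith) (by linarith)
      have h3 := dirichletPrimitive_one_sub K (1 - z)
      rw [sub_sub_cancel] at h3
      rw [h3]
      have := abs_sub (1 : ℝ) (dirichletPrimitive K (1 - z))
      rw [abs_one] at this
      linarith
  rw [abs_le] at hz
  rcases le_total 0 z with h | h
  · exact key2 z h hz.2
  · have := key2 (-z) (by linarith) (by linarith)
    rwa [dirichletPrimitive_neg, abs_neg] at this

-- This is the Riemann–Lebesgue lemma for the bounded remainder cut off to (0, z]: the integral is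
-- the imaginary part of its Fourier transform at -(2K+1)/2.
open scoped FourierTransform in
theorem tendsto_integral_sin_mul_cosecRemainder {z : ℝ} (h0 : 0 ≤ z) (h1 : z ≤ 1 / 2) :
    Tendsto (fun K : ℕ => ∫ t in (0 : ℝ)..z,
      Real.sin ((2 * K + 1) * Real.pi * t) * cosecRemainder t) atTop (𝓝 0) := by
  let g : ℝ → ℂ := (Set.Ioc 0 z).indicator fun t => (cosecRemainder t : ℂ)
  have hRL := Real.tendsto_integral_exp_smul_cocompact g
  have ht : Tendsto (fun K : ℕ => -((2 * (K : ℝ) + 1) / 2)) atTop (cocompact ℝ) := by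
    rw [cocompact_eq_atBot_atTop]
    refine Tendsto.mono_right ?_ le_sup_left
    refine tendsto_neg_atTop_atBot.comp ?_
    refine tendsto_atTop_mono (fun K : ℕ => ?_) tendsto_natCast_atTop_atTop
    linarith
  have := (Complex.continuous_im.tendsto 0).comp (hRL.comp ht)
  rw [Complex.zero_im] at this
  refine this.congr fun K => ?_
  simp only [Function.comp_apply]
  have e : ∀ v : ℝ, (𝐞 (-(v * -((2 * (K : ℝ) + 1) / 2))) • g v) =
      (Set.Ioc 0 z).indicator (fun t => Complex.exp (((2 * K + 1) * Real.pi * t : ℝ) * Complex.I) *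
        (cosecRemainder t : ℂ)) v := fun v => by
    rw [Circle.smul_def, Real.fourierChar_apply]
    by_cases hv : v ∈ Set.Ioc 0 z
    · simp only [g, Set.indicator_of_mem hv, smul_eq_mul]
      congr 2; push_cast; ring
    · simp [g, Set.indicator_of_notMem hv]
  simp_rw [e]
  rw [integral_indicator measurableSet_Ioc, ← Complex.imCLM_apply,
    ← ContinuousLinearMap.integral_comp_comm, intervalIntegral.integral_of_le h0]
  · congr 1; ext t
    rw [Complex.imCLM_apply, Complex.im_mul_ofReal, Complex.exp_ofReal_mul_I_im]
  · refine Measure.integrableOn_of_bounded (M := 2) (by simp) ?_ ?_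
    · have := measurable_cosecRemainder
      exact Measurable.aestronglyMeasurable (by fun_prop)
    · filter_upwards [ae_restrict_mem measurableSet_Ioc] with t ht
      rw [norm_mul, Complex.norm_exp_ofReal_mul_I, one_mul, Complex.norm_real]
      exact abs_cosecRemainder_le ht.1 (ht.2.trans h1)

/-- The sine integral contributes (π/2)/π and the remainder disappears. The open interval is
essential, as the limit is a periodic sawtooth that jumps at the integers. -/
theorem tendsto_dirichletPrimitive {z : ℝ} (h0 : 0 < z) (h1 : z < 1) :
    Tendsto (fun K : ℕ => dirichletPrimitive K z) atTop (𝓝 (1 / 2)) := by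
  have key : ∀ z : ℝ, 0 < z → z ≤ 1 / 2 →
      Tendsto (fun K : ℕ => dirichletPrimitive K z) atTop (𝓝 (1 / 2)) := by
    intro z h0 h1
    have hpi := Real.pi_pos
    have ht : Tendsto (fun K : ℕ => (2 * (K : ℝ) + 1) * Real.pi * z) atTop atTop := by
      refine Tendsto.atTop_mul_const h0 (Tendsto.atTop_mul_const hpi ?_)
      refine tendsto_atTop_mono (fun K : ℕ => ?_) tendsto_natCast_atTop_atTop
      have : (0 : ℝ) ≤ K := by positivity
      linarith
    have := ((tendsto_sineIntegral_atTop.comp ht).div_const Real.pi).add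
      (tendsto_integral_sin_mul_cosecRemainder h0.le h1)
    rw [show Real.pi / 2 / Real.pi + 0 = 1 / 2 by field_simp; simp] at this
    exact this.congr fun K => (dirichletPrimitive_eq K h0.le h1).symm
  rcases le_total z (1 / 2) with h | h
  · exact key z h0 h
  · have := (key (1 - z) (by linarith) (by linarith)).const_sub 1
    rw [show (1 : ℝ) - 1 / 2 = 1 / 2 by norm_num] at this
    refine this.congr fun K => ?_
    rw [← dirichletPrimitive_one_sub, sub_sub_cancel]

/-- Symmetric partial sums of the cardinal series of `x ↦ exp (2 π i u x)` on `[-1/2, 1/2]`. -/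
noncomputable def cardinalSum (u : ℝ) (K : ℕ) (x : ℝ) : ℂ :=
  ∑ k ∈ Finset.Icc (-(K : ℤ)) K,
    (Real.sinc (Real.pi * (u - k)) : ℂ) * Complex.exp (2 * Real.pi * Complex.I * k * x)

theorem hasDerivAt_exp_two_pi (u y : ℝ) :
    HasDerivAt (fun y : ℝ => Complex.exp (2 * Real.pi * Complex.I * u * y))
      (2 * Real.pi * Complex.I * u * Complex.exp (2 * Real.pi * Complex.I * u * y)) y := by
  have h : HasDerivAt (fun y : ℝ => (2 * Real.pi * Complex.I * u * y : ℂ))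
      (2 * Real.pi * Complex.I * u) y := by
    simpa using ((hasDerivAt_id y).ofReal_comp).const_mul (2 * Real.pi * Complex.I * u : ℂ)
  simpa [mul_comm] using h.cexp

/-- The number sinc(π(u-k)) is the k-th Fourier coefficient of y ↦ exp(2πiuy) on [-1/2, 1/2], so the
cardinal sum is a Fourier partial sum. -/
theorem cardinalSum_eq_integral (u : ℝ) (K : ℕ) (x : ℝ) :
    cardinalSum u K x = ∫ y in (-(1 / 2) : ℝ)..(1 / 2),
      Complex.exp (2 * Real.pi * Complex.I * u * y) * (dirichletKernel K (x - y) : ℂ) := by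
  have e : ∀ k : ℤ, (Real.sinc (Real.pi * (u - k)) : ℂ) *
      Complex.exp (2 * Real.pi * Complex.I * k * x) = ∫ y in (-(1 / 2) : ℝ)..(1 / 2),
      Complex.exp (2 * Real.pi * Complex.I * u * y) *
        Complex.exp (2 * Real.pi * Complex.I * k * (x - y : ℝ)) := fun k => by
    have h := integral_exp_symm (u - k) (1 / 2)
    rw [show 2 * (1 / 2 : ℝ) * Real.sinc (2 * Real.pi * (1 / 2) * (u - k)) =
      Real.sinc (Real.pi * (u - k)) by
          rw [mul_one_div_cancel two_ne_zero, one_mul]; congr 1; ring] at h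
    rw [← h, ← intervalIntegral.integral_mul_const]
    congr 1; ext y
    rw [← Complex.exp_add, ← Complex.exp_add]; congr 1; push_cast; ring
  unfold cardinalSum
  simp_rw [e]
  rw [← intervalIntegral.integral_finsetSum]
  · simp_rw [← Finset.mul_sum, sum_exp_eq_dirichletKernel]
  · intro k _
    exact Continuous.intervalIntegrable (by fun_prop) _ _

/-- Integration by parts trades the Dirichlet kernel, whose L¹ norms grow with K, for its primitive,
which is bounded uniformly in K. -/
theorem cardinalSum_eq (u : ℝ) (K : ℕ) (x : ℝ) :
    cardinalSum u K x =
      Complex.exp (2 * Real.pi * Complex.I * u * (-(1 / 2) : ℝ)) * dirichletPrimitive K (x + 1 / 2) -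
      Complex.exp (2 * Real.pi * Complex.I * u * (1 / 2 : ℝ)) * dirichletPrimitive K (x - 1 / 2) +
      ∫ y in (-(1 / 2) : ℝ)..(1 / 2), 2 * Real.pi * Complex.I * u *
        Complex.exp (2 * Real.pi * Complex.I * u * y) * (dirichletPrimitive K (x - y) : ℂ) := by
  have hP : ∀ y : ℝ, HasDerivAt (fun y : ℝ => (-(dirichletPrimitive K (x - y)) : ℂ))
      (dirichletKernel K (x - y) : ℂ) y := fun y => by
    have h1 : HasDerivAt (fun y => x - y) (-1) y := by simpa using (hasDerivAt_id y).const_sub x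
    have h2 := ((hasDerivAt_dirichletPrimitive K (x - y)).comp y h1).neg
    simpa using h2.ofReal_comp
  have hcK := continuous_dirichletKernel K
  have hcP := continuous_dirichletPrimitive K
  rw [cardinalSum_eq_integral, intervalIntegral.integral_mul_deriv_eq_deriv_mul
    (fun y _ => hasDerivAt_exp_two_pi u y) (fun y _ => hP y)
    (Continuous.intervalIntegrable (by fun_prop) _ _)
    (Continuous.intervalIntegrable (by fun_prop) _ _)]
  simp_rw [mul_neg, intervalIntegral.integral_neg]
  rw [show x - -(1 / 2) = x + 1 / 2 by ring]
  ring

theorem norm_exp_two_pi (u y : ℝ) : ‖Complex.exp (2 * Real.pi * Complex.I * u * y)‖ = 1 := by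
  rw [show (2 * Real.pi * Complex.I * u * y : ℂ) = ((2 * Real.pi * u * y : ℝ) : ℂ) * Complex.I by
    push_cast; ring]
  exact Complex.norm_exp_ofReal_mul_I _

theorem norm_two_pi_mul_exp_mul_le (u y : ℝ) (K : ℕ) {z : ℝ} (hz : |z| ≤ 1) :
    ‖2 * Real.pi * Complex.I * u * Complex.exp (2 * Real.pi * Complex.I * u * y) *
      (dirichletPrimitive K z : ℂ)‖ ≤ 8 * Real.pi * |u| := by
  rw [norm_mul, norm_mul, norm_exp_two_pi, mul_one, Complex.norm_real, Real.norm_eq_abs]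
  have h1 : ‖(2 * Real.pi * Complex.I * u : ℂ)‖ = 2 * Real.pi * |u| := by
    simp [abs_of_pos Real.pi_pos]
  rw [h1]
  have := abs_dirichletPrimitive_le K hz
  have hp := Real.pi_pos
  have : 0 ≤ 2 * Real.pi * |u| := by positivity
  nlinarith

/-- For |x| ≤ 1/2 all arguments of the primitive stay in [-1, 1]. Each boundary term is then at most
4, and the integrand is at most 4 · 2π|u|. -/
theorem norm_cardinalSum_le (u : ℝ) (K : ℕ) {x : ℝ} (hx : |x| ≤ 1 / 2) :
    ‖cardinalSum u K x‖ ≤ 8 + 8 * Real.pi * |u| := by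
  rw [abs_le] at hx
  rw [cardinalSum_eq]
  have h1 := abs_dirichletPrimitive_le K (z := x + 1 / 2) (by rw [abs_le]; constructor <;> linarith)
  have h2 := abs_dirichletPrimitive_le K (z := x - 1 / 2) (by rw [abs_le]; constructor <;> linarith)
  have h3 := intervalIntegral.norm_integral_le_of_norm_le_const (a := -(1 / 2)) (b := 1 / 2)
    (C := 8 * Real.pi * |u|) (f := fun y : ℝ => 2 * Real.pi * Complex.I * u *
        Complex.exp (2 * Real.pi * Complex.I * u * y) * (dirichletPrimitive K (x - y) : ℂ))
    fun y hy => by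
      rw [Set.uIoc_of_le (by norm_num)] at hy
      refine norm_two_pi_mul_exp_mul_le u y K ?_
      rw [abs_le]; constructor <;> linarith [hy.1, hy.2]
  rw [show |(1 / 2 : ℝ) - -(1 / 2)| = 1 by norm_num, mul_one] at h3
  refine (norm_add_le _ _).trans ?_
  refine (add_le_add_left (norm_sub_le _ _) _).trans ?_
  rw [norm_mul, norm_mul, norm_exp_two_pi, norm_exp_two_pi, Complex.norm_real, Complex.norm_real,
    Real.norm_eq_abs, Real.norm_eq_abs]
  linarith

/-- The primitives tend to 1/2 or -1/2 according to the sign of their argument. The limit of the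
integral is the exponential at x minus half of its two endpoint values, and the boundary terms
restore exactly these halves. -/
theorem tendsto_cardinalSum (u : ℝ) {x : ℝ} (hx : |x| < 1 / 2) :
    Tendsto (fun K => cardinalSum u K x) atTop
      (𝓝 (Complex.exp (2 * Real.pi * Complex.I * u * x))) := by
  rw [abs_lt] at hx
  simp_rw [cardinalSum_eq]
  have hpos : ∀ z : ℝ, 0 < z → z < 1 →
      Tendsto (fun K => (dirichletPrimitive K z : ℂ)) atTop (𝓝 (1 / 2)) := fun z h0 h1 => by
    have := (Complex.continuous_ofReal.tendsto _).comp (tendsto_dirichletPrimitive h0 h1)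
    simpa [Function.comp_def] using this
  have hneg : ∀ z : ℝ, z < 0 → -1 < z →
      Tendsto (fun K => (dirichletPrimitive K z : ℂ)) atTop (𝓝 (-(1 / 2))) := fun z h0 h1 => by
    refine (hpos (-z) (by linarith) (by linarith)).neg.congr fun K => ?_
    rw [dirichletPrimitive_neg]; simp
  let lim : ℝ → ℂ := fun y => 2 * Real.pi * Complex.I * u *
        Complex.exp (2 * Real.pi * Complex.I * u * y) * (if y < x then 1 / 2 else -(1 / 2))
  have hint : Tendsto (fun K => ∫ y in (-(1 / 2) : ℝ)..(1 / 2), 2 * Real.pi * Complex.I * u *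
        Complex.exp (2 * Real.pi * Complex.I * u * y) * (dirichletPrimitive K (x - y) : ℂ)) atTop
      (𝓝 (∫ y in (-(1 / 2) : ℝ)..(1 / 2), lim y)) := by
    refine intervalIntegral.tendsto_integral_filter_of_dominated_convergence
      (fun _ => 8 * Real.pi * |u|) (Eventually.of_forall fun K => ?_)
      (Eventually.of_forall fun K => Eventually.of_forall fun y hy => ?_) (by simp) ?_
    · have := continuous_dirichletPrimitive K
      exact Continuous.aestronglyMeasurable (by fun_prop)
    · rw [Set.uIoc_of_le (by norm_num)] at hy
      refine norm_two_pi_mul_exp_mul_le u y K ?_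
      rw [abs_le]; constructor <;> linarith [hy.1, hy.2]
    · have hx0 : ∀ᵐ y : ℝ, y ≠ x := by simp [ae_iff]
      filter_upwards [hx0] with y hyx hy
      rw [Set.uIoc_of_le (by norm_num)] at hy
      refine Tendsto.const_mul _ ?_
      split_ifs with h
      · exact hpos _ (by linarith) (by linarith [hy.1])
      · have : x < y := lt_of_le_of_ne (not_lt.1 h) (Ne.symm hyx)
        exact hneg _ (by linarith) (by linarith [hy.2])
  have hlim : ∫ y in (-(1 / 2) : ℝ)..(1 / 2), lim y =
      Complex.exp (2 * Real.pi * Complex.I * u * x)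
        - Complex.exp (2 * Real.pi * Complex.I * u * (-(1 / 2) : ℝ)) * (1 / 2)
        - Complex.exp (2 * Real.pi * Complex.I * u * (1 / 2 : ℝ)) * (1 / 2) := by
    have hc : Continuous fun y : ℝ => 2 * Real.pi * Complex.I * u *
        Complex.exp (2 * Real.pi * Complex.I * u * y) := by fun_prop
    have hF : ∀ a b : ℝ, ∫ y in a..b, 2 * Real.pi * Complex.I * u *
        Complex.exp (2 * Real.pi * Complex.I * u * y) =
        Complex.exp (2 * Real.pi * Complex.I * u * b) -
        Complex.exp (2 * Real.pi * Complex.I * u * a) := fun a b =>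
      intervalIntegral.integral_eq_sub_of_hasDerivAt (fun y _ => hasDerivAt_exp_two_pi u y)
        (hc.intervalIntegrable _ _)
    have h1 : Set.EqOn lim (fun y => 2 * Real.pi * Complex.I * u *
        Complex.exp (2 * Real.pi * Complex.I * u * y) * (1 / 2)) (Set.Ioo (-(1 / 2)) x) :=
      fun y hy => by simp [lim, hy.2]
    have h2 : Set.EqOn lim (fun y => 2 * Real.pi * Complex.I * u *
        Complex.exp (2 * Real.pi * Complex.I * u * y) * (-(1 / 2))) (Set.Ioc x (1 / 2)) :=
      fun y hy => by simp [lim, not_lt.2 hy.1.le]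
    have i1 : IntervalIntegrable lim volume (-(1 / 2)) x := by
      rw [intervalIntegrable_iff_integrableOn_Ioo_of_le hx.1.le]
      refine IntegrableOn.congr_fun ?_ h1.symm measurableSet_Ioo
      rw [← intervalIntegrable_iff_integrableOn_Ioo_of_le hx.1.le]
      exact Continuous.intervalIntegrable (by fun_prop) _ _
    have i2 : IntervalIntegrable lim volume x (1 / 2) := by
      rw [intervalIntegrable_iff_integrableOn_Ioc_of_le hx.2.le]
      refine IntegrableOn.congr_fun ?_ h2.symm measurableSet_Ioc
      rw [← intervalIntegrable_iff_integrableOn_Ioc_of_le hx.2.le]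
      exact Continuous.intervalIntegrable (by fun_prop) _ _
    rw [← intervalIntegral.integral_add_adjacent_intervals i1 i2,
      intervalIntegral.integral_of_le hx.1.le, integral_Ioc_eq_integral_Ioo,
      setIntegral_congr_fun measurableSet_Ioo h1, ← integral_Ioc_eq_integral_Ioo,
      ← intervalIntegral.integral_of_le hx.1.le, intervalIntegral.integral_of_le hx.2.le,
      setIntegral_congr_fun measurableSet_Ioc h2, ← intervalIntegral.integral_of_le hx.2.le,
      intervalIntegral.integral_mul_const, intervalIntegral.integral_mul_const, hF, hF]
    ring
  have h1 := (hpos (x + 1 / 2) (by linarith) (by linarith)).const_mul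
    (Complex.exp (2 * Real.pi * Complex.I * u * (-(1 / 2) : ℝ)))
  have h2 := (hneg (x - 1 / 2) (by linarith) (by linarith)).const_mul
    (Complex.exp (2 * Real.pi * Complex.I * u * (1 / 2 : ℝ)))
  have := (h1.sub h2).add hint
  rw [hlim] at this
  convert! this using 2
  ring

/-! ### Interpolation on a single band, at a fixed frequency -/

section

/-- The complex exponential of frequency `f`, evaluated at time `t`. -/
noncomputable def cexpi (f t : ℝ) : ℂ := Complex.exp (2 * Real.pi * Complex.I * f * t)

theorem norm_cexpi (f t : ℝ) : ‖cexpi f t‖ = 1 := norm_exp_two_pi f t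

theorem cexpi_add (f s t : ℝ) : cexpi f (s + t) = cexpi f s * cexpi f t := by
  unfold cexpi; rw [← Complex.exp_add]; congr 1; push_cast; ring

theorem star_cexpi (f t : ℝ) : (starRingEnd ℂ) (cexpi f t) = cexpi f (-t) := by
  unfold cexpi
  rw [← Complex.exp_conj]; congr 1; simp [map_ofNat]

variable {L : ℕ}

/-- Partial sums of the band-pass interpolation formula at the frequency `f`. -/
noncomputable def bandSum (e : Fin (L + 1) → ℝ) (l : Fin L) (τ t : ℝ) (K : ℕ) (f : ℝ) : ℂ :=
  ∑ k ∈ Finset.Icc (-(K : ℤ)) K,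
    cexpi f (τ + k / width e l) * kernel e l (t - (τ + k / width e l))

/-- Demodulation by the centre frequency and division by the width carry the band to [-1/2, 1/2] and
the samples to the integers. The offset enters only through a unimodular factor and the parameter u
= B^l (t - τ). -/
theorem bandSum_eq {e : Fin (L + 1) → ℝ} {l : Fin L} (hw : 0 < width e l) (τ t : ℝ) (K : ℕ)
    (f : ℝ) : bandSum e l τ t K f =
      cexpi ((e l.castSucc + e l.succ) / 2) t * cexpi (f - (e l.castSucc + e l.succ) / 2) τ *
      cardinalSum (width e l * (t - τ)) K ((f - (e l.castSucc + e l.succ) / 2) / width e l) := by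
  unfold bandSum cardinalSum
  rw [Finset.mul_sum]
  refine Finset.sum_congr rfl fun k _ => ?_
  unfold kernel cexpi
  have h1 : width e l * (t - (τ + k / width e l)) = width e l * (t - τ) - k := by
    field_simp; ring
  have hwc : (width e l : ℂ) ≠ 0 := by exact_mod_cast hw.ne'
  rw [h1, mul_left_comm, mul_left_comm _ (Real.sinc _ : ℂ), ← Complex.exp_add, ← Complex.exp_add,
    ← Complex.exp_add]
  congr 2
  push_cast
  field_simp
  ring

theorem norm_bandSum_le {e : Fin (L + 1) → ℝ} {l : Fin L} (hw : 0 < width e l) (τ t : ℝ) (K : ℕ)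
    {f : ℝ} (hf : f ∈ subband e l) :
    ‖bandSum e l τ t K f‖ ≤ 8 + 8 * Real.pi * |width e l * (t - τ)| := by
  rw [bandSum_eq hw, norm_mul, norm_mul, norm_cexpi, norm_cexpi, one_mul, one_mul]
  refine norm_cardinalSum_le _ _ ?_
  rw [abs_div, abs_of_pos hw, div_le_iff₀ hw, abs_le]
  have := hf.1
  have := hf.2
  unfold width
  constructor <;> linarith

theorem tendsto_bandSum {e : Fin (L + 1) → ℝ} {l : Fin L} (hw : 0 < width e l) (τ t : ℝ)
    {f : ℝ} (hf : f ∈ Set.Ioo (e l.castSucc) (e l.succ)) :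
    Tendsto (fun K => bandSum e l τ t K f) atTop (𝓝 (cexpi f t)) := by
  simp_rw [bandSum_eq hw]
  have h := (tendsto_cardinalSum (width e l * (t - τ))
    (x := (f - (e l.castSucc + e l.succ) / 2) / width e l) ?_).const_mul
    (cexpi ((e l.castSucc + e l.succ) / 2) t * cexpi (f - (e l.castSucc + e l.succ) / 2) τ)
  · convert! h using 2
    have hwc : (width e l : ℂ) ≠ 0 := by exact_mod_cast hw.ne'
    unfold cexpi
    rw [← Complex.exp_add, ← Complex.exp_add]
    congr 1
    push_cast
    field_simp
    ring
  · rw [abs_div, abs_of_pos hw, div_lt_iff₀ hw, abs_lt]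
    have := hf.1
    have := hf.2
    unfold width
    constructor <;> linarith

end

section

/-! ### The spectral measure -/

/-- A matrix of full column rank has a left inverse. -/
theorem exists_left_inverse_of_rank_eq {N M : ℕ} {U : Matrix (Fin N) (Fin M) ℝ}
    (hU : U.rank = M) : ∃ V : Matrix (Fin M) (Fin N) ℝ, V * U = 1 := by
  have hli : LinearIndependent ℝ U.col := by
    rw [linearIndependent_iff_card_eq_finrank_span, Set.finrank,
      ← Matrix.rank_eq_finrank_span_cols, hU, Fintype.card_fin]
  have hinj : Function.Injective U.mulVecLin := Matrix.mulVec_injective_iff.2 hli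
  obtain ⟨g, hg⟩ := LinearMap.exists_leftInverse_of_injective U.mulVecLin
    (LinearMap.ker_eq_bot.2 hinj)
  refine ⟨LinearMap.toMatrix' g, ?_⟩
  have hlin : Matrix.toLin' U = U.mulVecLin := Matrix.toLin'_apply' U
  rw [← hlin] at hg
  nth_rewrite 1 [← LinearMap.toMatrix'_toLin' U]
  rw [← LinearMap.toMatrix'_comp, hg, LinearMap.toMatrix'_id]

/-- The measure on `Fin M × ℝ` whose restriction to the `m`-th copy of the frequency axis has the
density `S m`. -/
noncomputable def specMeasure {M : ℕ} (S : Fin M → ℝ → ℝ) : Measure (Fin M × ℝ) :=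
  ∑ m, (volume.withDensity fun f => ENNReal.ofReal (S m f)).map (Prod.mk m)

variable {M : ℕ} {S : Fin M → ℝ → ℝ}

theorem measurableEmbedding_mk (m : Fin M) : MeasurableEmbedding (Prod.mk m : ℝ → Fin M × ℝ) :=
  MeasurableEmbedding.prodMk_left m MeasurableEmbedding.id

theorem isFiniteMeasure_specMeasure (hS : ∀ m, Integrable (S m)) :
    IsFiniteMeasure (specMeasure S) := by
  unfold specMeasure
  have : ∀ m, IsFiniteMeasure (volume.withDensity fun f => ENNReal.ofReal (S m f)) := fun m =>
    isFiniteMeasure_withDensity_ofReal (hS m).2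
  infer_instance

theorem ae_specMeasure_iff (hS : ∀ m, Integrable (S m)) {Q : Fin M × ℝ → Prop} :
    (∀ᵐ p ∂specMeasure S, Q p) ↔ ∀ m, ∀ᵐ f, 0 < S m f → Q (m, f) := by
  unfold specMeasure
  rw [ae_finsetSum_measure_iff]
  simp only [Finset.mem_univ, true_imp_iff]
  refine forall_congr' fun m => ?_
  rw [(measurableEmbedding_mk m).ae_map_iff,
    ae_withDensity_iff' (hS m).aestronglyMeasurable.aemeasurable.ennreal_ofReal]
  simp

theorem integrable_specMeasure_iff (hS : ∀ m, Integrable (S m)) (h0 : ∀ m f, 0 ≤ S m f)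
    {F : Fin M × ℝ → ℂ} :
    Integrable F (specMeasure S) ↔ ∀ m, Integrable fun f => (S m f : ℂ) * F (m, f) := by
  unfold specMeasure
  rw [integrable_finsetSum_measure]
  simp only [Finset.mem_univ, true_imp_iff]
  refine forall_congr' fun m => ?_
  rw [(measurableEmbedding_mk m).integrable_map_iff, integrable_withDensity_iff_integrable_smul₀'
    (hS m).aestronglyMeasurable.aemeasurable.ennreal_ofReal (by simp)]
  simp [ENNReal.toReal_ofReal (h0 m _)]

theorem integral_specMeasure (hS : ∀ m, Integrable (S m)) (h0 : ∀ m f, 0 ≤ S m f)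
    {F : Fin M × ℝ → ℂ} (hF : Integrable F (specMeasure S)) :
    ∫ p, F p ∂specMeasure S = ∑ m, ∫ f, (S m f : ℂ) * F (m, f) := by
  have hF' := hF
  unfold specMeasure at hF ⊢
  rw [integrable_finsetSum_measure] at hF
  rw [integral_finsetSum_measure hF]
  refine Finset.sum_congr rfl fun m _ => ?_
  rw [(measurableEmbedding_mk m).integral_map, integral_withDensity_eq_integral_toReal_smul₀
    (hS m).aestronglyMeasurable.aemeasurable.ennreal_ofReal (by simp)]
  simp [ENNReal.toReal_ofReal (h0 m _)]

/-! ### Modulation -/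

theorem memLp_cexpi_mul (t : ℝ) (g : Lp ℂ 2 (specMeasure S)) :
    MemLp (fun p => cexpi p.2 t * g p) 2 (specMeasure S) := by
  refine (Lp.memLp g).of_le ?_ (Eventually.of_forall fun p => ?_)
  · have : Measurable fun p : Fin M × ℝ => cexpi p.2 t := by unfold cexpi; fun_prop
    exact this.aestronglyMeasurable.mul (Lp.aestronglyMeasurable g)
  · rw [norm_mul, norm_cexpi, one_mul]

/-- Multiplication by `exp (2 π i f t)`, which corresponds to a translation in time. -/
noncomputable def modulate (t : ℝ) : Lp ℂ 2 (specMeasure S) →ₗᵢ[ℂ] Lp ℂ 2 (specMeasure S) where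
  toFun g := (memLp_cexpi_mul t g).toLp _
  map_add' g h := by
    refine Lp.ext ?_
    filter_upwards [MemLp.coeFn_toLp (memLp_cexpi_mul t (g + h)),
      MemLp.coeFn_toLp (memLp_cexpi_mul t g), MemLp.coeFn_toLp (memLp_cexpi_mul t h),
      Lp.coeFn_add g h, Lp.coeFn_add ((memLp_cexpi_mul t g).toLp _)
        ((memLp_cexpi_mul t h).toLp _)] with p h1 h2 h3 h4 h5
    rw [h1, h5, Pi.add_apply, h2, h3, h4, Pi.add_apply, mul_add]
  map_smul' c g := by
    refine Lp.ext ?_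
    filter_upwards [MemLp.coeFn_toLp (memLp_cexpi_mul t (c • g)),
      MemLp.coeFn_toLp (memLp_cexpi_mul t g),
      Lp.coeFn_smul c g, Lp.coeFn_smul c ((memLp_cexpi_mul t g).toLp _)] with p h1 h2 h4 h5
    rw [h1, RingHom.id_apply, h5, Pi.smul_apply, h2, h4, Pi.smul_apply, smul_eq_mul, smul_eq_mul]
    ring
  norm_map' g := by
    change ‖(memLp_cexpi_mul t g).toLp _‖ = _
    rw [Lp.norm_toLp, Lp.norm_def]
    congr 1
    refine eLpNorm_congr_norm_ae (Eventually.of_forall fun p => ?_)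
    rw [norm_mul, norm_cexpi, one_mul]

theorem coeFn_modulate (t : ℝ) (g : Lp ℂ 2 (specMeasure S)) :
    modulate t g =ᵐ[specMeasure S] fun p => cexpi p.2 t * g p :=
  MemLp.coeFn_toLp (memLp_cexpi_mul t g)

/-! ### Exponentials in the spectral `L²` space -/

section L2

variable [IsFiniteMeasure (specMeasure S)]

theorem measurable_fiber_mul_cexpi (a : Fin M → ℂ) (t : ℝ) :
    Measurable fun p : Fin M × ℝ => a p.1 * cexpi p.2 t := by
  unfold cexpi
  exact ((measurable_of_finite a).comp measurable_fst).mul (by fun_prop)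

theorem memLp_fiber_mul_cexpi (a : Fin M → ℂ) (t : ℝ) :
    MemLp (fun p : Fin M × ℝ => a p.1 * cexpi p.2 t) 2 (specMeasure S) := by
  refine MemLp.of_bound (measurable_fiber_mul_cexpi a t).aestronglyMeasurable (∑ m, ‖a m‖)
    (Eventually.of_forall fun p => ?_)
  rw [norm_mul, norm_cexpi, mul_one]
  exact Finset.single_le_sum (f := fun m => ‖a m‖) (fun _ _ => norm_nonneg _) (Finset.mem_univ p.1)

/-- The function `(m, f) ↦ a m * exp (2 π i f t)` as an element of `L²`. -/
noncomputable def expLp (S : Fin M → ℝ → ℝ) [IsFiniteMeasure (specMeasure S)] (t : ℝ)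
    (a : Fin M → ℂ) : Lp ℂ 2 (specMeasure S) :=
  (memLp_fiber_mul_cexpi a t).toLp _

theorem coeFn_expLp (t : ℝ) (a : Fin M → ℂ) :
    expLp S t a =ᵐ[specMeasure S] fun p => a p.1 * cexpi p.2 t :=
  MemLp.coeFn_toLp _

theorem expLp_sum {ι : Type*} (s : Finset ι) (t : ℝ) (c : ι → ℂ) (a : ι → Fin M → ℂ) :
    expLp S t (fun m => ∑ i ∈ s, c i * a i m) = ∑ i ∈ s, c i • expLp S t (a i) := by
  refine Lp.ext ?_
  refine (coeFn_expLp t _).trans ?_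
  have h1 : ∀ i ∈ s, (c i • expLp S t (a i) : Lp ℂ 2 (specMeasure S)) =ᵐ[specMeasure S]
      fun p => c i * (a i p.1 * cexpi p.2 t) := fun i _ => by
    filter_upwards [Lp.coeFn_smul (c i) (expLp S t (a i)), coeFn_expLp (S := S) t (a i)]
      with p h1 h2
    rw [h1, Pi.smul_apply, h2, smul_eq_mul]
  have h2 := (ae_ball_iff (s.countable_toSet)).2 h1
  filter_upwards [Lp.coeFn_finsetSum s fun i => c i • expLp S t (a i), h2] with p h3 h4
  rw [h3, Finset.sum_apply, Finset.sum_mul]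
  refine Finset.sum_congr rfl fun i hi => ?_
  rw [h4 i hi, mul_assoc]

theorem inner_expLp (t : ℝ) (a : Fin M → ℂ) (g : Lp ℂ 2 (specMeasure S)) :
    inner ℂ (expLp S t a) g =
      ∫ p, (starRingEnd ℂ) (a p.1) * (cexpi p.2 (-t) * g p) ∂specMeasure S := by
  rw [L2.inner_def]
  refine integral_congr_ae ?_
  filter_upwards [coeFn_expLp (S := S) t a] with p hp
  rw [hp, RCLike.inner_apply, map_mul, star_cexpi]; ring

theorem integrable_fiber_mul_cexpi_mul (t : ℝ) (a : Fin M → ℂ) (g : Lp ℂ 2 (specMeasure S)) :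
    Integrable (fun p => (starRingEnd ℂ) (a p.1) * (cexpi p.2 (-t) * g p)) (specMeasure S) := by
  have := L2.integrable_inner (𝕜 := ℂ) (expLp S t a) g
  refine this.congr ?_
  filter_upwards [coeFn_expLp (S := S) t a] with p hp
  rw [hp, RCLike.inner_apply, map_mul, star_cexpi]; ring

/-- The unit vector of the `m`-th fibre. -/
noncomputable def unitVec (m : Fin M) : Fin M → ℂ := Pi.single m 1

theorem integral_unitVec_mul (hS : ∀ m, Integrable (S m)) (h0 : ∀ m f, 0 ≤ S m f) (m : Fin M)
    (t : ℝ) (g : Lp ℂ 2 (specMeasure S)) :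
    inner ℂ (expLp S t (unitVec m)) g = ∫ f, cexpi f (-t) * ((S m f : ℂ) * g (m, f)) := by
  rw [inner_expLp, integral_specMeasure hS h0 (integrable_fiber_mul_cexpi_mul t _ g),
    Finset.sum_eq_single m]
  · congr 1; ext f; simp [unitVec]; ring
  · intro b _ hb
    simp [unitVec, hb]
  · simp

theorem integrable_mul_fiber (hS : ∀ m, Integrable (S m)) (h0 : ∀ m f, 0 ≤ S m f)
    (g : Lp ℂ 2 (specMeasure S)) (m : Fin M) : Integrable fun f => (S m f : ℂ) * g (m, f) :=
  (integrable_specMeasure_iff hS h0).1 ((Lp.memLp g).integrable (by norm_num)) m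

/-- The vector of mixing coefficients of the `n`-th channel. -/
noncomputable def mixRow {N : ℕ} (U : Matrix (Fin N) (Fin M) ℝ) (n : Fin N) : Fin M → ℂ :=
  fun m => (U n m : ℂ)

/-- A left inverse of U recovers the single fibres from the rows, so orthogonality to all rows can
be tested one source at a time. -/
theorem unitVec_eq_sum {N : ℕ} {U : Matrix (Fin N) (Fin M) ℝ} {V : Matrix (Fin M) (Fin N) ℝ}
    (hV : V * U = 1) (m : Fin M) :
    unitVec m = fun j => ∑ n, (V m n : ℂ) * mixRow U n j := by
  ext j
  have := congrFun (congrFun hV m) j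
  rw [Matrix.mul_apply] at this
  simp only [mixRow]
  rw [unitVec, Pi.single_apply]
  have h2 := congrArg (fun x : ℝ => (x : ℂ)) this
  push_cast at h2
  rw [h2, Matrix.one_apply]
  by_cases h : m = j
  · subst h; simp
  · simp [h, Ne.symm h]

/-- The exponentials with large `|t|` span a dense subspace, as the supports of the spectra have
finite measure. -/
theorem span_expLp_topologicalClosure_eq_top (hS : ∀ m, Integrable (S m))
    (h0 : ∀ m f, 0 ≤ S m f) {B : Fin M → Set ℝ} (hB : ∀ m, ∀ f, f ∉ B m → S m f = 0)
    (hBfin : totalBandwidth B < ∞) {N : ℕ} {U : Matrix (Fin N) (Fin M) ℝ} (hU : U.rank = M)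
    (R : ℝ) :
    (Submodule.span ℂ {x | ∃ (n : Fin N) (t : ℝ), R < |t| ∧
      x = expLp S t (mixRow U n)}).topologicalClosure = ⊤ := by
  obtain ⟨V, hV⟩ := exists_left_inverse_of_rank_eq hU
  rw [Submodule.topologicalClosure_eq_top_iff, Submodule.eq_bot_iff]
  intro g hg
  rw [Submodule.mem_orthogonal] at hg
  have h1 : ∀ m (t : ℝ), R < |t| → inner ℂ (expLp S t (unitVec m)) g = 0 := by
    intro m t ht
    rw [unitVec_eq_sum hV m, expLp_sum, sum_inner]
    refine Finset.sum_eq_zero fun n _ => ?_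
    rw [inner_smul_left, hg _ (Submodule.subset_span ⟨n, t, ht, rfl⟩), mul_zero]
  -- On each fibre the orthogonality says that the transform of S_m g(m,·) vanishes beyond R, while
  -- this function itself lives on the set B_m of finite measure.
  have h2 : ∀ m, ∀ᵐ f, (S m f : ℂ) * g (m, f) = 0 := by
    intro m
    refine ae_eq_zero_of_integral_exp_eq_zero (integrable_mul_fiber hS h0 g m) (E := B m) ?_
      (Eventually.of_forall fun f hf => by simp [hB m f hf]) (R := R) fun l hl => ?_
    · exact lt_of_le_of_lt (Finset.single_le_sum (f := fun m => volume (B m))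
        (fun _ _ => zero_le) (Finset.mem_univ m)) hBfin
    · have := h1 m (-l) (by simpa using hl)
      rw [integral_unitVec_mul hS h0, neg_neg] at this
      exact this
  refine Lp.ext ?_
  refine EventuallyEq.trans ?_ (Lp.coeFn_zero _ _ _).symm
  refine (ae_specMeasure_iff hS).2 fun m => ?_
  filter_upwards [h2 m] with f hf hpos
  rcases mul_eq_zero.1 hf with h | h
  · exact absurd (by exact_mod_cast h) hpos.ne'
  · exact h

theorem modulate_expLp (s t : ℝ) (a : Fin M → ℂ) :
    modulate s (expLp S t a) = expLp S (s + t) a := by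
  refine Lp.ext ?_
  filter_upwards [coeFn_modulate s (expLp S t a), coeFn_expLp (S := S) t a,
    coeFn_expLp (S := S) (s + t) a] with p h1 h2 h3
  rw [h1, h2, h3, cexpi_add]; ring

end L2

end

section

/-! ### The spectral isometry -/

/-- Two families with the same Gram matrix, the first of them total, are related by an isometry. -/
theorem exists_linearIsometry_of_inner_eq {ι E F : Type*} [NormedAddCommGroup E]
    [InnerProductSpace ℂ E] [NormedAddCommGroup F] [InnerProductSpace ℂ F] [CompleteSpace F]
    {v : ι → E} {w : ι → F} (hv : (Submodule.span ℂ (Set.range v)).topologicalClosure = ⊤)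
    (h : ∀ i j, inner ℂ (v i) (v j) = inner ℂ (w i) (w j)) :
    ∃ J : E →ₗᵢ[ℂ] F, ∀ i, J (v i) = w i := by
  have hnorm : ∀ x : ι →₀ ℂ, ‖Finsupp.linearCombination ℂ w x‖ =
      ‖Finsupp.linearCombination ℂ v x‖ := fun x => by
    have : inner ℂ (Finsupp.linearCombination ℂ w x) (Finsupp.linearCombination ℂ w x) =
        inner ℂ (Finsupp.linearCombination ℂ v x) (Finsupp.linearCombination ℂ v x) := by
      simp only [Finsupp.linearCombination_apply, Finsupp.inner_sum, Finsupp.sum_inner,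
        inner_smul_left, inner_smul_right, h]
    rw [inner_self_eq_norm_sq_to_K, inner_self_eq_norm_sq_to_K] at this
    exact (sq_eq_sq₀ (norm_nonneg _) (norm_nonneg _)).1 (by exact_mod_cast this)
  have hdense : DenseRange (Finsupp.linearCombination ℂ v) := by
    rw [DenseRange, ← LinearMap.coe_range, Finsupp.range_linearCombination,
      Submodule.dense_iff_topologicalClosure_eq_top, hv]
  have hex : ∃ C, ∀ x, ‖Finsupp.linearCombination ℂ w x‖ ≤
      C * ‖Finsupp.linearCombination ℂ v x‖ := ⟨1, fun x => by rw [hnorm, one_mul]⟩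
  -- Equal norms make the assignment well defined even when the vectors v are linearly dependent; it
  -- extends from the dense range by continuity.
  let J := (Finsupp.linearCombination ℂ w).extendOfNorm (Finsupp.linearCombination ℂ v)
  have hJ : ∀ x, J (Finsupp.linearCombination ℂ v x) = Finsupp.linearCombination ℂ w x :=
    LinearMap.extendOfNorm_eq hdense hex
  refine ⟨⟨J.toLinearMap, fun x => ?_⟩, fun i => ?_⟩
  · refine hdense.induction_on (p := fun x => ‖J x‖ = ‖x‖) x
      (isClosed_eq (by fun_prop) continuous_norm) fun c => ?_
    rw [hJ, hnorm]
  · have := hJ (Finsupp.single i 1)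
    simpa using this

variable {Ω : Type*} [MeasurableSpace Ω] {M N : ℕ} {S : Fin M → ℝ → ℝ}

theorem mixRow_one (m : Fin M) : mixRow (1 : Matrix (Fin M) (Fin M) ℝ) m = unitVec m := by
  ext j
  by_cases h : m = j
  · subst h; simp [mixRow, unitVec]
  · simp [mixRow, unitVec, h, Ne.symm h]

theorem inner_expLp_unitVec [IsFiniteMeasure (specMeasure S)] (hS : ∀ m, Integrable (S m))
    (h0 : ∀ m f, 0 ≤ S m f) (m m' : Fin M) (t t' : ℝ) :
    inner ℂ (expLp S t' (unitVec m')) (expLp S t (unitVec m)) =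
      if m = m' then ∫ f, (S m f : ℂ) * cexpi f (t - t') else 0 := by
  rw [integral_unitVec_mul hS h0]
  have h := (ae_specMeasure_iff hS).1 (coeFn_expLp (S := S) t (unitVec m)) m'
  have e : ∀ᵐ f, cexpi f (-t') * ((S m' f : ℂ) * expLp S t (unitVec m) (m', f)) =
      unitVec m m' * ((S m' f : ℂ) * cexpi f (t - t')) := by
    filter_upwards [h] with f hf
    rcases (h0 m' f).eq_or_lt with h1 | h1
    · simp [← h1]
    · rw [hf h1, sub_eq_add_neg, cexpi_add]; ring
  rw [integral_congr_ae e, integral_const_mul]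
  by_cases hm : m = m'
  · subst hm; simp [unitVec]
  · simp [unitVec, hm, Ne.symm hm]

/-- The isometry between the spectral `L²` space and the span of the latent signals. -/
theorem exists_spectral_isometry [IsFiniteMeasure (specMeasure S)] (P : Measure Ω)
    {A : Fin M → ℝ → Ω → ℂ} {B : Fin M → Set ℝ}
    (hA : ∀ m t, MemLp (A m t) 2 P) (hPSD : ∀ m, HasPSD P (A m) (S m))
    (hunc : MutuallyUncorrelated P A) (hBsupp : ∀ m, ∀ f, f ∉ B m → S m f = 0)
    (hBfin : totalBandwidth B < ∞) :
    ∃ J : Lp ℂ 2 (specMeasure S) →ₗᵢ[ℂ] Lp ℂ 2 P,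
      ∀ m t, J (expLp S t (unitVec m)) = (hA m t).toLp (A m t) := by
  have hS := fun m => (hPSD m).integrable
  have h0 := fun m => (hPSD m).nonneg
  -- The identity mixing matrix yields the single fibres, and the threshold -1 excludes no instant.
  have hdense := span_expLp_topologicalClosure_eq_top hS h0 hBsupp hBfin
    (U := (1 : Matrix (Fin M) (Fin M) ℝ)) (by simp) (-1)
  have hv : (Submodule.span ℂ (Set.range fun p : Fin M × ℝ =>
      expLp S p.2 (unitVec p.1))).topologicalClosure = ⊤ := by
    rw [← hdense]
    congr 2
    ext x
    simp only [Set.mem_range, Prod.exists, Set.mem_ofPred_eq, mixRow_one]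
    refine exists_congr fun m => exists_congr fun t => ?_
    have : -1 < |t| := by linarith [abs_nonneg t]
    simp [this, eq_comm]
  -- The Gram entries of the signals are correlations: on the diagonal the inverse transform of S_m,
  -- off the diagonal zero. The first slot of the inner product is the conjugated one, so the lag is
  -- t - t'.
  have hgram : ∀ p q : Fin M × ℝ,
      inner ℂ (expLp S p.2 (unitVec p.1)) (expLp S q.2 (unitVec q.1)) =
      inner ℂ ((hA p.1 p.2).toLp (A p.1 p.2)) ((hA q.1 q.2).toLp (A q.1 q.2)) := by
    rintro ⟨m', t'⟩ ⟨m, t⟩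
    rw [inner_expLp_unitVec hS h0, L2.inner_def]
    have e : ∫ ω, inner ℂ ((hA m' t').toLp (A m' t') ω) ((hA m t).toLp (A m t) ω) ∂P =
        corr P (A m) (A m') t (t - t') := by
      unfold corr
      refine integral_congr_ae ?_
      filter_upwards [(hA m' t').coeFn_toLp, (hA m t).coeFn_toLp] with ω h1 h2
      rw [h1, h2, RCLike.inner_apply, sub_sub_cancel]
    rw [e]
    split_ifs with h
    · subst h
      rw [(hPSD m).autocorr]; rfl
    · rw [hunc m m' h]
  obtain ⟨J, hJ⟩ := exists_linearIsometry_of_inner_eq hv hgram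
  exact ⟨J, fun m t => hJ (m, t)⟩

theorem memLp_mix {P : Measure Ω} {A : Fin M → ℝ → Ω → ℂ} (hA : ∀ m t, MemLp (A m t) 2 P)
    (U : Matrix (Fin N) (Fin M) ℝ) (n : Fin N) (t : ℝ) : MemLp (mix U A n t) 2 P :=
  memLp_finsetSum _ fun m _ => (hA m t).const_mul _

theorem isometry_expLp_mixRow [IsFiniteMeasure (specMeasure S)] {P : Measure Ω}
    {A : Fin M → ℝ → Ω → ℂ} {hA : ∀ m t, MemLp (A m t) 2 P}
    {J : Lp ℂ 2 (specMeasure S) →ₗᵢ[ℂ] Lp ℂ 2 P}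
    (hJ : ∀ m t, J (expLp S t (unitVec m)) = (hA m t).toLp (A m t))
    (U : Matrix (Fin N) (Fin M) ℝ) (n : Fin N) (t : ℝ) :
    J (expLp S t (mixRow U n)) = (memLp_mix hA U n t).toLp (mix U A n t) := by
  have e : mixRow U n = fun j => ∑ m, (U n m : ℂ) * unitVec m j := by
    ext j; simp [mixRow, unitVec, Pi.single_apply]
  rw [e, expLp_sum, map_sum]
  simp_rw [map_smul, hJ]
  refine Lp.ext ?_
  have h1 : ∀ m, (((U n m : ℂ) • (hA m t).toLp (A m t) : Lp ℂ 2 P)) =ᵐ[P]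
      fun ω => (U n m : ℂ) * A m t ω := fun m => by
    filter_upwards [Lp.coeFn_smul (U n m : ℂ) ((hA m t).toLp (A m t)), (hA m t).coeFn_toLp]
      with ω h1 h2
    rw [h1, Pi.smul_apply, h2, smul_eq_mul]
  filter_upwards [Lp.coeFn_finsetSum Finset.univ fun m => (U n m : ℂ) • (hA m t).toLp (A m t),
    ae_all_iff.2 h1, (memLp_mix hA U n t).coeFn_toLp] with ω h2 h3 h4
  rw [h2, h4, Finset.sum_apply, mix]
  exact Finset.sum_congr rfl fun m _ => h3 m

end

/-! ### Linear reconstructions and filter outputs in `L²` -/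

section Reconstruction

variable {Ω : Type*} [MeasurableSpace Ω] {P : Measure Ω} {ι : Type*}

theorem coeFn_linearCombination_toLp {Y : ι → Ω → ℂ} (hY : ∀ i, MemLp (Y i) 2 P) (c : ι →₀ ℂ) :
    (Finsupp.linearCombination ℂ (fun i => (hY i).toLp (Y i)) c : Lp ℂ 2 P) =ᵐ[P]
      fun ω => c.sum fun i a => a * Y i ω := by
  rw [Finsupp.linearCombination_apply, Finsupp.sum]
  have h1 : ∀ i ∈ c.support, ((c i • (hY i).toLp (Y i) : Lp ℂ 2 P)) =ᵐ[P]
      fun ω => c i * Y i ω := fun i _ => by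
    filter_upwards [Lp.coeFn_smul (c i) ((hY i).toLp (Y i)), (hY i).coeFn_toLp] with ω h1 h2
    rw [h1, Pi.smul_apply, h2, smul_eq_mul]
  filter_upwards [Lp.coeFn_finsetSum c.support fun i => c i • (hY i).toLp (Y i),
    (ae_ball_iff (c.support.countable_toSet)).2 h1] with ω h3 h4
  rw [h3, Finset.sum_apply]
  exact Finset.sum_congr rfl fun i hi => h4 i hi

theorem eLpNorm_sub_sum_eq {Y : ι → Ω → ℂ} (hY : ∀ i, MemLp (Y i) 2 P) {z : Ω → ℂ} {x : Lp ℂ 2 P}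
    (hz : z =ᵐ[P] x) (c : ι →₀ ℂ) :
    eLpNorm (fun ω => z ω - c.sum fun i a => a * Y i ω) 2 P =
      ENNReal.ofReal ‖x - Finsupp.linearCombination ℂ (fun i => (hY i).toLp (Y i)) c‖ := by
  rw [Lp.norm_def, ENNReal.ofReal_toReal (Lp.eLpNorm_ne_top _)]
  refine eLpNorm_congr_ae ?_
  filter_upwards [Lp.coeFn_sub x (Finsupp.linearCombination ℂ (fun i => (hY i).toLp (Y i)) c), hz,
    coeFn_linearCombination_toLp hY c] with ω h1 h2 h3
  rw [h1, Pi.sub_apply, h2, h3]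

theorem exists_seq_linearCombination_tendsto {E : Type*} [NormedAddCommGroup E]
    [InnerProductSpace ℂ E] {v : ι → E} {x : E}
    (hx : x ∈ (Submodule.span ℂ (Set.range v)).topologicalClosure) :
    ∃ c : ℕ → ι →₀ ℂ, Tendsto (fun k => Finsupp.linearCombination ℂ v (c k)) atTop (𝓝 x) := by
  rw [← SetLike.mem_coe, Submodule.topologicalClosure_coe, mem_closure_iff_seq_limit] at hx
  obtain ⟨y, hy, hlim⟩ := hx
  have : ∀ k, ∃ c : ι →₀ ℂ, Finsupp.linearCombination ℂ v c = y k := fun k =>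
    (Finsupp.mem_span_range_iff_exists_finsupp.1 (hy k)).imp fun c hc => by
      rw [Finsupp.linearCombination_apply, hc]
  choose c hc using this
  exact ⟨c, by simpa only [hc] using hlim⟩

/-- A measurable version of the pointwise limit of a sequence. -/
theorem exists_measurable_pointwise_limit {α : Type*} [MeasurableSpace α] {g : ℕ → α → ℂ}
    (hg : ∀ k, Measurable (g k)) :
    ∃ Z : α → ℂ, Measurable Z ∧ ∀ ω l, Tendsto (fun k => g k ω) atTop (𝓝 l) → Z ω = l := by
  classical
  -- Cutting the sequence off to the measurable set where it converges makes it converge everywhere,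
  -- with the limit 0 elsewhere.
  let D : Set α := {ω | ∃ l, Tendsto (fun k => g k ω) atTop (𝓝 l)}
  have hD : MeasurableSet D := measurableSet_exists_tendsto hg
  have hlim : ∀ ω, ∃ l, Tendsto (fun k => D.indicator (g k) ω) atTop (𝓝 l) ∧
      ∀ l', Tendsto (fun k => g k ω) atTop (𝓝 l') → l = l' := by
    intro ω
    by_cases h : ω ∈ D
    · obtain ⟨l, hl⟩ := id h
      exact ⟨l, by simpa only [Set.indicator_of_mem h] using hl,
        fun l' hl' => tendsto_nhds_unique hl hl'⟩
    · exact ⟨0, by simp [Set.indicator_of_notMem h], fun l' hl' => absurd ⟨l', hl'⟩ h⟩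
  choose Z hZ hZ' using hlim
  exact ⟨Z, measurable_of_tendsto_metrizable (fun k => (hg k).indicator hD)
    (tendsto_pi_nhds.2 hZ), hZ'⟩

/-- An element of the closed span is only a class modulo null sets, whereas a reconstruction must be
measurable for the σ-algebra of the samples itself, without completion. Such a version is the
pointwise limit of an almost everywhere convergent subsequence of linear combinations. -/
theorem exists_isLinearReconstruction {Y : ι → Ω → ℂ} (hY : ∀ i, MemLp (Y i) 2 P) {x : Lp ℂ 2 P}
    (hx : x ∈ (Submodule.span ℂ
      (Set.range fun i => (hY i).toLp (Y i))).topologicalClosure) :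
    ∃ Z : Ω → ℂ, IsLinearReconstruction P Y Z ∧ Z =ᵐ[P] x := by
  obtain ⟨c, hc⟩ := exists_seq_linearCombination_tendsto hx
  have hnorm : Tendsto (fun k =>
      ‖x - Finsupp.linearCombination ℂ (fun i => (hY i).toLp (Y i)) (c k)‖) atTop (𝓝 0) := by
    have := (tendsto_const_nhds (x := x)).sub hc
    rw [sub_self] at this
    simpa using this.norm
  have hmeas : TendstoInMeasure P (fun k ω => (c k).sum fun i a => a * Y i ω) atTop x := by
    refine tendstoInMeasure_of_tendsto_eLpNorm (p := 2) (by norm_num) (fun k => ?_)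
      (Lp.aestronglyMeasurable x) ?_
    · exact (Lp.aestronglyMeasurable _).congr (coeFn_linearCombination_toLp hY (c k))
    · have h0 : ∀ k, eLpNorm ((fun ω => (c k).sum fun i a => a * Y i ω) - ⇑x) 2 P =
          ENNReal.ofReal ‖x - Finsupp.linearCombination ℂ (fun i => (hY i).toLp (Y i)) (c k)‖ :=
        fun k => by
          rw [← eLpNorm_sub_sum_eq hY (EventuallyEq.refl _ _) (c k), ← eLpNorm_neg, neg_sub]
          rfl
      simp_rw [h0]
      simpa using ENNReal.tendsto_ofReal hnorm
  obtain ⟨ns, -, hns⟩ := hmeas.exists_seq_tendsto_ae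
  -- The σ-algebra is passed explicitly: it is the one generated by the samples, not the ambient
  -- one.
  obtain ⟨Z, hZm, hZ⟩ := @exists_measurable_pointwise_limit Ω
    (⨆ i, MeasurableSpace.comap (Y i) inferInstance)
    (fun k ω => (c (ns k)).sum fun i a => a * Y i ω) (fun k => by
      unfold Finsupp.sum
      refine Finset.measurable_fun_sum _ fun i _ => Measurable.const_mul ?_ _
      exact Measurable.mono (comap_measurable (Y i))
        (le_iSup (fun i => MeasurableSpace.comap (Y i) inferInstance) i) le_rfl)
  have hZx : Z =ᵐ[P] x := by
    filter_upwards [hns] with ω hω using hZ ω _ hω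
  refine ⟨Z, ⟨hZm, (memLp_congr_ae hZx).2 (Lp.memLp x), fun ε hε => ?_⟩, hZx⟩
  have h1 : ∀ᶠ k in atTop, ENNReal.ofReal
      ‖x - Finsupp.linearCombination ℂ (fun i => (hY i).toLp (Y i)) (c k)‖ ≤ ε := by
    have := ENNReal.tendsto_ofReal hnorm
    rw [ENNReal.ofReal_zero] at this
    exact (this.eventually (gt_mem_nhds hε)).mono fun _ h => h.le
  obtain ⟨k, hk⟩ := h1.exists
  exact ⟨c k, by rwa [eLpNorm_sub_sum_eq hY hZx]⟩

theorem IsLinearReconstruction.mem_topologicalClosure {Y : ι → Ω → ℂ} (hY : ∀ i, MemLp (Y i) 2 P)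
    {Z : Ω → ℂ} (hZ : IsLinearReconstruction P Y Z) :
    hZ.2.1.toLp Z ∈ (Submodule.span ℂ
      (Set.range fun i => (hY i).toLp (Y i))).topologicalClosure := by
  rw [← SetLike.mem_coe, Submodule.topologicalClosure_coe, Metric.mem_closure_iff]
  intro ε hε
  obtain ⟨c, hc⟩ := hZ.2.2 (ENNReal.ofReal (ε / 2)) (by simpa using half_pos hε)
  rw [eLpNorm_sub_sum_eq hY hZ.2.1.coeFn_toLp.symm,
    ENNReal.ofReal_le_ofReal_iff (half_pos hε).le] at hc
  refine ⟨_, Finsupp.mem_span_range_iff_exists_finsupp.2 ⟨c, rfl⟩, ?_⟩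
  rw [dist_eq_norm]
  exact lt_of_le_of_lt hc (half_lt_self hε)

theorem ae_eq_of_mse_eq_zero {x y : Ω → ℂ} (hx : MemLp x 2 P) (hy : MemLp y 2 P)
    (h : mse P x y = 0) : x =ᵐ[P] y := by
  unfold mse at h
  have h' := (lintegral_eq_zero_iff' (f := fun ω => ‖x ω - y ω‖ₑ ^ 2)
    ((hx.1.sub hy.1).enorm.pow_const 2)).1 h
  filter_upwards [h'] with ω hω
  simpa [sub_eq_zero] using hω

theorem mse_eq_zero_of_ae_eq {x y : Ω → ℂ} (h : x =ᵐ[P] y) : mse P x y = 0 := by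
  unfold mse
  rw [lintegral_congr_ae (g := fun _ => 0), lintegral_zero]
  filter_upwards [h] with ω hω
  simp [hω]

end Reconstruction

section Filters

variable {Ω : Type*} [MeasurableSpace Ω] {P : Measure Ω} {M N : ℕ} {S : Fin M → ℝ → ℝ}
  [IsFiniteMeasure (specMeasure S)] {A : Fin M → ℝ → Ω → ℂ} {hA : ∀ m t, MemLp (A m t) 2 P}
  {J : Lp ℂ 2 (specMeasure S) →ₗᵢ[ℂ] Lp ℂ 2 P}

/-- Since modulation translates in time, a filter whose weights do not depend on t is described by
one spectral vector, modulated by t. -/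
theorem isometry_modulate_linearCombination
    (hJ : ∀ m t, J (expLp S t (unitVec m)) = (hA m t).toLp (A m t))
    (U : Matrix (Fin N) (Fin M) ℝ) (t : ℝ) (c : Fin N × ℝ →₀ ℂ) :
    J (modulate t (Finsupp.linearCombination ℂ
      (fun p : Fin N × ℝ => expLp S (-p.2) (mixRow U p.1)) c)) =
    Finsupp.linearCombination ℂ (fun p : Fin N × ℝ =>
      (memLp_mix hA U p.1 (t - p.2)).toLp (mix U A p.1 (t - p.2))) c := by
  simp only [Finsupp.linearCombination_apply, Finsupp.sum, map_sum, map_smul, modulate_expLp,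
    isometry_expLp_mixRow hJ, sub_eq_add_neg]

/-- The transfer function of a mean-square filter. -/
theorem IsFilterOutput.exists_transfer
    (hJ : ∀ m t, J (expLp S t (unitVec m)) = (hA m t).toLp (A m t))
    {U : Matrix (Fin N) (Fin M) ℝ} {y : ℝ → Ω → ℂ} (hy : IsFilterOutput P (mix U A) y) :
    ∃ H : Lp ℂ 2 (specMeasure S), ∀ t, (hy.1 t).toLp (y t) = J (modulate t H) := by
  obtain ⟨c, hc⟩ := hy.2
  let G : ℕ → Lp ℂ 2 (specMeasure S) := fun k => Finsupp.linearCombination ℂ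
    (fun p : Fin N × ℝ => expLp S (-p.2) (mixRow U p.1)) (c k)
  have hlim : ∀ t, Tendsto (fun k => J (modulate t (G k))) atTop (𝓝 ((hy.1 t).toLp (y t))) := by
    intro t
    have h := hc t
    simp_rw [eLpNorm_sub_sum_eq (fun p : Fin N × ℝ => memLp_mix hA U p.1 (t - p.2))
      (hy.1 t).coeFn_toLp.symm, ← isometry_modulate_linearCombination hJ U t] at h
    have h2 := (ENNReal.tendsto_toReal ENNReal.zero_ne_top).comp h
    rw [ENNReal.toReal_zero] at h2
    rw [tendsto_iff_dist_tendsto_zero]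
    refine h2.congr fun k => ?_
    rw [Function.comp_apply, ENNReal.toReal_ofReal (norm_nonneg _), dist_comm, dist_eq_norm]
  -- J and the modulations are isometries, so convergence of the outputs at the single instant 0
  -- already makes the spectral vectors converge; their limit then serves every instant.
  have hcauchy : CauchySeq G := by
    have h1 := (hlim 0).cauchySeq
    rw [Metric.cauchySeq_iff'] at h1 ⊢
    simpa only [J.isometry.dist_eq, (modulate (S := S) 0).isometry.dist_eq] using h1
  obtain ⟨H, hH⟩ := cauchySeq_tendsto_of_complete hcauchy
  refine ⟨H, fun t => tendsto_nhds_unique (hlim t) ?_⟩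
  exact ((J.continuous.comp (modulate (S := S) t).continuous).tendsto H).comp hH

/-- The translates of the mixed signals are total, so every H is a limit of their combinations. The
same combinations approximate the modulated H at every instant, because modulation is isometric. -/
theorem isFilterOutput_modulate
    (hJ : ∀ m t, J (expLp S t (unitVec m)) = (hA m t).toLp (A m t))
    (hS : ∀ m, Integrable (S m))
    (h0 : ∀ m f, 0 ≤ S m f) {B : Fin M → Set ℝ} (hB : ∀ m, ∀ f, f ∉ B m → S m f = 0)
    (hBfin : totalBandwidth B < ∞) {U : Matrix (Fin N) (Fin M) ℝ} (hU : U.rank = M)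
    (H : Lp ℂ 2 (specMeasure S)) :
    IsFilterOutput P (mix U A) fun t => J (modulate t H) := by
  refine ⟨fun t => Lp.memLp _, ?_⟩
  have hdense := span_expLp_topologicalClosure_eq_top hS h0 hB hBfin hU (-1)
  have hv : (Submodule.span ℂ (Set.range fun p : Fin N × ℝ =>
      expLp S (-p.2) (mixRow U p.1))).topologicalClosure = ⊤ := by
    rw [← top_le_iff, ← hdense]
    refine Submodule.topologicalClosure_mono (Submodule.span_mono ?_)
    rintro x ⟨n, t, -, rfl⟩
    exact ⟨(n, -t), by simp⟩
  obtain ⟨c, hc⟩ := exists_seq_linearCombination_tendsto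
    (hv.symm ▸ Submodule.mem_top : H ∈ (Submodule.span ℂ (Set.range fun p : Fin N × ℝ =>
      expLp S (-p.2) (mixRow U p.1))).topologicalClosure)
  refine ⟨c, fun t => ?_⟩
  simp_rw [eLpNorm_sub_sum_eq (fun p : Fin N × ℝ => memLp_mix hA U p.1 (t - p.2))
      (EventuallyEq.refl _ _), ← isometry_modulate_linearCombination hJ U t]
  have h1 := ((J.continuous.comp (modulate (S := S) t).continuous).tendsto H).comp hc
  have h2 := ((tendsto_const_nhds (x := J (modulate t H))).sub h1).norm
  simpa using ENNReal.tendsto_ofReal h2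

end Filters

/-! ### Densities -/

section Density

variable {κ : Type*}

/-- The number of elements with instants in `[-t, t]`, normalized as in the total density. -/
noncomputable def countRatio (N : ℕ) (S : Set (κ × ℝ)) (t : ℝ) : ℝ≥0∞ :=
  (((S ∩ {p | p.2 ∈ Set.Icc (-t) t}).encard : ℕ∞) : ℝ≥0∞) / ENNReal.ofReal (2 * t * N)

theorem samplingDensity_eq_liminf (N : ℕ) (S : Set (κ × ℝ)) :
    samplingDensity N S = liminf (countRatio N S) atTop := rfl

theorem countRatio_mono {N : ℕ} {S T : Set (κ × ℝ)} (h : S ⊆ T) (t : ℝ) :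
    countRatio N S t ≤ countRatio N T t := by
  unfold countRatio
  refine ENNReal.div_le_div_right ?_ _
  exact_mod_cast Set.encard_le_encard (Set.inter_subset_inter_left _ h)

theorem countRatio_union_le (N : ℕ) (S T : Set (κ × ℝ)) (t : ℝ) :
    countRatio N (S ∪ T) t ≤ countRatio N S t + countRatio N T t := by
  unfold countRatio
  rw [← ENNReal.add_div]
  refine ENNReal.div_le_div_right ?_ _
  rw [Set.union_inter_distrib_right]
  exact_mod_cast Set.encard_union_le _ _

/-- Adding a set that is negligible along a sequence of windows does not change the density. -/
theorem samplingDensity_union {N : ℕ} {C D : Set (κ × ℝ)} {d : ℝ≥0∞}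
    (hC : Tendsto (countRatio N C) atTop (𝓝 d)) {R : ℕ → ℝ} (hR : Tendsto R atTop atTop)
    (hD : Tendsto (fun k => countRatio N D (R k)) atTop (𝓝 0)) :
    samplingDensity N (C ∪ D) = d := by
  rw [samplingDensity_eq_liminf]
  apply le_antisymm
  -- A liminf is at most the liminf along R, where D contributes nothing.
  · have h1 : liminf (countRatio N (C ∪ D)) atTop ≤
        liminf (fun k => countRatio N (C ∪ D) (R k)) atTop :=
      liminf_le_liminf_of_le hR
    refine h1.trans ?_
    have h2 := (hC.comp hR).add hD
    rw [add_zero] at h2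
    rw [← h2.liminf_eq]
    exact liminf_le_liminf (Eventually.of_forall fun k => countRatio_union_le _ _ _ _)
  · rw [← hC.liminf_eq]
    exact liminf_le_liminf (Eventually.of_forall fun t =>
      countRatio_mono Set.subset_union_left t)

/-- Uniform grids `τ i + T i ℤ` for the labels `i ∈ I`. -/
def gridSet (I : Finset κ) (T τ : κ → ℝ) : Set (κ × ℝ) :=
  {p | p.1 ∈ I ∧ ∃ k : ℤ, p.2 = τ p.1 + k * T p.1}

/-- In each grid the window selects the integers from a ceiling to a floor, so the count misses 2t/T
by at most one per label. -/
theorem exists_encard_gridSet_inter {I : Finset κ} {T τ : κ → ℝ} (hT : ∀ i ∈ I, 0 < T i) {t : ℝ}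
    (ht : 0 ≤ t) :
    ∃ n : ℕ, (gridSet I T τ ∩ {p | p.2 ∈ Set.Icc (-t) t}).encard = n ∧
      |(n : ℝ) - 2 * t * ∑ i ∈ I, (T i)⁻¹| ≤ I.card := by
  classical
  let a : κ → ℤ := fun i => ⌈(-t - τ i) / T i⌉
  let b : κ → ℤ := fun i => ⌊(t - τ i) / T i⌋
  let F : Finset ((_ : κ) × ℤ) := I.sigma fun i => Finset.Icc (a i) (b i)
  let φ : ((_ : κ) × ℤ) → κ × ℝ := fun q => (q.1, τ q.1 + q.2 * T q.1)
  have himg : gridSet I T τ ∩ {p | p.2 ∈ Set.Icc (-t) t} = φ '' F := by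
    ext ⟨i, x⟩
    simp only [gridSet, Set.mem_inter_iff, Set.mem_ofPred_eq, Set.mem_image, Finset.mem_coe, F, φ,
      Finset.mem_sigma, Finset.mem_Icc, Prod.mk.injEq, a, b, Int.ceil_le, Int.le_floor, Set.mem_Icc]
    constructor
    · rintro ⟨⟨hi, k, rfl⟩, h1, h2⟩
      have := hT i hi
      refine ⟨⟨i, k⟩, ⟨hi, ?_, ?_⟩, rfl, rfl⟩
      · rw [div_le_iff₀ this]; linarith
      · rw [le_div_iff₀ this]; linarith
    · rintro ⟨⟨j, k⟩, ⟨hi, h1, h2⟩, rfl, rfl⟩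
      have := hT j hi
      rw [div_le_iff₀ this] at h1
      rw [le_div_iff₀ this] at h2
      exact ⟨⟨hi, k, rfl⟩, by linarith, by linarith⟩
  have hinj : Set.InjOn φ F := by
    rintro ⟨i, k⟩ hi ⟨j, l⟩ _ h
    simp only [φ, Prod.mk.injEq] at h
    obtain ⟨rfl, h⟩ := h
    have hTi := hT i (Finset.mem_sigma.1 (Finset.mem_coe.1 hi)).1
    have : (k : ℝ) = l := mul_right_cancel₀ hTi.ne' (by linarith)
    have : k = l := by exact_mod_cast this
    rw [this]
  refine ⟨F.card, by rw [himg, hinj.encard_image, Set.encard_coe_eq_coe_finsetCard], ?_⟩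
  rw [Finset.card_sigma, Finset.mul_sum]
  push_cast
  rw [← Finset.sum_sub_distrib]
  refine (Finset.abs_sum_le_sum_abs _ _).trans ?_
  rw [← nsmul_one, ← Finset.sum_const]
  refine Finset.sum_le_sum fun i hi => ?_
  have hTi := hT i hi
  -- This also covers a window between two grid points: the cardinality b + 1 - a is then zero, not
  -- a truncated negative number.
  have hab : a i ≤ b i + 1 := by
    have h1 : (-t - τ i) / T i ≤ (t - τ i) / T i := by gcongr; linarith
    exact (Int.ceil_le_ceil h1).trans (Int.ceil_le_floor_add_one _)
  have hcard : ((Finset.Icc (a i) (b i)).card : ℝ) = b i + 1 - a i := by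
    rw [Int.card_Icc]
    have : (((b i + 1 - a i).toNat : ℤ) : ℝ) = ((b i + 1 - a i : ℤ) : ℝ) := by
      rw [Int.toNat_of_nonneg (by omega)]
    push_cast at this
    exact_mod_cast this
  have h1 := Int.ceil_lt_add_one ((-t - τ i) / T i)
  have h2 := Int.le_ceil ((-t - τ i) / T i)
  have h3 := Int.lt_floor_add_one ((t - τ i) / T i)
  have h4 := Int.floor_le ((t - τ i) / T i)
  have h5 : (t - τ i) / T i - (-t - τ i) / T i = 2 * t * (T i)⁻¹ := by field_simp; ring
  rw [hcard, abs_le]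
  constructor <;> simp only [a, b] <;> linarith

theorem tendsto_countRatio_gridSet {N : ℕ} (hN : 0 < N) {I : Finset κ} {T τ : κ → ℝ}
    (hT : ∀ i ∈ I, 0 < T i) :
    Tendsto (countRatio N (gridSet I T τ)) atTop (𝓝 (ENNReal.ofReal (∑ i ∈ I, (T i)⁻¹) / N)) := by
  have hN' : (0 : ℝ) < N := by exact_mod_cast hN
  have hex : ∀ t : ℝ, ∃ n : ℕ, 0 < t →
      ((gridSet I T τ ∩ {p | p.2 ∈ Set.Icc (-t) t}).encard = n ∧
      |(n : ℝ) - 2 * t * ∑ i ∈ I, (T i)⁻¹| ≤ I.card) := fun t => by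
    rcases lt_or_ge 0 t with ht | ht
    · exact (exists_encard_gridSet_inter hT ht.le).imp fun n hn _ => hn
    · exact ⟨0, fun h => absurd h (not_lt.2 ht)⟩
  choose n hn using hex
  have hlim : Tendsto (fun t : ℝ => (n t : ℝ) / (2 * t * N)) atTop
      (𝓝 ((∑ i ∈ I, (T i)⁻¹) / N)) := by
    rw [tendsto_iff_dist_tendsto_zero]
    have h0 : Tendsto (fun t : ℝ => (I.card : ℝ) / (2 * t * N)) atTop (𝓝 0) := by
      refine tendsto_const_nhds.div_atTop ?_
      exact (tendsto_id.const_mul_atTop (by norm_num : (0 : ℝ) < 2)).atTop_mul_const hN'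
    refine squeeze_zero' (Eventually.of_forall fun _ => dist_nonneg) ?_ h0
    filter_upwards [eventually_gt_atTop 0] with t ht
    have h := (hn t ht).2
    have hd : (0 : ℝ) < 2 * t * N := by positivity
    rw [Real.dist_eq, show (n t : ℝ) / (2 * t * N) - (∑ i ∈ I, (T i)⁻¹) / N =
      ((n t : ℝ) - 2 * t * ∑ i ∈ I, (T i)⁻¹) / (2 * t * N) by field_simp, abs_div, abs_of_pos hd]
    gcongr
  have h1 := ENNReal.tendsto_ofReal hlim
  rw [ENNReal.ofReal_div_of_pos hN', ENNReal.ofReal_natCast] at h1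
  refine h1.congr' ?_
  filter_upwards [eventually_gt_atTop 0] with t ht
  have hd : (0 : ℝ) < 2 * t * N := by positivity
  rw [countRatio, (hn t ht).1, ENNReal.ofReal_div_of_pos hd, ENNReal.ofReal_natCast]
  simp

theorem samplingDensity_gridSet {N : ℕ} (hN : 0 < N) {I : Finset κ} {T τ : κ → ℝ}
    (hT : ∀ i ∈ I, 0 < T i) :
    samplingDensity N (gridSet I T τ) = ENNReal.ofReal (∑ i ∈ I, (T i)⁻¹) / N :=
  (tendsto_countRatio_gridSet hN hT).liminf_eq

theorem samplingDensity_uniformSet {N : ℕ} (hN : 0 < N) {K : ℕ} {T τ : Fin K → ℝ}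
    (hT : ∀ i, 0 < T i) :
    samplingDensity N (uniformSet T τ) = ENNReal.ofReal (∑ i, (T i)⁻¹) / N := by
  rw [← samplingDensity_gridSet (τ := τ) hN fun i _ => hT i]
  congr 1
  ext p
  simp [uniformSet, gridSet]

end Density

section MultiBandDensity

variable {N M L : ℕ}

theorem width_pos {e : Fin (L + 1) → ℝ} (he : StrictMono e) (l : Fin L) : 0 < width e l :=
  sub_pos.2 (he l.castSucc_lt_succ)

theorem samplingDensity_multiBandSet (hN : 0 < N) {e : Fin (L + 1) → ℝ} (he : StrictMono e)
    (Ξ : Fin L → Finset (Fin N)) (τ : Fin L → Fin N → ℝ) :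
    samplingDensity N (multiBandSet e Ξ τ) =
      ENNReal.ofReal (∑ l, (Ξ l).card * width e l) / N := by
  classical
  let I : Finset (Fin L × Fin N) := Finset.univ.filter fun p => p.2 ∈ Ξ p.1
  have h := samplingDensity_gridSet (I := I) (T := fun p => (width e p.1)⁻¹)
    (τ := fun p => τ p.1 p.2) hN fun p _ => inv_pos.2 (width_pos he p.1)
  have hset : gridSet I (fun p => (width e p.1)⁻¹) (fun p => τ p.1 p.2) = multiBandSet e Ξ τ := by
    ext p
    simp [gridSet, multiBandSet, I, instant, div_eq_mul_inv]
  rw [← hset, h]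
  congr 2
  simp only [inv_inv, I]
  rw [Finset.sum_filter, Fintype.sum_prod_type]
  refine Finset.sum_congr rfl fun l _ => ?_
  dsimp only
  rw [← Finset.sum_filter, Finset.sum_const, nsmul_eq_mul]
  congr 2
  simp

theorem aedisjoint_subband {e : Fin (L + 1) → ℝ} (he : StrictMono e) :
    Pairwise (Function.onFun (AEDisjoint volume) (subband e)) := by
  have key : ∀ l l' : Fin L, l < l' → AEDisjoint volume (subband e l) (subband e l') := by
    intro l l' h
    refine measure_mono_null (t := {e l.succ}) ?_ (by simp)
    rintro x ⟨⟨-, h1⟩, ⟨h2, -⟩⟩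
    have : e l.succ ≤ e l'.castSucc := he.monotone (by
      rw [Fin.le_def]; simp; exact h)
    exact le_antisymm h1 (this.trans h2)
  intro l l' h
  rcases lt_or_gt_of_ne h with h | h
  · exact key l l' h
  · exact (key l' l h).symm

/-- Pairs of a source and a subband in which it is active are counted in two ways; overlaps at
common edges are null. -/
theorem totalBandwidth_eq {B : Fin M → Set ℝ} {e : Fin (L + 1) → ℝ} {Γ : Fin L → Finset (Fin M)}
    (h : IsSubbandDivision B e Γ) :
    totalBandwidth B = ENNReal.ofReal (∑ l, (Γ l).card * width e l) := by
  classical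
  have hB : ∀ m, volume (B m) = ∑ l, if m ∈ Γ l then ENNReal.ofReal (width e l) else 0 := by
    intro m
    rw [measure_congr (h.2 m)]
    have hu : (⋃ l ∈ {l | m ∈ Γ l}, subband e l) =
        ⋃ l ∈ (Finset.univ.filter fun l => m ∈ Γ l), subband e l := by simp
    rw [hu, measure_biUnion_finset₀]
    · rw [Finset.sum_filter]
      refine Finset.sum_congr rfl fun l _ => ?_
      rw [subband, Real.volume_Icc]; rfl
    · intro l _ l' _ hl
      exact aedisjoint_subband h.1 hl
    · intro l _
      exact measurableSet_Icc.nullMeasurableSet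
  unfold totalBandwidth
  simp_rw [hB]
  rw [Finset.sum_comm, ENNReal.ofReal_sum_of_nonneg fun l _ => by
    have := width_pos h.1 l; positivity]
  refine Finset.sum_congr rfl fun l _ => ?_
  rw [← Finset.sum_filter, Finset.sum_const, nsmul_eq_mul,
    ENNReal.ofReal_mul (by positivity), ENNReal.ofReal_natCast]
  congr 2
  simp

end MultiBandDensity

section

/-! ### A sampling set for the signals themselves -/

theorem map_mem_topologicalClosure_span {E F : Type*} [NormedAddCommGroup E]
    [InnerProductSpace ℂ E] [NormedAddCommGroup F] [InnerProductSpace ℂ F] (J : E →ₗᵢ[ℂ] F)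
    {s : Set E} {x : E} (hx : x ∈ (Submodule.span ℂ s).topologicalClosure) :
    J x ∈ (Submodule.span ℂ (J '' s)).topologicalClosure := by
  rw [← SetLike.mem_coe, Submodule.topologicalClosure_coe] at hx ⊢
  refine map_mem_closure J.continuous hx fun y hy => ?_
  have := Submodule.mem_map_of_mem (f := J.toLinearMap) hy
  rw [Submodule.map_span] at this
  exact this

/-- If the vectors with large labels span a dense subspace, however large the labels, then there is
a total subfamily that is negligible along a sequence of windows. -/
theorem exists_sparse_total_subset {κ E : Type*} [NormedAddCommGroup E] [InnerProductSpace ℂ E]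
    [TopologicalSpace.SeparableSpace E] {N : ℕ} (hN : 0 < N) (v : κ × ℝ → E)
    (hv : ∀ R : ℝ, (Submodule.span ℂ (v '' {p | R < |p.2|})).topologicalClosure = ⊤) :
    ∃ (D : Set (κ × ℝ)) (R : ℕ → ℝ), (Submodule.span ℂ (v '' D)).topologicalClosure = ⊤ ∧
      Tendsto R atTop atTop ∧ Tendsto (fun k => countRatio N D (R k)) atTop (𝓝 0) := by
  classical
  -- Unpairing the index repeats every term of the dense sequence infinitely often, so that each of
  -- them is approximated within 1/(k+1) for arbitrarily large k.
  let d : ℕ → E := fun k => TopologicalSpace.denseSeq E (Nat.unpair k).1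
  have hF : ∀ (k : ℕ) (R : ℝ), ∃ F : Finset (κ × ℝ), (∀ p ∈ F, R < |p.2|) ∧
      ∃ x ∈ Submodule.span ℂ (v '' (F : Set (κ × ℝ))), dist (d k) x < 1 / ((k : ℝ) + 1) := by
    intro k R
    have hmem : d k ∈
        closure ((Submodule.span ℂ (v '' {p | R < |p.2|}) : Submodule ℂ E) : Set E) := by
      rw [← Submodule.topologicalClosure_coe, hv R]; trivial
    obtain ⟨x, hx, hdist⟩ := Metric.mem_closure_iff.1 hmem (1 / ((k : ℝ) + 1)) (by positivity)
    obtain ⟨t, ht, hxt⟩ := Submodule.mem_span_finite_of_mem_span hx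
    obtain ⟨F, hF1, hF2⟩ := Finset.subset_set_image_iff.1 ht
    refine ⟨F, fun p hp => hF1 hp, x, ?_, hdist⟩
    rw [← hF2, Finset.coe_image] at hxt
    exact hxt
  choose F hFR x hxF hxd using hF
  -- The points added at stage k lie beyond the radius R_k = k(|Q_k| + 1). The window of radius R_k
  -- therefore contains only points of Q_k, and these number at most R_k / k.
  let Q : ℕ → Finset (κ × ℝ) := fun k =>
    Nat.rec ∅ (fun k Q => Q ∪ F k (k * ((Q.card : ℝ) + 1))) k
  let R : ℕ → ℝ := fun k => k * (((Q k).card : ℝ) + 1)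
  have hQ : ∀ k, Q (k + 1) = Q k ∪ F k (R k) := fun k => rfl
  have hQmono : Monotone Q := monotone_nat_of_le_succ fun k => by
    rw [hQ]; exact Finset.subset_union_left
  have hRmono : Monotone R := fun i j hij => by
    have h1 : (i : ℝ) ≤ j := by exact_mod_cast hij
    have h2 : ((Q i).card : ℝ) ≤ (Q j).card := by exact_mod_cast Finset.card_le_card (hQmono hij)
    simp only [R]
    gcongr
  have hRk : ∀ k : ℕ, (k : ℝ) ≤ R k := fun k => by
    simp only [R]
    have : (0 : ℝ) ≤ (Q k).card := by positivity
    have : (0 : ℝ) ≤ k := by positivity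
    nlinarith
  let D : Set (κ × ℝ) := ⋃ k : ℕ, {p | p ∈ Q k}
  have hQD : ∀ k, (F k (R k) : Set (κ × ℝ)) ⊆ D := fun k p hp =>
    Set.mem_iUnion.2 ⟨k + 1, by rw [hQ]; exact Finset.mem_coe.2 (Finset.mem_union_right _ hp)⟩
  have hDQ : ∀ k, D ∩ {p | p.2 ∈ Set.Icc (-R k) (R k)} ⊆ {p | p ∈ Q k} := by
    rintro k p ⟨hp, hpR⟩
    obtain ⟨j, hj⟩ := Set.mem_iUnion.1 hp
    by_contra hnot
    have : ∀ i, p ∉ Q (k + i) := by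
      intro i
      induction i with
      | zero => exact hnot
      | succ i ih =>
        rw [← add_assoc, hQ, Finset.mem_union, not_or]
        refine ⟨ih, fun h => ?_⟩
        have h1 := hFR _ _ _ h
        have h2 := hRmono (Nat.le_add_right k i)
        have h3 : |p.2| ≤ R k := abs_le.2 hpR
        linarith
    exact this j (hQmono (Nat.le_add_left j k) hj)
  refine ⟨D, R, ?_, tendsto_atTop_mono hRk tendsto_natCast_atTop_atTop, ?_⟩
  · rw [eq_top_iff]
    intro y _
    rw [← SetLike.mem_coe, Submodule.topologicalClosure_coe, Metric.mem_closure_iff]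
    intro ε hε
    obtain ⟨j, hj⟩ := Metric.denseRange_iff.1 (TopologicalSpace.denseRange_denseSeq E) y (ε / 2)
      (half_pos hε)
    obtain ⟨i, hi⟩ := exists_nat_one_div_lt (half_pos hε)
    let k := Nat.pair j i
    have hk : d k = TopologicalSpace.denseSeq E j := by simp [d, k]
    have hki : 1 / ((k : ℝ) + 1) ≤ 1 / ((i : ℝ) + 1) := by
      have : (i : ℝ) ≤ k := by exact_mod_cast Nat.right_le_pair j i
      gcongr
    refine ⟨x k (R k), Submodule.span_mono (Set.image_mono (hQD k)) (hxF k (R k)), ?_⟩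
    have h1 := hxd k (R k)
    rw [hk] at h1
    have h2 := dist_triangle y (TopologicalSpace.denseSeq E j) (x k (R k))
    linarith
  · have hN' : (0 : ℝ) < N := by exact_mod_cast hN
    have hle : ∀ k, 1 ≤ k → countRatio N D (R k) ≤ ENNReal.ofReal (1 / (k : ℝ)) := by
      intro k hk
      have hk' : (0 : ℝ) < k := by exact_mod_cast hk
      have hN1 : (1 : ℝ) ≤ N := by exact_mod_cast hN
      unfold countRatio
      have h1 : ((D ∩ {p | p.2 ∈ Set.Icc (-R k) (R k)}).encard : ℝ≥0∞) ≤
          ENNReal.ofReal ((Q k).card) := by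
        rw [ENNReal.ofReal_natCast]
        have h2 := (Set.encard_le_encard (hDQ k)).trans_eq (Set.encard_coe_eq_coe_finsetCard (Q k))
        exact_mod_cast h2
      have hpos : 0 < 2 * R k * N := by
        have := hRk k
        have : 0 < R k := by linarith
        positivity
      refine (ENNReal.div_le_div_right h1 _).trans ?_
      rw [← ENNReal.ofReal_div_of_pos hpos]
      refine ENNReal.ofReal_le_ofReal ?_
      rw [div_le_div_iff₀ hpos hk']
      have hq : (0 : ℝ) ≤ (Q k).card := by positivity
      have e1 : ((Q k).card : ℝ) * k ≤ R k := by simp only [R]; nlinarith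
      have e2 : R k ≤ R k * N := by nlinarith [hRk k]
      nlinarith [hRk k]
    have hlim : Tendsto (fun k : ℕ => ENNReal.ofReal (1 / (k : ℝ))) atTop (𝓝 0) := by
      have := ENNReal.tendsto_ofReal tendsto_one_div_atTop_nhds_zero_nat
      rwa [ENNReal.ofReal_zero] at this
    refine tendsto_of_tendsto_of_tendsto_of_le_of_le' tendsto_const_nhds hlim
      (Eventually.of_forall fun _ => zero_le) ?_
    filter_upwards [eventually_ge_atTop 1] with k hk using hle k hk

variable {Ω : Type*} [MeasurableSpace Ω] {P : Measure Ω} {M N : ℕ} {S : Fin M → ℝ → ℝ}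
  [IsFiniteMeasure (specMeasure S)] {A : Fin M → ℝ → Ω → ℂ} {hA : ∀ m t, MemLp (A m t) 2 P}
  {J : Lp ℂ 2 (specMeasure S) →ₗᵢ[ℂ] Lp ℂ 2 P}

/-- The sparse total set alone determines the signals; the grid only raises the density to the
prescribed value. -/
theorem exists_sampling_set (hN : 0 < N)
    (hJ : ∀ m t, J (expLp S t (unitVec m)) = (hA m t).toLp (A m t))
    (hS : ∀ m, Integrable (S m))
    (h0 : ∀ m f, 0 ≤ S m f) {B : Fin M → Set ℝ} (hB : ∀ m, ∀ f, f ∉ B m → S m f = 0)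
    (hBfin : totalBandwidth B < ∞) {U : Matrix (Fin N) (Fin M) ℝ} (hU : U.rank = M) :
    ∃ 𝒮 : Set (Fin N × ℝ), samplingDensity N 𝒮 = totalBandwidth B / N ∧
      ∃ Xhat : Fin N → ℝ → Ω → ℂ,
        (∀ n t, IsLinearReconstruction P (fun s : 𝒮 => mix U A s.1.1 s.1.2) (Xhat n t)) ∧
        ∀ n t, mse P (mix U A n t) (Xhat n t) = 0 := by
  -- Needed for the separability of the spectral `Lp` space.
  have : Fact ((2 : ℝ≥0∞) ≠ ∞) := ⟨by norm_num⟩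
  obtain ⟨D, R, hD, hR, hDR⟩ := exists_sparse_total_subset hN
    (fun p : Fin N × ℝ => expLp S p.2 (mixRow U p.1)) (fun R => by
      rw [← span_expLp_topologicalClosure_eq_top hS h0 hB hBfin hU R]
      congr 2; ext x
      simp only [Set.mem_image, Prod.exists, Set.mem_ofPred_eq]
      exact exists_congr fun n => exists_congr fun t => by rw [eq_comm (a := x)])
  -- One grid of rate B on a single channel; for B = 0 no period exists and the grid is empty.
  obtain ⟨I, T, hT, hIT⟩ : ∃ (I : Finset (Fin N)) (T : Fin N → ℝ), (∀ i ∈ I, 0 < T i) ∧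
      ENNReal.ofReal (∑ i ∈ I, (T i)⁻¹) = totalBandwidth B := by
    rcases eq_or_ne (totalBandwidth B) 0 with h | h
    · exact ⟨∅, fun _ => 1, by simp, by simp [h]⟩
    · have hpos := ENNReal.toReal_pos h hBfin.ne
      refine ⟨{⟨0, hN⟩}, fun _ => (totalBandwidth B).toReal⁻¹, fun _ _ => inv_pos.2 hpos, ?_⟩
      simp [ENNReal.ofReal_toReal hBfin.ne]
  have hdens := samplingDensity_union (tendsto_countRatio_gridSet (τ := fun _ => 0) hN hT) hR hDR
  rw [hIT] at hdens
  refine ⟨_, hdens, ?_⟩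
  set 𝒮 := gridSet I T (fun _ => 0) ∪ D with h𝒮
  have hex : ∀ n t, ∃ Z : Ω → ℂ,
      IsLinearReconstruction P (fun s : 𝒮 => mix U A s.1.1 s.1.2) Z ∧
      Z =ᵐ[P] J (expLp S t (mixRow U n)) := by
    intro n t
    refine exists_isLinearReconstruction (fun s : 𝒮 => memLp_mix hA U s.1.1 s.1.2) ?_
    have hmem : expLp S t (mixRow U n) ∈ (Submodule.span ℂ
        ((fun p : Fin N × ℝ => expLp S p.2 (mixRow U p.1)) '' D)).topologicalClosure := by
      rw [hD]; trivial
    refine Submodule.topologicalClosure_mono (Submodule.span_mono ?_)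
      (map_mem_topologicalClosure_span J hmem)
    rintro _ ⟨_, ⟨p, hp, rfl⟩, rfl⟩
    exact ⟨⟨p, Or.inr hp⟩, (isometry_expLp_mixRow hJ U p.1 p.2).symm⟩
  choose Xhat hX hXe using hex
  refine ⟨Xhat, hX, fun n t => mse_eq_zero_of_ae_eq ?_⟩
  refine EventuallyEq.trans ?_ (hXe n t).symm
  rw [isometry_expLp_mixRow hJ]
  exact (memLp_mix hA U n t).coeFn_toLp.symm

end

/-! ### Channel selection and spatial interpolation -/

section Algebra

variable {N M L : ℕ}

theorem linearIndependent_col_of_rank_eq {m n : Type*} [Fintype m] [Fintype n]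
    {U : Matrix m n ℝ} (hU : U.rank = Fintype.card n) : LinearIndependent ℝ U.col := by
  rw [linearIndependent_iff_card_eq_finrank_span, Set.finrank,
    ← Matrix.rank_eq_finrank_span_cols, hU]

/-- The columns of U are independent, so U(·, G) has rank |G|; row rank equals column rank, and a
basis of the row space can be chosen among the rows. -/
theorem exists_isChannelSelection {U : Matrix (Fin N) (Fin M) ℝ} (hU : U.rank = M)
    (Γ : Fin L → Finset (Fin M)) : ∃ Ξ : Fin L → Finset (Fin N), IsChannelSelection U Γ Ξ := by
  classical
  have hcol : LinearIndependent ℝ U.col := linearIndependent_col_of_rank_eq (by simpa using hU)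
  have key : ∀ G : Finset (Fin M), ∃ X : Finset (Fin N), X.card = G.card ∧
      LinearIndependent ℝ (fun i : X => fun j : G => U i j) := by
    intro G
    let W : Matrix (Fin N) G ℝ := fun i j => U i j
    have hW : W.rank = G.card := by
      have : LinearIndependent ℝ W.col := hcol.comp (fun j : G => (j : Fin M))
        Subtype.val_injective
      rw [Matrix.rank_eq_finrank_span_cols, finrank_span_eq_card this, Fintype.card_coe]
    obtain ⟨κ, a, ha, hspan, hli⟩ := exists_linearIndependent' ℝ W.row
    have : Finite κ := Finite.of_injective a ha
    have : Fintype κ := Fintype.ofFinite κ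
    refine ⟨Finset.univ.image a, ?_, ?_⟩
    · rw [Finset.card_image_of_injective _ ha, Finset.card_univ, ← finrank_span_eq_card hli, hspan,
        ← Matrix.rank_eq_finrank_span_row, hW]
    · let eq : κ ≃ (Finset.univ.image a : Finset (Fin N)) :=
        (Equiv.ofInjective a ha).trans (Equiv.subtypeEquivRight fun x => by simp)
      rw [← linearIndependent_equiv eq]
      exact hli
  choose X hX using fun l => key (Γ l)
  exact ⟨X, hX⟩

/-- The selected block is square with independent rows, so its Gram matrix is invertible and the
interpolation operator is U(·, G) times a left inverse of the block. -/
theorem sum_spatialInterp_mul {U : Matrix (Fin N) (Fin M) ℝ} {G : Finset (Fin M)}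
    {X : Finset (Fin N)} (hcard : X.card = G.card)
    (hli : LinearIndependent ℝ (fun i : X => fun j : G => U i j)) (n : Fin N) {m : Fin M}
    (hm : m ∈ G) : ∑ j : X, spatialInterp U G X n j * U j m = U n m := by
  let Us : Matrix X G ℝ := U.submatrix (fun i => (i : Fin N)) (fun j => (j : Fin M))
  have hrank : (Us.conjTranspose * Us).rank = Fintype.card G := by
    rw [Matrix.rank_conjTranspose_mul_self, LinearIndependent.rank_matrix (M := Us) hli,
      Fintype.card_coe, Fintype.card_coe, hcard]
  have hunit : IsUnit (Us.conjTranspose * Us) :=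
    Matrix.linearIndependent_cols_iff_isUnit.1 (linearIndependent_col_of_rank_eq hrank)
  have h : spatialInterp U G X * Us = U.submatrix id (fun j : G => (j : Fin M)) := by
    change U.submatrix id (fun j : G => (j : Fin M)) * (Us.conjTranspose * Us)⁻¹ *
      Us.conjTranspose * Us = _
    rw [Matrix.mul_assoc, Matrix.mul_assoc,
      Matrix.nonsing_inv_mul _ ((Matrix.isUnit_iff_isUnit_det _).1 hunit), Matrix.mul_one]
  have := congrFun (congrFun h n) ⟨m, hm⟩
  rw [Matrix.mul_apply] at this
  exact this

end Algebra

/-! ### Bounded convergence in the spectral `L²` space -/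

section Bounded

/-- Dominated convergence with a constant majorant. The filter is general so that the same statement
covers continuity in t, truncation radii R → ∞ and partial sums K → ∞. -/
theorem tendsto_toLp_of_bounded {α ι : Type*} [MeasurableSpace α] {μ : Measure α}
    [IsFiniteMeasure μ] {l : Filter ι} [l.IsCountablyGenerated] {g : ι → α → ℂ} {g₀ : α → ℂ}
    (hg : ∀ i, MemLp (g i) 2 μ) (hg₀ : MemLp g₀ 2 μ) (C : ℝ) (hC : ∀ i, ∀ᵐ p ∂μ, ‖g i p‖ ≤ C)
    (hlim : ∀ᵐ p ∂μ, Tendsto (fun i => g i p) l (𝓝 (g₀ p))) :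
    Tendsto (fun i => (hg i).toLp (g i)) l (𝓝 (hg₀.toLp g₀)) := by
  rcases l.eq_or_neBot with rfl | hl
  · exact tendsto_bot
  rcases isEmpty_or_nonempty ι with hι | ⟨⟨i₀⟩⟩
  · exact absurd (Subsingleton.elim l ⊥) hl.ne
  -- Each bound holds off its own null set; along a sequence there are countably many of these, and
  -- the limit inherits the bound.
  obtain ⟨u, hu⟩ := l.exists_seq_tendsto
  have hC₀ : ∀ᵐ p ∂μ, ‖g₀ p‖ ≤ C := by
    filter_upwards [hlim, ae_all_iff.2 fun k => hC (u k)] with p h1 h2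
    exact le_of_tendsto (h1.comp hu).norm (Eventually.of_forall h2)
  rw [tendsto_iff_norm_sub_tendsto_zero]
  have e : ∀ i, ‖(hg i).toLp (g i) - hg₀.toLp g₀‖ =
      (∫ p, ‖g i p - g₀ p‖ ^ 2 ∂μ) ^ (2 : ℝ)⁻¹ := fun i => by
    rw [← MemLp.toLp_sub, Lp.norm_toLp, MemLp.eLpNorm_eq_integral_rpow_norm (by norm_num)
      (by norm_num) ((hg i).sub hg₀), ENNReal.toReal_ofReal (by positivity)]
    simp
  simp_rw [e]
  have h1 : Tendsto (fun i => ∫ p, ‖g i p - g₀ p‖ ^ 2 ∂μ) l (𝓝 (∫ _, (0 : ℝ) ∂μ)) := by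
    refine tendsto_integral_filter_of_dominated_convergence (fun _ => (C + C) ^ 2)
      (Eventually.of_forall fun i => ((hg i).1.sub hg₀.1).norm.pow 2)
      (Eventually.of_forall fun i => ?_) (integrable_const _) ?_
    · filter_upwards [hC i, hC₀] with p h1 h2
      rw [norm_pow, norm_norm]
      gcongr
      exact (norm_sub_le _ _).trans (add_le_add h1 h2)
    · filter_upwards [hlim] with p hp
      have := ((hp.sub_const (g₀ p)).norm).pow 2
      simpa using this
  rw [integral_zero] at h1
  have := h1.rpow_const (p := (2 : ℝ)⁻¹) (Or.inr (by norm_num))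
  simpa using this

variable {M : ℕ} {S : Fin M → ℝ → ℝ}

theorem continuous_cexpi_right (f : ℝ) : Continuous (cexpi f) := by
  unfold cexpi; fun_prop

theorem norm_fiber_mul_le (a : Fin M → ℂ) (m : Fin M) {z : ℂ} {C : ℝ} (hz : ‖z‖ ≤ C) :
    ‖a m * z‖ ≤ (∑ m, ‖a m‖) * C := by
  rw [norm_mul]
  have h := Finset.single_le_sum (f := fun m => ‖a m‖) (fun _ _ => norm_nonneg _)
    (Finset.mem_univ m)
  exact mul_le_mul h hz (norm_nonneg _) (Finset.sum_nonneg fun _ _ => norm_nonneg _)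

theorem continuous_expLp [IsFiniteMeasure (specMeasure S)] (a : Fin M → ℂ) :
    Continuous fun t => expLp S t a := by
  rw [continuous_iff_continuousAt]
  intro t
  refine tendsto_toLp_of_bounded _ _ ((∑ m, ‖a m‖) * 1)
    (fun s => Eventually.of_forall fun p => ?_) (Eventually.of_forall fun p => ?_)
  · exact norm_fiber_mul_le a p.1 (norm_cexpi _ _).le
  · exact ((continuous_cexpi_right p.2).tendsto t).const_mul _

theorem measurable_fiber_mul (a : Fin M → ℂ) {φ : ℝ → ℂ} (hφ : Measurable φ) :
    Measurable fun p : Fin M × ℝ => a p.1 * φ p.2 :=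
  ((measurable_of_finite a).comp measurable_fst).mul (hφ.comp measurable_snd)

theorem memLp_fiber_mul [IsFiniteMeasure (specMeasure S)] (a : Fin M → ℂ) {φ : ℝ → ℂ}
    (hφ : Measurable φ) {C : ℝ} (hC : ∀ f, ‖φ f‖ ≤ C) :
    MemLp (fun p : Fin M × ℝ => a p.1 * φ p.2) 2 (specMeasure S) :=
  MemLp.of_bound (measurable_fiber_mul a hφ).aestronglyMeasurable _
    (Eventually.of_forall fun p => norm_fiber_mul_le a p.1 (hC p.2))

theorem continuous_bandPass (a b : ℝ) : Continuous (bandPass a b) := by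
  unfold bandPass
  refine intervalIntegral.continuous_parametric_intervalIntegral_of_continuous' ?_ _ _
  unfold Function.uncurry
  fun_prop

/-- A weighted integral of exponentials in `L²` is computed pointwise. -/
theorem integral_smul_expLp [IsFiniteMeasure (specMeasure S)] {h : ℝ → ℂ} (hh : Continuous h)
    (a : Fin M → ℂ) (t R : ℝ) :
    ∃ hmem : MemLp (fun p : Fin M × ℝ =>
        a p.1 * (cexpi p.2 t * ∫ s in (-R)..R, h s * cexpi p.2 (-s))) 2 (specMeasure S),
      ∫ s in (-R)..R, h s • expLp S (t - s) a = hmem.toLp _ := by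
  have hcont : Continuous fun s => h s • expLp S (t - s) a :=
    hh.smul ((continuous_expLp a).comp (continuous_const.sub continuous_id))
  have hcu : Continuous fun q : ℝ × ℝ => h q.2 * cexpi q.1 (-q.2) := by
    unfold cexpi; fun_prop
  have hφ : Continuous fun f : ℝ => cexpi f t * ∫ s in (-R)..R, h s * cexpi f (-s) := by
    refine Continuous.mul (by unfold cexpi; fun_prop) ?_
    exact intervalIntegral.continuous_parametric_intervalIntegral_of_continuous'
      (f := fun f s => h s * cexpi f (-s)) hcu _ _
  obtain ⟨C, hC⟩ := (isCompact_uIcc (a := -R) (b := R)).exists_bound_of_continuousOn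
    hh.continuousOn
  have hC0 : ∀ s ∈ Set.uIoc (-R) R, ∀ f u, ‖h s * cexpi f u‖ ≤ C := fun s hs f u => by
    rw [norm_mul, norm_cexpi, mul_one]; exact hC s (Set.uIoc_subset_uIcc hs)
  have hφb : ∀ f, ‖cexpi f t * ∫ s in (-R)..R, h s * cexpi f (-s)‖ ≤ C * |R - -R| := fun f => by
    rw [norm_mul, norm_cexpi, one_mul]
    exact intervalIntegral.norm_integral_le_of_norm_le_const fun s hs => hC0 s hs f _
  have hmem := memLp_fiber_mul (S := S) a hφ.measurable hφb
  refine ⟨hmem, ?_⟩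
  -- A Bochner integral in `Lp` has no immediate pointwise value; pairing with an arbitrary g and
  -- exchanging the integrals identifies it.
  refine ext_inner_left ℂ fun g => ?_
  have hgi : Integrable (fun p => (starRingEnd ℂ) (g p)) (specMeasure S) :=
    Complex.conjCLE.integrable_comp_iff.2 ((Lp.memLp g).integrable (by norm_num))
  have e1 : inner ℂ g (∫ s in (-R)..R, h s • expLp S (t - s) a) =
      ∫ s in (-R)..R, ∫ p, (h s * (a p.1 * cexpi p.2 (t - s))) * (starRingEnd ℂ) (g p)
        ∂specMeasure S := by
    have := ContinuousLinearMap.intervalIntegral_comp_comm (innerSL ℂ g)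
      (hcont.intervalIntegrable (μ := volume) (-R) R)
    rw [innerSL_apply_apply] at this
    rw [← this]
    congr 1; ext s
    rw [innerSL_apply_apply, inner_smul_right, L2.inner_def, ← integral_const_mul]
    refine integral_congr_ae ?_
    filter_upwards [coeFn_expLp (S := S) (t - s) a] with p hp
    rw [hp, RCLike.inner_apply]; ring
  have hint : Integrable (Function.uncurry fun (s : ℝ) (p : Fin M × ℝ) =>
      (h s * (a p.1 * cexpi p.2 (t - s))) * (starRingEnd ℂ) (g p))
      ((volume.restrict (Set.uIoc (-R) R)).prod (specMeasure S)) := by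
    have : IsFiniteMeasure (volume.restrict (Set.uIoc (-R) R)) := ⟨by simp⟩
    refine Integrable.bdd_mul (c := C * ∑ m, ‖a m‖) (hgi.comp_snd _) ?_ ?_
    · have h1 : Measurable fun q : ℝ × (Fin M × ℝ) => a q.2.1 :=
        (measurable_of_finite a).comp (measurable_fst.comp measurable_snd)
      have h2 : Measurable fun q : ℝ × (Fin M × ℝ) => cexpi q.2.2 (t - q.1) := by
        unfold cexpi; fun_prop
      exact ((hh.measurable.comp measurable_fst).mul (h1.mul h2)).aestronglyMeasurable
    · have hae : ∀ᵐ q ∂((volume.restrict (Set.uIoc (-R) R)).prod (specMeasure S)),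
          q.1 ∈ Set.uIoc (-R) R :=
        Measure.quasiMeasurePreserving_fst.ae (ae_restrict_mem measurableSet_uIoc)
      filter_upwards [hae] with q hq
      rw [norm_mul]
      have h1 := hC q.1 (Set.uIoc_subset_uIcc hq)
      have h2 := norm_fiber_mul_le a q.2.1 (norm_cexpi q.2.2 (t - q.1)).le
      rw [mul_one] at h2
      exact mul_le_mul h1 h2 (norm_nonneg _) ((norm_nonneg _).trans h1)
  rw [e1, intervalIntegral_integral_swap hint, L2.inner_def]
  refine integral_congr_ae ?_
  filter_upwards [hmem.coeFn_toLp] with p hp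
  rw [hp, RCLike.inner_apply, intervalIntegral.integral_mul_const,
    ← intervalIntegral.integral_const_mul,
    ← intervalIntegral.integral_const_mul]
  congr 2; ext s
  rw [sub_eq_add_neg, cexpi_add]; ring

end Bounded

section

/-! ### The multi-band scheme -/

/-- The indicator function of a frequency band. -/
noncomputable def bandInd (a b f : ℝ) : ℂ := (Set.Icc a b).indicator (fun _ => 1) f

theorem measurable_bandInd (a b : ℝ) : Measurable (bandInd a b) :=
  measurable_const.indicator measurableSet_Icc

theorem norm_bandInd_le (a b f : ℝ) : ‖bandInd a b f‖ ≤ 1 := by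
  unfold bandInd Set.indicator
  split_ifs <;> simp

theorem ae_specMeasure_of_ae {M : ℕ} {S : Fin M → ℝ → ℝ} (hS : ∀ m, Integrable (S m)) {Q : ℝ → Prop}
    (h : ∀ᵐ f, Q f) : ∀ᵐ p ∂specMeasure S, Q p.2 :=
  (ae_specMeasure_iff hS).2 fun _ => h.mono fun _ hf _ => hf

variable {Ω : Type*} [MeasurableSpace Ω] {P : Measure Ω} {M N L : ℕ} {S : Fin M → ℝ → ℝ}
  [IsFiniteMeasure (specMeasure S)]

theorem coeFn_sum_smul {α ι : Type*} [MeasurableSpace α] {μ : Measure α} (s : Finset ι)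
    (c : ι → ℂ) (x : ι → Lp ℂ 2 μ) :
    (∑ i ∈ s, c i • x i : Lp ℂ 2 μ) =ᵐ[μ] fun p => ∑ i ∈ s, c i * x i p := by
  filter_upwards [Lp.coeFn_finsetSum s fun i => c i • x i,
    (ae_ball_iff s.countable_toSet).2 fun i _ => Lp.coeFn_smul (c i) (x i)] with p h1 h2
  rw [h1, Finset.sum_apply]
  exact Finset.sum_congr rfl fun i hi => h2 i hi

/-- The transfer function of the ideal band-pass filter applied to the signal with the mixing
coefficients `a`. -/
noncomputable def bandVec (S : Fin M → ℝ → ℝ) [IsFiniteMeasure (specMeasure S)] (x y : ℝ)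
    (a : Fin M → ℂ) : Lp ℂ 2 (specMeasure S) :=
  (memLp_fiber_mul a (measurable_bandInd x y) (norm_bandInd_le x y)).toLp _

theorem coeFn_modulate_bandVec (x y t : ℝ) (a : Fin M → ℂ) :
    modulate t (bandVec S x y a) =ᵐ[specMeasure S]
      fun p => a p.1 * (bandInd x y p.2 * cexpi p.2 t) := by
  filter_upwards [coeFn_modulate t (bandVec S x y a),
    (memLp_fiber_mul (S := S) a (measurable_bandInd x y) (norm_bandInd_le x y)).coeFn_toLp]
    with p h1 h2
  rw [h1, bandVec, h2]; ring

theorem ae_ne_const (c : ℝ) : ∀ᵐ f : ℝ, f ≠ c := by simp [ae_iff]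

/-- The truncated convolution multiplies the exponential by a partial frequency response, which is
bounded by 8 and converges except at the two edges. These are null because the spectral measure has
densities. -/
theorem tendsto_integral_bandPass_smul_expLp (hS : ∀ m, Integrable (S m)) {x y : ℝ} (hxy : x < y)
    (a : Fin M → ℂ) (t : ℝ) :
    Tendsto (fun R : ℝ => ∫ s in (-R)..R, bandPass x y s • expLp S (t - s) a) atTop
      (𝓝 (modulate t (bandVec S x y a))) := by
  choose hmem hint using fun R : ℝ => integral_smul_expLp (S := S) (continuous_bandPass x y) a t R
  simp_rw [hint]
  rw [← Lp.toLp_coeFn (modulate t (bandVec S x y a)) (Lp.memLp _)]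
  refine tendsto_toLp_of_bounded _ _ ((∑ m, ‖a m‖) * 8)
    (fun R => Eventually.of_forall fun p => ?_) ?_
  · refine norm_fiber_mul_le a p.1 ?_
    rw [norm_mul, norm_cexpi, one_mul]
    exact norm_integral_bandPass_mul_exp_le x y R p.2
  · filter_upwards [coeFn_modulate_bandVec (S := S) x y t a,
      ae_specMeasure_of_ae hS ((ae_ne_const x).and (ae_ne_const y))] with p h1 h2
    rw [h1, mul_comm (bandInd x y p.2)]
    exact ((tendsto_integral_bandPass_mul_exp hxy h2.1 h2.2).const_mul _).const_mul _

variable {A : Fin M → ℝ → Ω → ℂ} {hA : ∀ m t, MemLp (A m t) 2 P}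
  {J : Lp ℂ 2 (specMeasure S) →ₗᵢ[ℂ] Lp ℂ 2 P}

theorem isConvolution_bandPass
    (hJ : ∀ m t, J (expLp S t (unitVec m)) = (hA m t).toLp (A m t))
    (hS : ∀ m, Integrable (S m)) {x y : ℝ} (hxy : x < y) (U : Matrix (Fin N) (Fin M) ℝ)
    (n : Fin N) :
    IsConvolution P (bandPass x y) (mix U A n)
      (fun t => J (modulate t (bandVec S x y (mixRow U n)))) := by
  refine ⟨fun t => memLp_mix hA U n t, fun t => Lp.memLp _, fun t => ?_⟩
  have hcont : Continuous fun s => bandPass x y s • expLp S (t - s) (mixRow U n) :=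
    (continuous_bandPass x y).smul
      ((continuous_expLp _).comp (continuous_const.sub continuous_id))
  have e : ∀ s, bandPass x y s • (memLp_mix hA U n (t - s)).toLp (mix U A n (t - s)) =
      J.toContinuousLinearMap (bandPass x y s • expLp S (t - s) (mixRow U n)) := fun s => by
    rw [map_smul]
    exact congrArg _ (isometry_expLp_mixRow hJ U n (t - s)).symm
  simp_rw [e]
  refine ⟨fun R => (J.continuous.comp hcont).intervalIntegrable _ _, ?_⟩
  simp_rw [fun R : ℝ => ContinuousLinearMap.intervalIntegral_comp_comm J.toContinuousLinearMap
    (hcont.intervalIntegrable (μ := volume) (-R) R)]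
  rw [Lp.toLp_coeFn]
  exact (J.continuous.tendsto _).comp (tendsto_integral_bandPass_smul_expLp hS hxy _ t)

/-- The partial interpolation sums in the spectral domain. -/
noncomputable def interpVec (S : Fin M → ℝ → ℝ) [IsFiniteMeasure (specMeasure S)]
    (e : Fin (L + 1) → ℝ) (l : Fin L) (τ : ℝ) (a : Fin M → ℂ) (t : ℝ) (K : ℕ) :
    Lp ℂ 2 (specMeasure S) :=
  ∑ k ∈ Finset.Icc (-(K : ℤ)) K, kernel e l (t - (τ + k / width e l)) •
    modulate (τ + k / width e l) (bandVec S (e l.castSucc) (e l.succ) a)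

theorem coeFn_interpVec (e : Fin (L + 1) → ℝ) (l : Fin L) (τ : ℝ) (a : Fin M → ℂ) (t : ℝ)
    (K : ℕ) : interpVec S e l τ a t K =ᵐ[specMeasure S]
      fun p => a p.1 * (bandInd (e l.castSucc) (e l.succ) p.2 * bandSum e l τ t K p.2) := by
  unfold interpVec
  filter_upwards [coeFn_sum_smul (μ := specMeasure S) (Finset.Icc (-(K : ℤ)) K)
    (fun k => kernel e l (t - (τ + k / width e l)))
    (fun k => modulate (τ + k / width e l) (bandVec S (e l.castSucc) (e l.succ) a)),
    ae_all_iff.2 fun k : ℤ => coeFn_modulate_bandVec (S := S) (e l.castSucc) (e l.succ)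
      (τ + k / width e l) a] with p h1 h2
  rw [h1, bandSum, Finset.mul_sum, Finset.mul_sum]
  refine Finset.sum_congr rfl fun k _ => ?_
  rw [h2]; ring

/-- The indicator restricts the band sums to the band, where they are bounded uniformly in K; the
exceptional edges are null. -/
theorem tendsto_interpVec (hS : ∀ m, Integrable (S m)) {e : Fin (L + 1) → ℝ} (he : StrictMono e)
    (l : Fin L) (τ : ℝ) (a : Fin M → ℂ) (t : ℝ) :
    Tendsto (interpVec S e l τ a t) atTop
      (𝓝 (modulate t (bandVec S (e l.castSucc) (e l.succ) a))) := by
  have hw := width_pos he l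
  have h := tendsto_toLp_of_bounded (l := atTop) (g := fun K => interpVec S e l τ a t K)
    (g₀ := modulate t (bandVec S (e l.castSucc) (e l.succ) a))
    (fun K => Lp.memLp _) (Lp.memLp _)
    ((∑ m, ‖a m‖) * (8 + 8 * Real.pi * |width e l * (t - τ)|)) (fun K => ?_) ?_
  · simpa only [Lp.toLp_coeFn] using h
  · filter_upwards [coeFn_interpVec (S := S) e l τ a t K] with p hp
    rw [hp]
    refine norm_fiber_mul_le a p.1 ?_
    have hpi := Real.pi_pos
    by_cases hf : p.2 ∈ Set.Icc (e l.castSucc) (e l.succ)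
    · rw [bandInd, Set.indicator_of_mem hf, one_mul]
      exact norm_bandSum_le hw τ t K hf
    · rw [bandInd, Set.indicator_of_notMem hf, zero_mul, norm_zero]
      positivity
  · filter_upwards [ae_all_iff.2 fun K => coeFn_interpVec (S := S) e l τ a t K,
      coeFn_modulate_bandVec (S := S) (e l.castSucc) (e l.succ) t a,
      ae_specMeasure_of_ae hS ((ae_ne_const (e l.castSucc)).and (ae_ne_const (e l.succ)))]
      with p h1 h2 h3
    simp_rw [h1, h2]
    refine Tendsto.const_mul _ ?_
    by_cases hf : p.2 ∈ Set.Icc (e l.castSucc) (e l.succ)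
    · exact (tendsto_bandSum hw τ t
        ⟨lt_of_le_of_ne hf.1 h3.1.symm, lt_of_le_of_ne hf.2 h3.2⟩).const_mul _
    · simp only [bandInd, Set.indicator_of_notMem hf, zero_mul]
      exact tendsto_const_nhds

/-- The spatial interpolation of the subband signals restores the mixed signals. -/
theorem sum_spatialInterp_smul_modulate (hS : ∀ m, Integrable (S m)) {B : Fin M → Set ℝ}
    (hB : ∀ m, ∀ f, f ∉ B m → S m f = 0) {U : Matrix (Fin N) (Fin M) ℝ}
    {e : Fin (L + 1) → ℝ} {Γ : Fin L → Finset (Fin M)} (hdiv : IsSubbandDivision B e Γ)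
    {Ξ : Fin L → Finset (Fin N)} (hΞ : IsChannelSelection U Γ Ξ) (n : Fin N) (t : ℝ) :
    ∑ l, ∑ j : Ξ l, (spatialInterp U (Γ l) (Ξ l) n j : ℂ) •
      modulate t (bandVec S (e l.castSucc) (e l.succ) (mixRow U j)) = expLp S t (mixRow U n) := by
  refine Lp.ext ?_
  have h1 : ∀ l, (∑ j : Ξ l, (spatialInterp U (Γ l) (Ξ l) n j : ℂ) •
      modulate t (bandVec S (e l.castSucc) (e l.succ) (mixRow U j)) :
        Lp ℂ 2 (specMeasure S)) =ᵐ[specMeasure S] fun p =>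
      (∑ j : Ξ l, (spatialInterp U (Γ l) (Ξ l) n j : ℂ) * U j p.1) *
        (bandInd (e l.castSucc) (e l.succ) p.2 * cexpi p.2 t) := fun l => by
    filter_upwards [coeFn_sum_smul (μ := specMeasure S) Finset.univ
      (fun j : Ξ l => (spatialInterp U (Γ l) (Ξ l) n j : ℂ))
      (fun j => modulate t (bandVec S (e l.castSucc) (e l.succ) (mixRow U j))),
      ae_all_iff.2 fun j : Ξ l => coeFn_modulate_bandVec (S := S) (e l.castSucc) (e l.succ) t
        (mixRow U j)] with p h1 h2
    rw [h1, Finset.sum_mul]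
    refine Finset.sum_congr rfl fun j _ => ?_
    rw [h2, mixRow]; ring
  -- Together with the covering below: almost every spectral point (m, f) lies in exactly one
  -- subband, and m is active there. Only that term survives, and there the spatial interpolation is
  -- exact.
  have hdisj : ∀ᵐ f : ℝ, ∀ l l', l ≠ l' → ¬ (f ∈ subband e l ∧ f ∈ subband e l') := by
    refine ae_all_iff.2 fun l => ae_all_iff.2 fun l' => ?_
    by_cases hl : l = l'
    · exact Eventually.of_forall fun _ h => absurd hl h
    · have := measure_eq_zero_iff_ae_notMem.1 (aedisjoint_subband hdiv.1 hl)
      filter_upwards [this] with f hf _ using hf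
  have hcover : ∀ᵐ p ∂specMeasure S, ∃ l, p.1 ∈ Γ l ∧ p.2 ∈ subband e l := by
    refine (ae_specMeasure_iff hS).2 fun m => ?_
    filter_upwards [(hdiv.2 m).mem_iff] with f hf hpos
    have hfB : f ∈ B m := by
      by_contra h
      exact hpos.ne' (hB m f h)
    simpa using hf.1 hfB
  filter_upwards [Lp.coeFn_finsetSum Finset.univ fun l => ∑ j : Ξ l,
      (spatialInterp U (Γ l) (Ξ l) n j : ℂ) •
      modulate t (bandVec S (e l.castSucc) (e l.succ) (mixRow U j)), ae_all_iff.2 h1,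
    ae_specMeasure_of_ae hS hdisj, hcover, coeFn_expLp (S := S) t (mixRow U n)]
    with p h2 h3 h4 h5 h6
  obtain ⟨l₀, hm, hf⟩ := h5
  rw [h2, Finset.sum_apply, h6, Finset.sum_eq_single l₀]
  · have h7 := sum_spatialInterp_mul (hΞ l₀).1 (hΞ l₀).2 n hm
    have h8 := congrArg (fun x : ℝ => (x : ℂ)) h7
    push_cast at h8
    rw [h3, h8, bandInd, Set.indicator_of_mem (show p.2 ∈ Set.Icc _ _ from hf), one_mul, mixRow]
  · intro l _ hl
    have : p.2 ∉ Set.Icc (e l.castSucc) (e l.succ) := fun h => h4 l l₀ hl ⟨h, hf⟩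
    rw [h3, bandInd, Set.indicator_of_notMem this]; simp
  · simp

theorem multiBandInterp_ae_eq (U : Matrix (Fin N) (Fin M) ℝ) (e : Fin (L + 1) → ℝ)
    (Γ : Fin L → Finset (Fin M)) (Ξ : Fin L → Finset (Fin N)) (τ : Fin L → Fin N → ℝ)
    (J : Lp ℂ 2 (specMeasure S) →ₗᵢ[ℂ] Lp ℂ 2 P) (K : ℕ) (n : Fin N) (t : ℝ) :
    multiBandInterp U e Γ Ξ τ
      (fun l n t => J (modulate t (bandVec S (e l.castSucc) (e l.succ) (mixRow U n)))) K n t =ᵐ[P]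
    J (∑ l, ∑ j : Ξ l, (spatialInterp U (Γ l) (Ξ l) n j : ℂ) •
      interpVec S e l (τ l j) (mixRow U j) t K) := by
  simp only [map_sum, map_smul]
  have h1 : ∀ (l : Fin L) (j : Fin N), J (interpVec S e l (τ l j) (mixRow U j) t K) =ᵐ[P] fun ω =>
      ∑ k ∈ Finset.Icc (-(K : ℤ)) K,
        J (modulate (instant e τ l j k) (bandVec S (e l.castSucc) (e l.succ) (mixRow U j))) ω *
        kernel e l (t - instant e τ l j k) := fun l j => by
    simp only [interpVec, map_sum, map_smul]
    filter_upwards [coeFn_sum_smul (μ := P) (Finset.Icc (-(K : ℤ)) K)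
      (fun k => kernel e l (t - (τ l j + k / width e l)))
      (fun k => J (modulate (τ l j + k / width e l)
        (bandVec S (e l.castSucc) (e l.succ) (mixRow U j))))] with ω h
    rw [h]
    exact Finset.sum_congr rfl fun k _ => mul_comm _ _
  filter_upwards [Lp.coeFn_finsetSum Finset.univ fun l => ∑ j : Ξ l,
      (spatialInterp U (Γ l) (Ξ l) n j : ℂ) • J (interpVec S e l (τ l j) (mixRow U j) t K),
    ae_all_iff.2 fun l : Fin L => coeFn_sum_smul (μ := P) Finset.univ
      (fun j : Ξ l => (spatialInterp U (Γ l) (Ξ l) n j : ℂ))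
      (fun j => J (interpVec S e l (τ l j) (mixRow U j) t K)),
    ae_all_iff.2 fun l => ae_all_iff.2 fun j => h1 l j] with ω h2 h3 h4
  rw [h2, Finset.sum_apply, multiBandInterp]
  refine Finset.sum_congr rfl fun l _ => ?_
  rw [h3]
  refine Finset.sum_congr rfl fun j _ => ?_
  rw [h4]

theorem multiBand_reconstruction (hN : 0 < N)
    (hJ : ∀ m t, J (expLp S t (unitVec m)) = (hA m t).toLp (A m t))
    (hS : ∀ m, Integrable (S m)) (h0 : ∀ m f, 0 ≤ S m f) {B : Fin M → Set ℝ}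
    (hB : ∀ m, ∀ f, f ∉ B m → S m f = 0) (hBfin : totalBandwidth B < ∞)
    {U : Matrix (Fin N) (Fin M) ℝ} (hU : U.rank = M)
    {e : Fin (L + 1) → ℝ} {Γ : Fin L → Finset (Fin M)} (hdiv : IsSubbandDivision B e Γ)
    {Ξ : Fin L → Finset (Fin N)} (hΞ : IsChannelSelection U Γ Ξ) (τ : Fin L → Fin N → ℝ) :
    samplingDensity N (multiBandSet e Ξ τ) = totalBandwidth B / N ∧
      ∃ Y : Fin L → Fin N → ℝ → Ω → ℂ,
        (∀ l n, IsConvolution P (bandPass (e l.castSucc) (e l.succ)) (mix U A n) (Y l n)) ∧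
        (∀ l n, IsFilterOutput P (mix U A) (Y l n)) ∧
        ∃ Xhat : Fin N → ℝ → Ω → ℂ,
          (∀ n t, IsLinearReconstruction P
            (fun s : multiBandSet e Ξ τ => Y s.1.1.1 s.1.1.2 s.1.2) (Xhat n t)) ∧
          (∀ n t, Tendsto (fun K : ℕ => eLpNorm (fun ω =>
            Xhat n t ω - multiBandInterp U e Γ Ξ τ Y K n t ω) 2 P) atTop (𝓝 0)) ∧
          ∀ n t, mse P (mix U A n t) (Xhat n t) = 0 := by
  refine ⟨?_, fun l n t => J (modulate t (bandVec S (e l.castSucc) (e l.succ) (mixRow U n))),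
    fun l n => isConvolution_bandPass hJ hS (hdiv.1 l.castSucc_lt_succ) U n,
    fun l n => isFilterOutput_modulate hJ hS h0 hB hBfin hU _, ?_⟩
  · rw [samplingDensity_multiBandSet hN hdiv.1, totalBandwidth_eq hdiv]
    simp_rw [(hΞ _).1]
  let x : ℕ → Fin N → ℝ → Lp ℂ 2 P := fun K n t => J (∑ l, ∑ j : Ξ l,
    (spatialInterp U (Γ l) (Ξ l) n j : ℂ) • interpVec S e l (τ l j) (mixRow U j) t K)
  have hlim : ∀ n t, Tendsto (fun K => x K n t) atTop (𝓝 (J (expLp S t (mixRow U n)))) := by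
    intro n t
    refine (J.continuous.tendsto _).comp ?_
    rw [← sum_spatialInterp_smul_modulate hS hB hdiv hΞ n t]
    exact tendsto_finsetSum _ fun l _ => tendsto_finsetSum _ fun j _ =>
      (tendsto_interpVec hS hdiv.1 l (τ l j) (mixRow U j) t).const_smul _
  have hY : ∀ s : multiBandSet e Ξ τ, MemLp (J (modulate s.1.2
      (bandVec S (e s.1.1.1.castSucc) (e s.1.1.1.succ) (mixRow U s.1.1.2)))) 2 P :=
    fun s => Lp.memLp _
  -- The partial interpolations are finite combinations of the samples and converge to X(n,t), which
  -- thereby lies in the closed span.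
  have hmem : ∀ n t, J (expLp S t (mixRow U n)) ∈ (Submodule.span ℂ (Set.range fun s =>
      (hY s).toLp _)).topologicalClosure := by
    intro n t
    refine (Submodule.isClosed_topologicalClosure _).mem_of_tendsto (hlim n t)
      (Eventually.of_forall fun K => Submodule.le_topologicalClosure _ ?_)
    simp only [x, map_sum, map_smul, interpVec]
    refine Submodule.sum_mem _ fun l _ => Submodule.sum_mem _ fun j _ =>
      Submodule.smul_mem _ _ (Submodule.sum_mem _ fun k _ => Submodule.smul_mem _ _
        (Submodule.subset_span ?_))
    exact ⟨⟨((l, j), τ l j + k / width e l), j.2, k, rfl⟩, Lp.toLp_coeFn _ _⟩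
  choose Xhat hX hXe using fun n t => exists_isLinearReconstruction hY (hmem n t)
  refine ⟨Xhat, hX, fun n t => ?_, fun n t => mse_eq_zero_of_ae_eq ?_⟩
  · have h : ∀ K, eLpNorm (fun ω => Xhat n t ω - multiBandInterp U e Γ Ξ τ
        (fun l n t => J (modulate t (bandVec S (e l.castSucc) (e l.succ) (mixRow U n)))) K n t ω)
        2 P = ENNReal.ofReal ‖J (expLp S t (mixRow U n)) - x K n t‖ := fun K => by
      rw [Lp.norm_def, ENNReal.ofReal_toReal (Lp.eLpNorm_ne_top _)]
      refine eLpNorm_congr_ae ?_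
      filter_upwards [hXe n t, multiBandInterp_ae_eq U e Γ Ξ τ J K n t,
        Lp.coeFn_sub (J (expLp S t (mixRow U n))) (x K n t)] with ω h1 h2 h3
      rw [h1, h2, h3, Pi.sub_apply]
    simp_rw [h]
    have h2 := ((tendsto_const_nhds (x := J (expLp S t (mixRow U n)))).sub (hlim n t)).norm
    simpa using ENNReal.tendsto_ofReal h2
  · refine EventuallyEq.trans ?_ (hXe n t).symm
    rw [isometry_expLp_mixRow hJ]
    exact (memLp_mix hA U n t).coeFn_toLp.symm

end

section

/-! ### Underdetermined systems with measurable coefficients -/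

/-- An underdetermined linear system whose coefficients are measurable functions has a bounded
measurable solution that does not vanish almost everywhere. -/
theorem exists_measurable_kernel {α p q : Type*} [MeasurableSpace α] {ν : Measure α} (hν : ν ≠ 0)
    [Fintype p] [Fintype q] (hcard : Fintype.card p < Fintype.card q) {a : p → q → α → ℂ}
    (ha : ∀ i j, AEStronglyMeasurable (a i j) ν) :
    ∃ x : q → α → ℂ, (∀ j, Measurable (x j)) ∧ (∀ j w, ‖x j w‖ ≤ 1) ∧
      (∀ i, ∀ᵐ w ∂ν, ∑ j, a i j w * x j w = 0) ∧ ∃ j, ¬ ∀ᵐ w ∂ν, x j w = 0 := by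
  have : NeZero ν := ⟨hν⟩
  -- Measurable functions modulo almost everywhere equality form a commutative ring, realized below
  -- as a subring of germs and nontrivial as ν ≠ 0. Over such a ring a linear map into a free module
  -- of smaller rank is not injective, so no pointwise selection of kernel vectors is needed.
  let Mf : Subring (α → ℂ) :=
    { carrier := {f | Measurable f}
      mul_mem' := fun {f g} (hf : Measurable f) (hg : Measurable g) => hf.mul hg
      one_mem' := measurable_one
      add_mem' := fun {f g} (hf : Measurable f) (hg : Measurable g) => hf.add hg
      zero_mem' := measurable_zero
      neg_mem' := fun {f} (hf : Measurable f) => hf.neg }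
  let θ : Mf →+* (ae ν).Germ ℂ := (Germ.coeRingHom (ae ν)).comp Mf.subtype
  have hnt : Nontrivial θ.range := inferInstance
  let Φ : (q → θ.range) →ₗ[θ.range] (p → θ.range) := Matrix.mulVecLin
    (Matrix.of fun i j => θ.rangeRestrict ⟨(ha i j).mk _, (ha i j).measurable_mk⟩)
  have hnot : ¬ Function.Injective Φ := fun h =>
    absurd (card_le_of_injective _ Φ h) (not_le.2 hcard)
  obtain ⟨X, hX, hX0⟩ : ∃ X, Φ X = 0 ∧ X ≠ 0 := by
    rw [← LinearMap.ker_eq_bot, Submodule.eq_bot_iff] at hnot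
    push Not at hnot
    obtain ⟨X, h1, h2⟩ := hnot
    exact ⟨X, h1, h2⟩
  choose Y hY using fun j => θ.rangeRestrict_surjective (X j)
  -- Division of all components by one positive measurable function makes them bounded and preserves
  -- the equations and the zero sets.
  have hw : ∀ w, (0 : ℝ) < 1 + ∑ j, ‖(Y j).1 w‖ := fun w => by
    have : 0 ≤ ∑ j, ‖(Y j).1 w‖ := Finset.sum_nonneg fun _ _ => norm_nonneg _
    linarith
  have hYm : ∀ j, Measurable (Y j).1 := fun j => (Y j).2
  refine ⟨fun j w => (Y j).1 w / ((1 + ∑ j, ‖(Y j).1 w‖ : ℝ) : ℂ), fun j => by fun_prop,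
    fun j w => ?_, fun i => ?_, ?_⟩
  · rw [norm_div, Complex.norm_real, Real.norm_eq_abs, abs_of_pos (hw w), div_le_one (hw w)]
    have := Finset.single_le_sum (f := fun j => ‖(Y j).1 w‖) (fun _ _ => norm_nonneg _)
      (Finset.mem_univ j)
    linarith
  · have h1 : θ (∑ j, ⟨(ha i j).mk _, (ha i j).measurable_mk⟩ * Y j) = 0 := by
      have h := congrArg Subtype.val (congrFun hX i)
      rw [Matrix.mulVecLin_apply, Matrix.mulVec, dotProduct] at h
      simp_rw [← hY, Matrix.of_apply, ← map_mul] at h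
      rw [← map_sum] at h
      exact h
    have h2 : (fun w => ∑ j, (ha i j).mk _ w * (Y j).1 w) =ᵐ[ν] 0 := by
      have h3 := Germ.coe_eq.1 (show ((_ : α → ℂ) : (ae ν).Germ ℂ) = ((0 : α → ℂ)) from h1)
      filter_upwards [h3] with w h
      rw [← h]
      simp [Finset.sum_apply]
    filter_upwards [h2, ae_all_iff.2 fun j => (ha i j).ae_eq_mk] with w h3 h4
    simp_rw [mul_div_assoc', h4]
    rw [← Finset.sum_div, h3]; simp
  · by_contra! hcon
    refine hX0 (funext fun j => ?_)
    rw [← hY]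
    refine Subtype.ext (Germ.coe_eq.2 ?_)
    filter_upwards [hcon j] with w h
    rcases div_eq_zero_iff.1 h with h | h
    · exact h
    · exact absurd (Complex.ofReal_eq_zero.1 h) (hw w).ne'

/-! ### Boxes in a finitely generated group of real numbers -/

/-- A sequence of polynomial growth has some almost constant stretch of a given length. -/
theorem exists_le_mul_of_polynomial_growth {a : ℕ → ℕ} {K : ℕ} (h1 : ∀ n, 1 ≤ a n)
    (h2 : ∀ n, a n ≤ (2 * n + 1) ^ K) (k : ℕ) {r : ℝ} (hr : 1 < r) :
    ∃ n, (a (n + k) : ℝ) ≤ r * a n := by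
  by_contra! hcon
  -- Otherwise the sequence would grow geometrically along the multiples of k.
  have hge : ∀ j : ℕ, r ^ j ≤ a (j * k) := by
    intro j
    induction j with
    | zero => simpa using h1 0
    | succ j ih =>
      rw [pow_succ, mul_comm, Nat.succ_mul]
      exact (mul_le_mul_of_nonneg_left ih (by linarith)).trans (hcon (j * k)).le
  have hlim := (tendsto_pow_const_div_const_pow_of_one_lt K hr).const_mul
    ((2 * (k : ℝ) + 1) ^ K)
  rw [mul_zero] at hlim
  obtain ⟨j, hj, hj1⟩ := ((hlim.eventually (gt_mem_nhds one_pos)).and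
    (eventually_ge_atTop 1)).exists
  have hrj : 0 < r ^ j := by positivity
  have hle : r ^ j ≤ (2 * (k : ℝ) + 1) ^ K * (j : ℝ) ^ K := by
    refine (hge j).trans ?_
    rw [← mul_pow]
    calc (a (j * k) : ℝ) ≤ (2 * (j * k : ℕ) + 1 : ℝ) ^ K := by exact_mod_cast h2 (j * k)
      _ ≤ _ := by
        have : (1 : ℝ) ≤ j := by exact_mod_cast hj1
        have hk : (0 : ℝ) ≤ k := by positivity
        push_cast
        gcongr
        nlinarith
  rw [mul_div_assoc', div_lt_one hrj] at hj
  exact absurd hle (not_le.2 hj)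

/-- The combinations of the numbers `s i` with integral coefficients between `-n` and `n`. -/
noncomputable def box {K : ℕ} (s : Fin K → ℝ) (n : ℕ) : Finset ℝ :=
  (Fintype.piFinset fun _ : Fin K => Finset.Icc (-(n : ℤ)) n).image fun z => ∑ i, z i * s i

variable {K : ℕ}

theorem card_box_le (s : Fin K → ℝ) (n : ℕ) : (box s n).card ≤ (2 * n + 1) ^ K := by
  refine Finset.card_image_le.trans ?_
  rw [Fintype.card_piFinset]
  simp only [Int.card_Icc, Finset.prod_const, Finset.card_univ, Fintype.card_fin]
  refine Nat.pow_le_pow_left ?_ K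
  omega

theorem one_le_card_box (s : Fin K → ℝ) (n : ℕ) : 1 ≤ (box s n).card := by
  refine Finset.card_pos.2 ⟨0, Finset.mem_image.2 ⟨0, ?_, by simp⟩⟩
  simp [Fintype.mem_piFinset]

/-- Reducing a point modulo one generator in at most k₀ steps leads out of the box only into the box
enlarged by k₀, which for suitable n is hardly larger. -/
theorem add_mul_mem_box {s : Fin K → ℝ} {n k₀ : ℕ} {x : ℝ} (hx : x ∈ box s n) (i : Fin K) {k : ℤ}
    (hk : |k| ≤ k₀) : x + k * s i ∈ box s (n + k₀) := by
  obtain ⟨z, hz, rfl⟩ := Finset.mem_image.1 hx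
  rw [Fintype.mem_piFinset] at hz
  refine Finset.mem_image.2 ⟨z + Pi.single i k, ?_, ?_⟩
  · rw [Fintype.mem_piFinset]
    intro j
    have hj := Finset.mem_Icc.1 (hz j)
    rw [abs_le] at hk
    rw [Finset.mem_Icc, Pi.add_apply]
    by_cases h : j = i
    · subst h; rw [Pi.single_eq_same]; push_cast; constructor <;> linarith [hj.1, hj.2]
    · rw [Pi.single_eq_of_ne h]; push_cast; constructor <;> linarith [hj.1, hj.2]
  · simp only [Pi.add_apply, Int.cast_add, add_mul, Finset.sum_add_distrib]
    congr 1
    rw [Finset.sum_eq_single i]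
    · simp
    · intro j _ h; simp [Pi.single_eq_of_ne h]
    · simp

end

/-! ### Frequency shifts, alias classes and the counting argument -/

section

variable {K M : ℕ}

/-- Truncating measurable sets to a large interval hardly changes their total measure. -/
theorem exists_lt_sum_volume_inter {B : Fin M → Set ℝ} {c : ℝ≥0∞}
    (hlt : c < ∑ m, volume (B m)) :
    ∃ W : ℕ, c < ∑ m, volume (B m ∩ Set.Icc (-(W : ℝ)) W) := by
  have h : Tendsto (fun W : ℕ => ∑ m, volume (B m ∩ Set.Icc (-(W : ℝ)) W)) atTop
      (𝓝 (∑ m, volume (B m))) := by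
    refine tendsto_finsetSum _ fun m _ => ?_
    have hmono : Monotone fun W : ℕ => B m ∩ Set.Icc (-(W : ℝ)) W := fun a b hab =>
      Set.inter_subset_inter_right _ (Set.Icc_subset_Icc (by simpa using hab) (by simpa using hab))
    have h1 := tendsto_measure_iUnion_atTop (μ := volume) hmono
    have h2 : (⋃ W : ℕ, B m ∩ Set.Icc (-(W : ℝ)) W) = B m := by
      refine Set.Subset.antisymm (Set.iUnion_subset fun _ => Set.inter_subset_left) fun x hx => ?_
      obtain ⟨n, hn⟩ := exists_nat_ge |x|
      exact Set.mem_iUnion.2 ⟨n, hx, abs_le.1 hn⟩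
    rwa [h2] at h1
  exact (h.eventually (lt_mem_nhds hlt)).exists

/-- Translation invariance makes the integrated number of hits independent of the shifts. -/
theorem lintegral_card_filter {ι : Type*} (F : Finset ι) (x : ι → ℝ) {E : ι → Set ℝ}
    (hE : ∀ p, MeasurableSet (E p)) [∀ f, DecidablePred fun p => f + x p ∈ E p] :
    ∫⁻ f, ((F.filter fun p => f + x p ∈ E p).card : ℝ≥0∞) = ∑ p ∈ F, volume (E p) := by
  have h : ∀ f, ((F.filter fun p => f + x p ∈ E p).card : ℝ≥0∞) =
      ∑ p ∈ F, ((fun f => f + x p) ⁻¹' E p).indicator 1 f := by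
    intro f
    rw [Finset.card_filter, Nat.cast_sum]
    refine Finset.sum_congr rfl fun p _ => ?_
    by_cases hp : f + x p ∈ E p
    · rw [if_pos hp, Set.indicator_of_mem (by exact hp)]; simp
    · rw [if_neg hp, Set.indicator_of_notMem (by exact hp)]; simp
  have hm : ∀ p, MeasurableSet ((fun f => f + x p) ⁻¹' E p) := fun p =>
    (measurable_add_const (x p)) (hE p)
  simp_rw [h]
  rw [lintegral_finsetSum _ fun p _ => measurable_one.indicator (hm p)]
  refine Finset.sum_congr rfl fun p _ => ?_
  rw [lintegral_indicator_one (hm p), measure_preimage_add_right]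

/-- If the total measure of the sets `E m` exceeds that of the fundamental domains `[0, s i)`,
then on a set of positive measure more points of a large box are hit than classes modulo the
numbers `s i`. -/
theorem exists_box_volume_ne_zero {E : Fin M → Set ℝ} (hE : ∀ m, MeasurableSet (E m))
    (s : Fin K → ℝ) (hs : ∀ i, 0 < s i) (hfin : ∑ m, volume (E m) ≠ ∞)
    (hlt : ENNReal.ofReal (∑ i, s i) < ∑ m, volume (E m)) (k₀ : ℕ) :
    ∃ n : ℕ, ∃ Q : ℝ → Finset (Fin M × ℝ), ∃ R : ℝ → Fin K → Finset ℝ,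
      (∀ f p, p ∈ Q f ↔ p.2 ∈ box s n ∧ f + p.2 ∈ E p.1) ∧
      (∀ f i x, x ∈ R f i ↔ x ∈ box s (n + k₀) ∧ f + x ∈ Set.Ico 0 (s i)) ∧
      (∀ f, Q f ⊆ Finset.univ ×ˢ box s n) ∧
      volume {f | ∑ i, (R f i).card < (Q f).card} ≠ 0 := by
  classical
  obtain ⟨b, hb⟩ : ∃ b : NNReal, (b : ℝ≥0∞) = ∑ m, volume (E m) := ⟨_, ENNReal.coe_toNNReal hfin⟩
  have hs0 : 0 ≤ ∑ i, s i := Finset.sum_nonneg fun i _ => (hs i).le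
  have hlt' : ∑ i, s i < b := by
    rw [← hb, ← ENNReal.ofReal_coe_nnreal] at hlt
    exact (ENNReal.ofReal_lt_ofReal_iff_of_nonneg hs0).1 hlt
  -- The factor r is the growth of the box that the gap between the two totals can absorb.
  obtain ⟨r, hr1, hr⟩ : ∃ r : ℝ, 1 < r ∧ r * ∑ i, s i < b := by
    have h : Tendsto (fun r : ℝ => r * ∑ i, s i) (𝓝[>] 1) (𝓝 (1 * ∑ i, s i)) :=
      ((continuous_id.mul continuous_const).tendsto 1).mono_left nhdsWithin_le_nhds
    rw [one_mul] at h
    obtain ⟨r, h1, h2⟩ := ((h.eventually (gt_mem_nhds hlt')).and self_mem_nhdsWithin).exists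
    exact ⟨r, h2, h1⟩
  obtain ⟨n, hn⟩ := exists_le_mul_of_polynomial_growth (one_le_card_box s) (card_box_le s) k₀ hr1
  refine ⟨n, fun f => (Finset.univ ×ˢ box s n).filter fun p => f + p.2 ∈ E p.1,
    fun f i => (box s (n + k₀)).filter fun x => f + x ∈ Set.Ico 0 (s i), fun f p => by simp,
    fun f i x => by simp, fun f => Finset.filter_subset _ _, fun h0 => ?_⟩
  -- If classes outnumbered hits almost everywhere in the weak sense, integration would give |box n|
  -- · b ≤ |box (n + k₀)| · Σ sᵢ ≤ r · |box n| · Σ sᵢ, against r · Σ sᵢ < b.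
  have hle : ∀ᵐ f : ℝ, ((((Finset.univ ×ˢ box s n).filter
      fun p : Fin M × ℝ => f + p.2 ∈ E p.1).card : ℕ) : ℝ≥0∞) ≤
      ∑ i, (((box s (n + k₀)).filter fun x => f + x ∈ Set.Ico 0 (s i)).card : ℝ≥0∞) := by
    filter_upwards [measure_eq_zero_iff_ae_notMem.1 h0] with f hf
    rw [not_lt] at hf
    exact_mod_cast hf
  have hI := lintegral_mono_ae hle
  have hmeas : ∀ i : Fin K, Measurable fun f : ℝ =>
      (((box s (n + k₀)).filter fun x => f + x ∈ Set.Ico 0 (s i)).card : ℝ≥0∞) := by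
    intro i
    simp_rw [Finset.card_filter, Nat.cast_sum]
    refine Finset.measurable_sum _ fun x _ => ?_
    have : MeasurableSet {f : ℝ | f + x ∈ Set.Ico 0 (s i)} :=
      (measurable_add_const x) measurableSet_Ico
    exact Measurable.comp (g := fun k : ℕ => (k : ℝ≥0∞)) measurable_from_top
      (Measurable.ite this measurable_const measurable_const)
  rw [lintegral_card_filter _ (fun p : Fin M × ℝ => p.2) (E := fun p => E p.1) fun p => hE p.1,
    lintegral_finsetSum _ fun i _ => hmeas i, Finset.sum_product] at hI
  simp_rw [fun i => lintegral_card_filter (box s (n + k₀)) (fun x => x)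
    (E := fun _ => Set.Ico 0 (s i)) fun _ => measurableSet_Ico, Finset.sum_const,
    nsmul_eq_mul, Real.volume_Ico, sub_zero] at hI
  rw [← Finset.mul_sum, ← Finset.mul_sum, ← ENNReal.ofReal_sum_of_nonneg fun i _ => (hs i).le,
    ← hb, ← ENNReal.ofReal_coe_nnreal, ← ENNReal.ofReal_natCast, ← ENNReal.ofReal_natCast,
    ← ENNReal.ofReal_mul (by positivity), ← ENNReal.ofReal_mul (by positivity),
    ENNReal.ofReal_le_ofReal_iff (by positivity)] at hI
  have hn0 : (0 : ℝ) < (box s n).card := by exact_mod_cast one_le_card_box s n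
  have h1 : ((box s (n + k₀)).card : ℝ) * ∑ i, s i ≤ r * (box s n).card * ∑ i, s i :=
    mul_le_mul_of_nonneg_right hn hs0
  nlinarith

/-- The combinatorial pattern behind the density bound: a finite set of pairs (source, shift) and
a set `D` of positive measure such that all shifts of `D` lie in the corresponding sets `B m`,
the shifts of `D` are disjoint, and there are fewer classes of shifts modulo the numbers `s i` than
pairs. -/
theorem exists_pattern {B : Fin M → Set ℝ} (hB : ∀ m, MeasurableSet (B m)) {s : Fin K → ℝ}
    (hs : ∀ i, 0 < s i) (hlt : ENNReal.ofReal (∑ i, s i) < ∑ m, volume (B m)) :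
    ∃ (Q : Finset (Fin M × ℝ)) (D : Set ℝ) (R : Fin K → Finset ℝ) (cls : Fin K → ℝ → ℝ),
      MeasurableSet D ∧ volume D ≠ 0 ∧ (∀ q ∈ Q, ∀ f ∈ D, f + q.2 ∈ B q.1) ∧
      ∑ i, (R i).card < Q.card ∧
      (∀ i, ∀ q ∈ Q, cls i q.2 ∈ R i ∧ ∃ j : ℤ, q.2 = cls i q.2 + j * s i) ∧
      ∀ q ∈ Q, ∀ q' ∈ Q, q.2 ≠ q'.2 → ∀ f ∈ D, f + q.2 - q'.2 ∉ D := by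
  obtain ⟨W, hW⟩ := exists_lt_sum_volume_inter hlt
  have hEfin : ∑ m, volume (B m ∩ Set.Icc (-(W : ℝ)) W) ≠ ∞ :=
    (ENNReal.sum_lt_top.2 fun m _ => (measure_mono Set.inter_subset_right).trans_lt
      measure_Icc_lt_top).ne
  -- A point of [-W, W] reaches the fundamental domain [0, sᵢ) in at most W/sᵢ + 1 steps of length
  -- sᵢ.
  obtain ⟨k₀, hk₀⟩ : ∃ k₀ : ℕ, ∀ i, W / s i + 1 ≤ k₀ := by
    have h : ∀ᶠ k : ℕ in atTop, ∀ i, (W / s i + 1 : ℝ) ≤ k :=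
      eventually_all.2 fun i => tendsto_natCast_atTop_atTop.eventually_ge_atTop _
    exact h.exists
  obtain ⟨n, Q, R, hQ, hR, hQsub, hpos⟩ := exists_box_volume_ne_zero
    (fun m => (hB m).inter measurableSet_Icc) s hs hEfin hW k₀
  -- δ is smaller than every gap of the box, so a set of base frequencies inside one cell of length
  -- δ has disjoint shifts.
  obtain ⟨δ, hδ, hδ0⟩ : ∃ δ : ℝ, (∀ p ∈ (box s n).offDiag, δ < |p.1 - p.2|) ∧ 0 < δ := by
    have h : ∀ᶠ δ : ℝ in 𝓝[>] 0, ∀ p ∈ (box s n).offDiag, δ < |p.1 - p.2| := by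
      rw [Filter.eventually_all_finset]
      intro p hp
      refine nhdsWithin_le_nhds (gt_mem_nhds (abs_pos.2 (sub_ne_zero.2 ?_)))
      exact (Finset.mem_offDiag.1 hp).2.2
    exact (h.and self_mem_nhdsWithin).exists
  -- Pigeonhole: there are finitely many values of Q f and countably many cells, so one combination
  -- has positive measure.
  obtain ⟨⟨Q₀, j⟩, hQj⟩ : ∃ x : (Finset.univ ×ˢ box s n : Finset (Fin M × ℝ)).powerset × ℤ,
      volume {f | ∑ i, (R f i).card < (Q f).card ∧ Q f = x.1 ∧ ⌊f / δ⌋ = x.2} ≠ 0 := by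
    by_contra! hcon
    refine hpos (measure_mono_null ?_ (measure_iUnion_null hcon))
    intro f hf
    exact Set.mem_iUnion.2 ⟨⟨⟨Q f, Finset.mem_powerset.2 (hQsub f)⟩, ⌊f / δ⌋⟩, hf, rfl, rfl⟩
  obtain ⟨f₀, h0, hf0, -⟩ := nonempty_of_measure_ne_zero hQj
  have hQbox : ∀ q ∈ Q₀.1, q.2 ∈ box s n := fun q hq =>
    (Finset.mem_product.1 (Finset.mem_powerset.1 Q₀.2 hq)).2
  -- The class of a shift x is represented by the translate of x modulo sᵢ that puts f₀ + x into [0,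
  -- sᵢ). The single base point f₀ suffices for all of D, since congruence of shifts does not depend
  -- on the base frequency.
  refine ⟨Q₀.1, {f | ∀ q ∈ Q₀.1, f + q.2 ∈ B q.1} ∩ {f | ⌊f / δ⌋ = j}, R f₀,
    fun i x => x - ⌊(f₀ + x) / s i⌋ * s i, ?_, ?_, fun q hq f hf => hf.1 q hq, by rwa [← hf0],
    fun i q hq => ⟨(hR _ _ _).2 ⟨?_, ?_, ?_⟩, ⌊(f₀ + q.2) / s i⌋, by ring⟩, ?_⟩
  · refine MeasurableSet.inter ?_ ?_
    · rw [show {f : ℝ | ∀ q ∈ Q₀.1, f + q.2 ∈ B q.1} = ⋂ q ∈ Q₀.1, (fun f => f + q.2) ⁻¹' B q.1 by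
        ext f; simp]
      exact Finset.measurableSet_biInter _ fun q _ => (measurable_add_const q.2) (hB q.1)
    · exact (Int.measurable_floor.comp (measurable_id.div_const δ)) (measurableSet_singleton j)
  · refine fun h => hQj (measure_mono_null ?_ h)
    refine fun f hf => ⟨fun q hq => ?_, hf.2.2⟩
    rw [← hf.2.1] at hq
    exact ((hQ _ _).1 hq).2.1
  · have hq' := ((hQ f₀ q).1 (by rwa [hf0])).2.2
    have habs : |(f₀ + q.2) / s i| ≤ W / s i := by
      rw [abs_div, abs_of_pos (hs i)]
      exact div_le_div_of_nonneg_right (abs_le.2 hq') (hs i).le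
    have hle := hk₀ i
    have hfl := Int.floor_le ((f₀ + q.2) / s i)
    have hfl' := Int.lt_floor_add_one ((f₀ + q.2) / s i)
    rw [abs_le] at habs
    have := add_mul_mem_box (hQbox q hq) i (k := -⌊(f₀ + q.2) / s i⌋) (k₀ := k₀) (by
      rw [abs_le]
      constructor
      · have : ((⌊(f₀ + q.2) / s i⌋ : ℤ) : ℝ) ≤ (k₀ : ℤ) := by push_cast; linarith
        have := Int.cast_le.1 this
        linarith
      · have : ((-⌊(f₀ + q.2) / s i⌋ : ℤ) : ℝ) ≤ (k₀ : ℤ) := by push_cast; linarith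
        exact Int.cast_le.1 this)
    rw [Int.cast_neg, neg_mul, ← sub_eq_add_neg] at this
    exact this
  · have := (le_div_iff₀ (hs i)).1 (Int.floor_le ((f₀ + q.2) / s i))
    linarith
  · have := (div_lt_iff₀ (hs i)).1 (Int.lt_floor_add_one ((f₀ + q.2) / s i))
    linarith
  · intro q hq q' hq' hne f hf hf'
    have h1 := hδ (q.2, q'.2) (Finset.mem_offDiag.2 ⟨hQbox q hq, hQbox q' hq', hne⟩)
    have h2 := Int.abs_sub_lt_one_of_floor_eq_floor
      ((show ⌊(f + q.2 - q'.2) / δ⌋ = j from hf'.2).trans (show ⌊f / δ⌋ = j from hf.2).symm)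
    rw [← sub_div, abs_div, abs_of_pos hδ0, div_lt_one hδ0,
      show f + q.2 - q'.2 - f = q.2 - q'.2 by ring] at h2
    exact lt_asymm h1 h2

end

/-! ### Spectra orthogonal to all samples -/

section

variable {K M : ℕ}

theorem cexpi_add_left (f g t : ℝ) : cexpi (f + g) t = cexpi f t * cexpi g t := by
  rw [cexpi, cexpi, cexpi, ← Complex.exp_add]
  congr 1
  push_cast
  ring

/-- Aliasing: shifts by multiples of 1/T are invisible on the grid Tℤ. -/
theorem cexpi_int_div_mul {T : ℝ} (hT : T ≠ 0) (j k : ℤ) : cexpi (j * T⁻¹) (k * T) = 1 := by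
  rw [cexpi, Complex.exp_eq_one_iff]
  refine ⟨j * k, ?_⟩
  have : (T : ℂ) ≠ 0 := by exact_mod_cast hT
  push_cast
  field_simp

/-- If the uniform sampling rates add up to less than the total bandwidth, some nonzero bounded
function is orthogonal to all modulations of finitely many given spectra along the grids. -/
theorem exists_orthogonal_function {B : Fin M → Set ℝ} (hB : ∀ m, MeasurableSet (B m))
    {T : Fin K → ℝ} (hT : ∀ i, 0 < T i) (τ : Fin K → ℝ)
    (hlt : ENNReal.ofReal (∑ i, (T i)⁻¹) < ∑ m, volume (B m)) {ψ : Fin K → Fin M → ℝ → ℂ}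
    (hψ : ∀ i m, Integrable (ψ i m)) :
    ∃ g : Fin M → ℝ → ℂ, (∀ m, Measurable (g m)) ∧ (∃ C : ℝ, ∀ m f, ‖g m f‖ ≤ C) ∧
      (∃ m, ¬ ∀ᵐ f, f ∈ B m → g m f = 0) ∧
      ∀ i (k : ℤ), ∑ m, ∫ f, g m f * (ψ i m f * cexpi f (τ i + k * T i)) = 0 := by
  classical
  obtain ⟨Q, D, R, cls, hD, hD0, hQD, hcard, hcls, hsep⟩ :=
    exists_pattern hB (fun i => inv_pos.2 (hT i)) hlt
  have hmeas : ∀ (i : Fin K) (q : Fin M × ℝ), AEStronglyMeasurable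
      (fun f => ψ i q.1 (f + q.2) * cexpi (f + q.2) (τ i)) := fun i q =>
    ((hψ i q.1).comp_add_right q.2).1.mul (by unfold cexpi; fun_prop)
  -- One unknown function on D for each pair in Q, and one equation for each filter i and alias
  -- class. Only the offset τᵢ enters the coefficients, as the grid index k contributes the same
  -- factor throughout a class.
  obtain ⟨x, hxm, hx1, hx0, q₀, hq₀⟩ := exists_measurable_kernel (ν := volume.restrict D)
    (p := (i : Fin K) × R i) (q := Q) (by rwa [Ne, Measure.restrict_eq_zero])
    (by simpa [Fintype.card_sigma] using hcard)
    (a := fun ρ q f => if cls ρ.1 q.1.2 = ρ.2 then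
      ψ ρ.1 q.1.1 (f + q.1.2) * cexpi (f + q.1.2) (τ ρ.1) else 0) (fun ρ q => by
        split_ifs
        · exact (hmeas ρ.1 q.1).restrict
        · exact aestronglyMeasurable_const)
  have hind : ∀ q f, ‖D.indicator (x q) f‖ ≤ 1 := fun q f =>
    (norm_indicator_le_norm_self _ _).trans (hx1 q f)
  -- The solution is spread over the shifted copies of D, the component of q being placed on the
  -- source q.1 at the shift q.2.
  refine ⟨fun m f => ∑ q : Q, if q.1.1 = m then D.indicator (x q) (f - q.1.2) else 0,
    fun m => ?_, ⟨Q.card, fun m f => ?_⟩, ⟨q₀.1.1, fun h => hq₀ ?_⟩, fun i k => ?_⟩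
  · refine Finset.measurable_sum _ fun q _ => ?_
    split_ifs
    · exact ((hxm q).indicator hD).comp (measurable_id.sub_const _)
    · exact measurable_const
  · refine (norm_sum_le _ _).trans ((Finset.sum_le_card_nsmul _ _ 1 fun q _ => ?_).trans ?_)
    · split_ifs
      · exact hind q _
      · simp
    · simp
  · rw [ae_restrict_iff' hD]
    filter_upwards [(measurePreserving_add_right volume q₀.1.2).quasiMeasurePreserving.ae h]
      with f hf hfD
    have h1 := hf (hQD _ q₀.2 f hfD)
    -- The copies on one source are disjoint, so nothing cancels the component q₀ on its own copy.
    rw [Finset.sum_eq_single q₀] at h1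
    · simpa [hfD] using h1
    · intro q _ hq
      split_ifs with hqm
      · refine Set.indicator_of_notMem (hsep _ q₀.2 _ q.2 (fun h => hq ?_) f hfD) _
        exact Subtype.ext (Prod.ext hqm h.symm)
      · rfl
    · simp
  · set Ψ : Fin M → ℝ → ℂ := fun m f => ψ i m f * cexpi f (τ i + k * T i) with hΨ
    have hΨi : ∀ m, Integrable (Ψ m) := fun m => by
      refine (hψ i m).mul_bdd (c := 1) (by unfold cexpi; fun_prop)
        (Eventually.of_forall fun f => (norm_cexpi _ _).le)
    have hi : ∀ (q : Q) m, Integrable fun f => D.indicator (x q) (f - q.1.2) * Ψ m f :=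
      fun q m => (hΨi m).bdd_mul (c := 1)
        (((hxm q).indicator hD).comp (measurable_id.sub_const _)).aestronglyMeasurable
        (Eventually.of_forall fun f => hind q _)
    have h1 : ∀ m, ∫ f, (∑ q : Q, if q.1.1 = m then D.indicator (x q) (f - q.1.2) else 0) * Ψ m f =
        ∑ q : Q, if q.1.1 = m then ∫ f, D.indicator (x q) (f - q.1.2) * Ψ q.1.1 f else 0 := by
      intro m
      simp_rw [Finset.sum_mul]
      rw [integral_finsetSum]
      · refine Finset.sum_congr rfl fun q _ => ?_
        split_ifs with h
        · rw [h]
        · simp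
      · intro q _
        split_ifs
        · exact hi q m
        · simp
    have h2 : ∀ q : Q, ∫ f, D.indicator (x q) (f - q.1.2) * Ψ q.1.1 f =
        ∫ f, D.indicator (x q) f * Ψ q.1.1 (f + q.1.2) := by
      intro q
      rw [← integral_add_right_eq_self _ q.1.2]
      simp_rw [add_sub_cancel_right]
    have h3 : ∀ q : Q, Integrable fun f => D.indicator (x q) f * Ψ q.1.1 (f + q.1.2) := by
      intro q
      have := (hi q q.1.1).comp_add_right q.1.2
      simpa only [add_sub_cancel_right] using this
    refine (Finset.sum_congr rfl fun m _ => h1 m).trans ?_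
    rw [Finset.sum_comm]
    simp_rw [Finset.sum_ite_eq, Finset.mem_univ, if_true, h2]
    rw [← integral_finsetSum _ fun q _ => h3 q]
    refine integral_eq_zero_of_ae ?_
    have h4 := (ae_restrict_iff' hD).1 (ae_all_iff.2 fun ρ : R i => hx0 ⟨i, ρ⟩)
    filter_upwards [h4] with f hf
    by_cases hfD : f ∈ D
    swap
    · simp [hfD]
    -- After all copies are moved back to D, the terms are grouped by alias class and each group
    -- vanishes by the system.
    have h5 : ∀ q : Q, D.indicator (x q) f * Ψ q.1.1 (f + q.1.2) = ∑ ρ : R i,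
        cexpi (f + ρ) (k * T i) * ((if cls i q.1.2 = ρ then
          ψ i q.1.1 (f + q.1.2) * cexpi (f + q.1.2) (τ i) else 0) * x q f) := by
      intro q
      obtain ⟨hR, j, hj⟩ := hcls i q.1 q.2
      have h6 : cexpi (f + q.1.2) (k * T i) = cexpi (f + cls i q.1.2) (k * T i) := by
        conv_lhs => rw [hj]
        rw [← add_assoc, cexpi_add_left, cexpi_int_div_mul (hT i).ne', mul_one]
      rw [Finset.sum_eq_single ⟨cls i q.1.2, hR⟩]
      · rw [if_pos rfl, ← h6, Set.indicator_of_mem hfD, hΨ]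
        dsimp only
        rw [cexpi_add]
        ring
      · intro ρ _ hρ
        rw [if_neg fun h => hρ (Subtype.ext h.symm)]
        simp
      · simp
    simp_rw [h5]
    rw [Finset.sum_comm]
    refine Finset.sum_eq_zero fun ρ _ => ?_
    rw [← Finset.mul_sum, hf hfD ρ, mul_zero]

end

/-! ### Minimality -/

section Minimality

variable {Ω : Type*} [MeasurableSpace Ω] {P : Measure Ω} {M N K : ℕ} {S : Fin M → ℝ → ℝ}
  [IsFiniteMeasure (specMeasure S)] {A : Fin M → ℝ → Ω → ℂ} {hA : ∀ m t, MemLp (A m t) 2 P}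
  {J : Lp ℂ 2 (specMeasure S) →ₗᵢ[ℂ] Lp ℂ 2 P}

/-- If the uniform sampling rates add up to less than the total bandwidth, some nonzero element of
the spectral space is orthogonal to the spectra of all samples. -/
theorem exists_ne_zero_inner_modulate_eq_zero (hS : ∀ m, Integrable (S m))
    (h0 : ∀ m f, 0 ≤ S m f) {B : Fin M → Set ℝ} (hB : ∀ m, MeasurableSet (B m))
    (hpos : ∀ m, ∀ᵐ f, f ∈ B m → 0 < S m f) {T : Fin K → ℝ} (hT : ∀ i, 0 < T i)
    (τ : Fin K → ℝ) (hlt : ENNReal.ofReal (∑ i, (T i)⁻¹) < totalBandwidth B)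
    (H : Fin K → Lp ℂ 2 (specMeasure S)) :
    ∃ G : Lp ℂ 2 (specMeasure S), G ≠ 0 ∧
      ∀ i (k : ℤ), inner ℂ G (modulate (τ i + k * T i) (H i)) = 0 := by
  -- Applied to the densities times the transfer functions. The element sought is the conjugate of
  -- g, since the inner product conjugates its first slot.
  obtain ⟨g, hgm, ⟨C, hC⟩, ⟨m, hm⟩, hg⟩ := exists_orthogonal_function hB hT τ hlt
    fun i m => integrable_mul_fiber hS h0 (H i) m
  have hmeas : Measurable fun p : Fin M × ℝ => (starRingEnd ℂ) (g p.1 p.2) :=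
    Complex.continuous_conj.measurable.comp
      (measurable_from_prod_countable_right fun m => hgm m)
  have hG : MemLp (fun p : Fin M × ℝ => (starRingEnd ℂ) (g p.1 p.2)) 2 (specMeasure S) :=
    MemLp.of_bound hmeas.aestronglyMeasurable C
      (Eventually.of_forall fun p => by rw [RCLike.norm_conj]; exact hC _ _)
  refine ⟨hG.toLp _, fun h => hm ?_, fun i k => ?_⟩
  · have h1 : (fun p : Fin M × ℝ => (starRingEnd ℂ) (g p.1 p.2)) =ᵐ[specMeasure S] 0 :=
      hG.coeFn_toLp.symm.trans (h ▸ Lp.coeFn_zero _ _ _)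
    -- Positivity of S_m on B_m keeps g nonzero modulo the spectral measure.
    filter_upwards [(ae_specMeasure_iff hS).1 h1 m, hpos m] with f h2 h3 h4
    exact (map_eq_zero _).1 (h2 (h3 h4))
  · have h1 : (fun p => inner ℂ (hG.toLp _ p) (modulate (τ i + k * T i) (H i) p)) =ᵐ[specMeasure S]
        fun p => g p.1 p.2 * (H i p * cexpi p.2 (τ i + k * T i)) := by
      filter_upwards [hG.coeFn_toLp, coeFn_modulate (τ i + k * T i) (H i)] with p h2 h3
      rw [h2, h3, RCLike.inner_apply, Complex.conj_conj]
      ring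
    rw [L2.inner_def, integral_congr_ae h1,
      integral_specMeasure hS h0 ((L2.integrable_inner _ _).congr h1), ← hg i k]
    refine Finset.sum_congr rfl fun m _ => integral_congr_ae (Eventually.of_forall fun f => ?_)
    dsimp only
    ring

/-- Perfect reconstruction from uniform samples behind finitely many filters needs at least the
total bandwidth. -/
theorem totalBandwidth_div_le_samplingDensity (hN : 0 < N)
    (hJ : ∀ m t, J (expLp S t (unitVec m)) = (hA m t).toLp (A m t))
    (hS : ∀ m, Integrable (S m)) (h0 : ∀ m f, 0 ≤ S m f) {B : Fin M → Set ℝ}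
    (hBmeas : ∀ m, MeasurableSet (B m)) (hB : ∀ m, ∀ f, f ∉ B m → S m f = 0)
    (hBfin : totalBandwidth B < ∞) {U : Matrix (Fin N) (Fin M) ℝ} (hU : U.rank = M)
    (hpos : ∀ m, ∀ᵐ f, f ∈ B m → 0 < S m f) {Y : Fin K → ℝ → Ω → ℂ} {T τ : Fin K → ℝ}
    (hT : ∀ i, 0 < T i) (hY : ∀ i, IsFilterOutput P (mix U A) (Y i))
    {Xhat : Fin N → ℝ → Ω → ℂ}
    (hX : ∀ n t, IsLinearReconstruction P (fun s : uniformSet T τ => Y s.1.1 s.1.2) (Xhat n t))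
    (hmse : ∀ n t, mse P (mix U A n t) (Xhat n t) = 0) :
    totalBandwidth B / N ≤ samplingDensity N (uniformSet T τ) := by
  rw [samplingDensity_uniformSet hN hT]
  refine ENNReal.div_le_div_right ?_ _
  by_contra! hlt
  choose H hH using fun i => (hY i).exists_transfer hJ
  obtain ⟨G, hG, hGH⟩ := exists_ne_zero_inner_modulate_eq_zero hS h0 hBmeas hpos hT τ hlt H
  -- Each X(n,t) equals its reconstruction almost surely and so lies in the closed span of the
  -- samples, which is orthogonal to J G. Thus G is orthogonal to a total family.
  have horth : ∀ n t, inner ℂ G (expLp S t (mixRow U n)) = 0 := by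
    intro n t
    have h1 := (hX n t).mem_topologicalClosure fun s : uniformSet T τ => (hY s.1.1).1 s.1.2
    have h2 : (Submodule.span ℂ (Set.range fun s : uniformSet T τ =>
        ((hY s.1.1).1 s.1.2).toLp (Y s.1.1 s.1.2))).topologicalClosure ≤ (ℂ ∙ J G)ᗮ := by
      refine Submodule.topologicalClosure_minimal _ (Submodule.span_le.2 ?_)
        (Submodule.isClosed_orthogonal _)
      rintro _ ⟨⟨⟨i, s⟩, k, hk⟩, rfl⟩
      obtain rfl : s = τ i + k * T i := hk
      exact Submodule.mem_orthogonal_singleton_iff_inner_right.2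
        ((congrArg (inner ℂ (J G)) (hH i _)).trans ((J.inner_map_map _ _).trans (hGH i k)))
    have h3 := Submodule.mem_orthogonal_singleton_iff_inner_right.1 (h2 h1)
    rw [← LinearIsometry.inner_map_map J, isometry_expLp_mixRow hJ, ← h3]
    congr 1
    exact MemLp.toLp_congr _ _ (ae_eq_of_mse_eq_zero (memLp_mix hA U n t) (hX n t).2.1 (hmse n t))
  refine hG (inner_self_eq_zero (𝕜 := ℂ).1 ?_)
  have h4 : (⊤ : Submodule ℂ (Lp ℂ 2 (specMeasure S))) ≤ (ℂ ∙ G)ᗮ := by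
    rw [← span_expLp_topologicalClosure_eq_top hS h0 hB hBfin hU 0]
    refine Submodule.topologicalClosure_minimal _ (Submodule.span_le.2 ?_)
      (Submodule.isClosed_orthogonal _)
    rintro _ ⟨n, t, -, rfl⟩
    exact Submodule.mem_orthogonal_singleton_iff_inner_right.2 (horth n t)
  exact Submodule.mem_orthogonal_singleton_iff_inner_right.1 (h4 trivial)

end Minimality

end CorrelatedSampling

open CorrelatedSampling in
theorem theorem1 {Ω : Type*} [MeasurableSpace Ω] (P : Measure Ω) [IsProbabilityMeasure P]
    {N M : ℕ} (hN : 0 < N)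
    (A : Fin M → ℝ → Ω → ℂ) (S : Fin M → ℝ → ℝ) (B : Fin M → Set ℝ)
    (hWSS : ∀ m, IsWSS P (A m)) (hPSD : ∀ m, HasPSD P (A m) (S m))
    (hunc : MutuallyUncorrelated P A)
    (hBmeas : ∀ m, MeasurableSet (B m)) (hBsupp : ∀ m, ∀ f, f ∉ B m → S m f = 0)
    (hBfin : totalBandwidth B < ∞)
    (U : Matrix (Fin N) (Fin M) ℝ) (hU : U.rank = M) :
    -- a sampling set of density `B / N` for the signals themselves
    (∃ 𝒮 : Set (Fin N × ℝ), samplingDensity N 𝒮 = totalBandwidth B / N ∧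
      ∃ Xhat : Fin N → ℝ → Ω → ℂ,
        (∀ n t, IsLinearReconstruction P (fun s : 𝒮 => mix U A s.1.1 s.1.2) (Xhat n t)) ∧
        ∀ n t, mse P (mix U A n t) (Xhat n t) = 0) ∧
    -- the multi-band scheme attains `B / N` with explicit interpolation
    (∀ (L : ℕ) (e : Fin (L + 1) → ℝ) (Γ : Fin L → Finset (Fin M)), IsSubbandDivision B e Γ →
      (∃ Ξ : Fin L → Finset (Fin N), IsChannelSelection U Γ Ξ) ∧
      ∀ Ξ : Fin L → Finset (Fin N), IsChannelSelection U Γ Ξ → ∀ τ : Fin L → Fin N → ℝ,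
        samplingDensity N (multiBandSet e Ξ τ) = totalBandwidth B / N ∧
        ∃ Y : Fin L → Fin N → ℝ → Ω → ℂ,
          (∀ l n, IsConvolution P (bandPass (e l.castSucc) (e l.succ)) (mix U A n) (Y l n)) ∧
          (∀ l n, IsFilterOutput P (mix U A) (Y l n)) ∧
          ∃ Xhat : Fin N → ℝ → Ω → ℂ,
            (∀ n t, IsLinearReconstruction P
              (fun s : multiBandSet e Ξ τ => Y s.1.1.1 s.1.1.2 s.1.2) (Xhat n t)) ∧
            (∀ n t, Tendsto (fun K : ℕ => eLpNorm (fun ω =>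
              Xhat n t ω - multiBandInterp U e Γ Ξ τ Y K n t ω) 2 P) atTop (𝓝 0)) ∧
            ∀ n t, mse P (mix U A n t) (Xhat n t) = 0) ∧
    -- `B / N` is minimal among uniform sampling schemes behind finitely many filters
    ((∀ m, ∀ᵐ f, f ∈ B m → 0 < S m f) →
      ∀ (K : ℕ) (Y : Fin K → ℝ → Ω → ℂ) (T τ : Fin K → ℝ), (∀ i, 0 < T i) →
        (∀ i, IsFilterOutput P (mix U A) (Y i)) →
        ∀ Xhat : Fin N → ℝ → Ω → ℂ,
          (∀ n t, IsLinearReconstruction P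
            (fun s : uniformSet T τ => Y s.1.1 s.1.2) (Xhat n t)) →
          (∀ n t, mse P (mix U A n t) (Xhat n t) = 0) →
          totalBandwidth B / N ≤ samplingDensity N (uniformSet T τ)) := by
  have hS := fun m => (hPSD m).integrable
  have h0 := fun m => (hPSD m).nonneg
  have := isFiniteMeasure_specMeasure hS
  obtain ⟨J, hJ⟩ := exists_spectral_isometry P (fun m t => (hWSS m).memLp t) hPSD hunc hBsupp hBfin
  exact ⟨exists_sampling_set hN hJ hS h0 hBsupp hBfin hU,
    fun L e Γ hdiv => ⟨exists_isChannelSelection hU Γ,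
      fun Ξ hΞ τ => multiBand_reconstruction hN hJ hS h0 hBsupp hBfin hU hdiv hΞ τ⟩,
    fun hpos K Y T τ hT hY Xhat hX hmse =>
      totalBandwidth_div_le_samplingDensity hN hJ hS h0 hBmeas hBsupp hBfin hU hpos hT hY hX hmse⟩
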